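/- Let $\mathcal H=\{z=x+iy : y>0\}$ with the measure $d\mu=dx\,dy/y^2$, and let $T_1\mathcal H=\mathcal H\times\mathbb R/2\pi\mathbb Z$ be its unit tangent bundle (the angle $\theta$ being measured counterclockwise from the vertical), on which $\begin{pmatrix}a&b\\c&d\end{pmatrix}\in\mathrm{PSL}(2,\mathbb R)$ acts by $(z,\theta)\mapsto\bigl(\tfrac{az+b}{cz+d},\,\theta-2\arg(cz+d)\bigr)$. Let $\Gamma=\overline\Gamma_1(4)$ be the image in $\mathrm{PSL}(2,\mathbb R)$ of $\Gamma_1(4)=\{\begin{pmatrix}a&b\\c&d\end{pmatrix}\in\mathrm{SL}(2,\mathbb Z): c\equiv0,\ a\equiv d\equiv1 \bmod 4\}$, and let $\mathcal F$ be a fundamental domain for $\Gamma$ in $\mathcal H$. The invariant height function is $$\mathcal Y_\Gamma(z)=\sup\{\mathrm{Im}\,NW(z) : N\in\mathcal S_\Gamma,\ W\in\Gamma\},$$ where $\mathcal S_\Gamma$ is the set of $N\in\mathrm{PSL}(2,\mathbb R)$ such that $\eta=N^{-1}\infty$ is a cusp of $\Gamma$ whose isotropy group $\Gamma_\eta$ is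 generated by $N^{-1}\begin{pmatrix}1&1\\0&1\end{pmatrix}N$. For a $\Gamma$-invariant function $f$ on $T_1\mathcal H$ put $$\langle f\rangle=\frac1{2\pi\mu(\mathcal F)}\int_{\mathcal F}\int_0^{2\pi}f(z,\theta)\,d\theta\,d\mu(z).$$ For $\nu>0$, $\gamma\ge0$ and $\alpha\in\mathbb R$, one says that $\langle\Gamma,\nu,\alpha\rangle$-$\mathrm{PSE}_\gamma$ holds if, for every continuous $\Gamma$-invariant $f:T_1\mathcal H\to\mathbb C$ with $|f(z,\theta)|\le C\,\mathcal Y_\Gamma(z)^{\gamma}$ for some constant $C>0$ and all $(z,\theta)$, and for all $0<C_1<C_2$, $$\frac1M\sum_{m=1}^M f(m\alpha+iy,0)\to\langle f\rangle$$ uniformly as $M\to\infty$ and $C_1M^{-\nu}\le y\le C_2M^{-\nu}$. Finally, for a compact interval $[a,b]\subset\mathbb R$ (with $a\le b$) and a positive integer $N$ let $$R_2([a,b],\alpha,N)=\frac1N\Bigl|\Bigl\{1\le j\ne k\le N : j^2\alpha-k^2\alpha\in\Bigl[\frac aN,\frac bN\Bigr]+\mathbb Z\Bigr\}\Bigr|.$$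 **Proposition.** (i) If $\langle\overline\Gamma_1(4),2,\alpha\rangle$-$\mathrm{PSE}_{1/2}$ holds for some $\alpha\in\mathbb R$, then for every interval $[a,b]\subset\mathbb R$ $$R_2([a,b],\alpha,N)\to b-a\qquad\text{as } N\to\infty .$$ (ii) (Rudnick–Sarnak) For Lebesgue-almost every $\alpha\in\mathbb R$, one has $R_2([a,b],\alpha,N)\to b-a$ as $N\to\infty$ for every interval $[a,b]\subset\mathbb R$. -/

import Mathlib

open Filter Topology MeasureTheory
open scoped UpperHalfPlane MatrixGroups

noncomputable section

namespace HorocyclePSE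

/-! ### The actions of `PSL(2, ℝ)` on the upper half-plane and on its boundary -/

theorem center_scalar {g : SL(2, ℝ)} (hg : g ∈ Subgroup.center SL(2, ℝ)) :
    ∃ r : ℝ, r ≠ 0 ∧ g 0 0 = r ∧ g 0 1 = 0 ∧ g 1 0 = 0 ∧ g 1 1 = r := by
  obtain ⟨r, hr, h⟩ := Matrix.SpecialLinearGroup.mem_center_iff.mp hg
  refine ⟨r, ?_, ?_, ?_, ?_, ?_⟩
  · rintro rfl
    simp at hr
  all_goals rw [← h]; simp [Matrix.scalar_apply]

/-- Möbius transformations as a homomorphism from `PSL(2, ℝ)` to the permutations of `ℍ`. -/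
def mobiusHom : PSL(2, ℝ) →* Equiv.Perm ℍ :=
  QuotientGroup.lift (Subgroup.center SL(2, ℝ)) (MulAction.toPermHom SL(2, ℝ) ℍ) (by
    intro g hg
    obtain ⟨r, hr, h00, h01, h10, h11⟩ := center_scalar hg
    ext z
    have hr' : (r : ℂ) ≠ 0 := by exact_mod_cast hr
    simp [UpperHalfPlane.coe_specialLinearGroup_apply, h00, h01, h10, h11, hr'])

/-- `PSL(2, ℝ)` acts on `ℍ` by `z ↦ (a z + b) / (c z + d)`. -/
instance mobiusAction : MulAction PSL(2, ℝ) ℍ := MulAction.compHom ℍ mobiusHom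

/-- Möbius transformations of the boundary `ℝ ∪ {∞}` of `ℍ`. -/
def boundaryHom : PSL(2, ℝ) →* Equiv.Perm (OnePoint ℝ) :=
  QuotientGroup.lift (Subgroup.center SL(2, ℝ))
    ((MulAction.toPermHom (GL (Fin 2) ℝ) (OnePoint ℝ)).comp
      Matrix.SpecialLinearGroup.toGL) (by
    intro g hg
    obtain ⟨r, hr, h00, h01, h10, h11⟩ := center_scalar hg
    ext x
    induction x using OnePoint.rec with
    | infty => simp [OnePoint.smul_infty_eq_ite, h10]
    | coe x => simp [OnePoint.smul_some_eq_ite, h00, h01, h10, h11, hr])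

/-- `PSL(2, ℝ)` acts on `ℝ ∪ {∞}` by `x ↦ (a x + b) / (c x + d)`. -/
instance boundaryAction : MulAction PSL(2, ℝ) (OnePoint ℝ) :=
  MulAction.compHom (OnePoint ℝ) boundaryHom

theorem mk_smul (g : SL(2, ℝ)) (z : ℍ) : (g : PSL(2, ℝ)) • z = g • z := rfl

theorem mk_smul_boundary (g : SL(2, ℝ)) (x : OnePoint ℝ) :
    (g : PSL(2, ℝ)) • x = Matrix.SpecialLinearGroup.toGL g • x := rfl

/-! ### The unit tangent bundle -/

/-- The unit tangent bundle `T₁ℍ`: pairs `(z, θ)` with `θ ∈ ℝ / 2πℤ`, the angle being measured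
counterclockwise from the vertical. -/
abbrev UnitTangent : Type := ℍ × Real.Angle

/-- The action `(z, θ) ↦ (g z, θ - 2 arg (c z + d))` on `T₁ℍ`; as `θ` is taken modulo `2π`,
it depends only on the class of `g` in `PSL(2, ℝ)`. -/
def tangentAct (g : SL(2, ℝ)) (p : UnitTangent) : UnitTangent :=
  (g • p.1,
    p.2 - ((2 * Complex.arg ((g 1 0 : ℂ) * (p.1 : ℂ) + (g 1 1 : ℂ)) : ℝ) : Real.Angle))

/-- `Γ`-invariance of a function on `T₁ℍ`. -/
def IsInvariant (Γ : Subgroup PSL(2, ℝ)) (f : UnitTangent → ℂ) : Prop :=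
  ∀ g : SL(2, ℝ), (g : PSL(2, ℝ)) ∈ Γ → ∀ p : UnitTangent, f (tangentAct g p) = f p

/-! ### Cusps and the invariant height function -/

/-- The class of `(1 1; 0 1)` in `PSL(2, ℝ)`, that is, the translation `z ↦ z + 1`. -/
def translation : PSL(2, ℝ) :=
  QuotientGroup.mk (⟨!![1, 1; 0, 1], by simp [Matrix.det_fin_two]⟩ : SL(2, ℝ))

/-- The elements `N` of `PSL(2, ℝ)` such that `η = N⁻¹ ∞` is a cusp of `Γ` whose isotropy group
`Γ_η` is generated by `N⁻¹ (1 1; 0 1) N`. (This last condition makes `η` a cusp, as it says that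
`η` is fixed by a parabolic element of `Γ`.) -/
def cuspNormalizers (Γ : Subgroup PSL(2, ℝ)) : Set PSL(2, ℝ) :=
  {N | Γ ⊓ MulAction.stabilizer PSL(2, ℝ) (N⁻¹ • (OnePoint.infty : OnePoint ℝ)) =
    Subgroup.zpowers (N⁻¹ * translation * N)}

/-- The invariant height function
`𝒴_Γ(z) = sup {Im (N W z) | N ∈ cuspNormalizers Γ, W ∈ Γ}`. -/
def height (Γ : Subgroup PSL(2, ℝ)) (z : ℍ) : ℝ :=
  sSup {t : ℝ | ∃ N ∈ cuspNormalizers Γ, ∃ W ∈ Γ, t = (N • (W • z)).im}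

/-! ### Equidistribution of point sets -/

/-- The class `B_γ(Γ \ T₁ℍ)`: continuous `Γ`-invariant functions `f` on `T₁ℍ` such that
`|f(z, θ)| ≤ C 𝒴_Γ(z)^γ` for some constant `C > 0`. -/
def TestFunction (Γ : Subgroup PSL(2, ℝ)) (γ : ℝ) (f : UnitTangent → ℂ) : Prop :=
  Continuous f ∧ IsInvariant Γ f ∧
    ∃ C : ℝ, 0 < C ∧ ∀ (z : ℍ) (θ : Real.Angle), ‖f (z, θ)‖ ≤ C * height Γ z ^ γ

/-- The average `⟨f⟩ = (2π μ(F))⁻¹ ∫_F ∫_0^{2π} f(z, θ) dθ dμ(z)`, where `dμ = dx dy / y²` is the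
measure `volume` on `ℍ`. For invariant `f` it is the same for all fundamental domains `F`. -/
def average (F : Set ℍ) (f : UnitTangent → ℂ) : ℂ :=
  ((1 / (2 * Real.pi * (volume F).toReal) : ℝ) : ℂ) *
    ∫ z in F, ∫ θ in (0 : ℝ)..(2 * Real.pi), f (z, (θ : Real.Angle))

/-- `⟨Γ, ν, α⟩-PSE_γ` (point set equidistribution): for every `f` in `B_γ(Γ \ T₁ℍ)` and all
`0 < C₁ < C₂`, the mean of `f (m α + i y, 0)` over `m = 1, …, M` tends to `⟨f⟩`, uniformly as
`M → ∞` and `C₁ M^{-ν} ≤ y ≤ C₂ M^{-ν}`. The average is computed on a fundamental domain for `Γ`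
in `ℍ`. -/
def PSE (Γ : Subgroup PSL(2, ℝ)) (ν α γ : ℝ) : Prop :=
  ∃ F : Set ℍ, IsFundamentalDomain Γ F (volume : Measure ℍ) ∧
    ∀ f : UnitTangent → ℂ, TestFunction Γ γ f →
    ∀ C₁ C₂ : ℝ, 0 < C₁ → C₁ < C₂ →
    ∀ ε : ℝ, 0 < ε → ∃ M₀ : ℕ, ∀ M : ℕ, M₀ ≤ M →
    ∀ (y : ℝ) (hy : 0 < y), C₁ * (M : ℝ) ^ (-ν) ≤ y → y ≤ C₂ * (M : ℝ) ^ (-ν) →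
      ‖(1 / (M : ℂ)) * ∑ m ∈ Finset.Icc 1 M,
          f ((⟨⟨(m : ℝ) * α, y⟩, hy⟩ : ℍ), (0 : Real.Angle)) - average F f‖ < ε

/-! ### The group and the pair correlation function -/

/-- The image of the congruence subgroup `Γ₁(4)` of `SL(2, ℤ)` in `PSL(2, ℝ)`. -/
def Gamma14Bar : Subgroup PSL(2, ℝ) :=
  (CongruenceSubgroup.Gamma1 4).map
    ((QuotientGroup.mk' (Subgroup.center SL(2, ℝ))).comp
      (Matrix.SpecialLinearGroup.map (Int.castRingHom ℝ)))

/-- The pair correlation function of `n² α` modulo one: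
`R₂([a, b], α, N) = N⁻¹ |{1 ≤ j ≠ k ≤ N | j² α - k² α ∈ [a/N, b/N] + ℤ}|`. -/
def pairCorrelation (a b α : ℝ) (N : ℕ) : ℝ :=
  (1 / (N : ℝ)) * (Set.ncard {p : ℕ × ℕ |
    1 ≤ p.1 ∧ p.1 ≤ N ∧ 1 ≤ p.2 ∧ p.2 ≤ N ∧ p.1 ≠ p.2 ∧
      ∃ t ∈ Set.Icc (a / (N : ℝ)) (b / (N : ℝ)), ∃ n : ℤ,
        (p.1 : ℝ) ^ 2 * α - (p.2 : ℝ) ^ 2 * α = t + (n : ℝ)} : ℝ)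

end HorocyclePSE

end

/-!
# Pair correlation of `n² α` and equidistribution of point sets on horocycles

Both parts rest on the same reduction. Smoothing the interval `[a, b]` by a function `h` and
applying Poisson summation, the weighted pair correlation sum of `j² α` becomes a sum over `m` of
`N⁻² 𝓕 h (m / N) |∑_j a_j e(m j² α)|²`. Without the diagonal `i = j`, it tends to `(∫ a)² ∫ h`
once the masses `|∑_j a_j e(m j² α)|² / N²` over `1 ≤ m ≤ N x` have the total predicted by the
diagonal terms (`MeanSquareLaw`, `tendsto_weighted_pairs`, `tendsto_pairCorrelation_of_weights`).
The tail of the sum over `m` needs a bound for the masses that is linear in `x` and uniform in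
`N`; it holds because a sum with nonnegative coefficients has its largest Fejér means at the
origin (`fejer_shift_le`).

For part (i), the weights are `a_j = ψ(j / N)` with `ψ` smooth and even. The square of the theta
sum `∑ ψ(n √y) e(n² x)`, multiplied by `√y`, equals a sum of the Wigner function of `ψ` over the
lattice `(c z + d) / √y`, with signs that are invariant under `Γ₁(4)` (`latticeSum_wigner`). As a
function on the unit tangent bundle, such a lattice sum is continuous and `Γ₁(4)`-invariant, and
it grows like the square root of the height in the cusps (`Admissible.testFunction`), so that
`PSE` with exponent `1/2` applies to it. The equidistribution with `y ≍ M⁻²` thus evaluates the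
mean square of the Weyl sums, provided that the average is known. By unfolding, the average of the
lattice sum of `Φ` is `Φ(0) + κ' ∫ Φ` with a constant `κ'` independent of `Φ` (`exists_average`).
This constant need not be computed from the index of `Γ₁(4)`: for odd `ψ` the theta sum vanishes
identically, while the formula gives `(1 - 4 κ') ∫ ψ²`, so that `κ' = 1/4` and the average is
`2 ∫ ψ²` for even `ψ` (`tendsto_thetaSum_of_PSE`).

For part (ii), the weights are the indicator function of `[1, N]`. The mean square over `α` of the
off-diagonal terms counts the solutions of `m (j² - i²) = m' (j'² - i'²)`, of which there are few
by the divisor bound (`exists_card_solutions_le`). Along `N = k ^ 4` the variances are summable,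
which gives the mean square law for almost every `α` (`ae_tendsto_offDiagonalSum`), and
monotonicity of the number of pairs fills the gaps between fourth powers
(`tendsto_pairCorrelation_of_pow_four`).
-/

namespace HorocyclePSE

section

open scoped SchwartzMap FourierTransform

/-- The additive character `e(t) = exp(2πit)`. -/
noncomputable def e (t : ℝ) : ℂ := Complex.exp (2 * Real.pi * Complex.I * t)

theorem e_zero : e 0 = 1 := by simp [e]

theorem e_add (s t : ℝ) : e (s + t) = e s * e t := by
  simp only [e, ← Complex.exp_add]; push_cast; ring_nf

theorem norm_e (t : ℝ) : ‖e t‖ = 1 := by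
  rw [e, show (2 * Real.pi * Complex.I * t : ℂ) = ((2 * Real.pi * t : ℝ) : ℂ) * Complex.I by
    push_cast; ring]
  exact Complex.norm_exp_ofReal_mul_I _

theorem star_e (t : ℝ) : (starRingEnd ℂ) (e t) = e (-t) := by
  rw [e, e, ← Complex.exp_conj]
  simp only [map_mul, Complex.conj_ofReal, Complex.conj_I, map_ofNat]
  push_cast; ring_nf

theorem e_intCast (n : ℤ) : e n = 1 := by
  rw [e, Complex.exp_eq_one_iff]; exact ⟨n, by push_cast; ring⟩

@[fun_prop] theorem continuous_e : Continuous e := by unfold e; fun_prop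

theorem fourier_coe_eq_e (n : ℤ) (x : ℝ) : fourier n (x : UnitAddCircle) = e (n * x) := by
  rw [fourier_coe_apply, e]; congr 1; push_cast; ring

theorem re_e (t : ℝ) : (e t).re = Real.cos (2 * Real.pi * t) := by
  rw [e, show (2 * Real.pi * Complex.I * t : ℂ) = ((2 * Real.pi * t : ℝ) : ℂ) * Complex.I by
    push_cast; ring, Complex.exp_ofReal_mul_I_re]

/-! ### Poisson summation on a lattice of arbitrary spacing -/

/-- The dilation `x ↦ H (N x)` of a Schwartz function. -/
noncomputable def dilate (N : ℝ) (hN : N ≠ 0) (H : 𝓢(ℝ, ℂ)) : 𝓢(ℝ, ℂ) :=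
  SchwartzMap.compCLMOfContinuousLinearEquiv ℂ
    (ContinuousLinearEquiv.unitsEquivAut ℝ (Units.mk0 N hN)) H

theorem dilate_apply (N : ℝ) (hN : N ≠ 0) (H : 𝓢(ℝ, ℂ)) (x : ℝ) :
    dilate N hN H x = H (N * x) := by
  simp [dilate, mul_comm]

theorem fourier_eq_integral_e (f : ℝ → ℂ) (w : ℝ) : 𝓕 f w = ∫ v, e (-(v * w)) * f v := by
  rw [Real.fourier_eq' f w]
  refine integral_congr_ae (Eventually.of_forall fun v => ?_)
  simp only [smul_eq_mul, e, RCLike.inner_apply, conj_trivial]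
  congr 2; push_cast; ring

theorem fourier_dilate (N : ℝ) (hN : 0 < N) (H : 𝓢(ℝ, ℂ)) (w : ℝ) :
    𝓕 (dilate N hN.ne' H : ℝ → ℂ) w = (1 / N : ℂ) * 𝓕 (H : ℝ → ℂ) (w / N) := by
  rw [fourier_eq_integral_e, fourier_eq_integral_e]
  have := Measure.integral_comp_mul_left (fun v => e (-(v * (w / N))) * H v) N
  rw [abs_of_pos (inv_pos.mpr hN)] at this
  simp only [dilate_apply]
  rw [show (1 / N : ℂ) = ((N⁻¹ : ℝ) : ℂ) by push_cast; ring, ← Complex.real_smul]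
  rw [← this]
  refine integral_congr_ae (Eventually.of_forall fun v => ?_)
  simp only
  congr 3; field_simp

theorem poisson_dilate (N : ℝ) (hN : 0 < N) (H : 𝓢(ℝ, ℂ)) (t : ℝ) :
    ∑' n : ℤ, H (N * (t + n)) =
      (1 / N : ℂ) * ∑' m : ℤ, 𝓕 (H : ℝ → ℂ) (m / N) * e (m * t) := by
  have := SchwartzMap.tsum_eq_tsum_fourier (dilate N hN.ne' H) t
  simp only [dilate_apply, SchwartzMap.fourier_coe, fourier_dilate N hN, fourier_coe_eq_e] at this
  rw [this, ← tsum_mul_left]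
  simp only [mul_assoc]

theorem summable_schwartz_int (f : 𝓢(ℝ, ℂ)) (N : ℝ) (hN : 0 < N) :
    Summable fun m : ℤ => f (m / N) := by
  have h := summable_of_isBigO (Real.summable_abs_int_rpow (one_lt_two))
    (((dilate N⁻¹ (inv_ne_zero hN.ne') f).isBigO_cocompact_rpow (-2)).comp_tendsto
      Int.tendsto_coe_cofinite)
  refine h.congr fun m => ?_
  simp only [Function.comp, dilate_apply]
  congr 1; field_simp

/-! ### Trigonometric sums with nonnegative coefficients -/

section PositiveDefinite

variable {ι : Type*} (s : Finset ι) (a τ : ι → ℝ)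

/-- The trigonometric sum `∑ a_j e(m τ_j)`. -/
noncomputable def trigSum (m : ℤ) : ℂ := ∑ j ∈ s, (a j : ℂ) * e (m * τ j)

theorem normSq_trigSum (m : ℤ) : ((‖trigSum s a τ m‖ ^ 2 : ℝ) : ℂ) =
    ∑ j ∈ s, ∑ k ∈ s, (a j * a k : ℂ) * e (m * (τ j - τ k)) := by
  rw [Complex.ofReal_pow, ← Complex.mul_conj', trigSum, map_sum, Finset.sum_mul_sum]
  refine Finset.sum_congr rfl fun j _ => Finset.sum_congr rfl fun k _ => ?_
  rw [map_mul, star_e, Complex.conj_ofReal, mul_sub, sub_eq_add_neg, e_add]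
  ring

theorem norm_trigSum_neg (m : ℤ) : ‖trigSum s a τ (-m)‖ = ‖trigSum s a τ m‖ := by
  rw [← RCLike.norm_conj (trigSum s a τ m)]
  congr 1
  simp only [trigSum, map_sum, map_mul, star_e, Complex.conj_ofReal]
  simp

variable {a}

theorem norm_trigSum_le (ha : ∀ j ∈ s, 0 ≤ a j) (m : ℤ) :
    ‖trigSum s a τ m‖ ≤ ∑ j ∈ s, a j := by
  refine (norm_sum_le _ _).trans (Finset.sum_le_sum fun j hj => ?_)
  rw [norm_mul, norm_e, mul_one, Complex.norm_real, Real.norm_of_nonneg (ha j hj)]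

/-- The mean square of a trigonometric sum with nonnegative coefficients over a Fejér window is
largest when the window is centred at the origin. -/
theorem fejer_shift_le (ha : ∀ j ∈ s, 0 ≤ a j) (K : ℕ) (c : ℤ) :
    ∑ i ∈ Finset.range K, ∑ l ∈ Finset.range K, ‖trigSum s a τ (i - l + c)‖ ^ 2 ≤
      ∑ i ∈ Finset.range K, ∑ l ∈ Finset.range K, ‖trigSum s a τ (i - l)‖ ^ 2 := by
  have key : ∀ c : ℤ, ((∑ i ∈ Finset.range K, ∑ l ∈ Finset.range K,
      ‖trigSum s a τ (i - l + c)‖ ^ 2 : ℝ) : ℂ) =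
      ∑ j ∈ s, ∑ k ∈ s, ((a j * a k *
        ‖∑ i ∈ Finset.range K, e (i * (τ j - τ k))‖ ^ 2 : ℝ) : ℂ) * e (c * (τ j - τ k)) := by
    intro c
    push_cast
    have : ∀ i l : ℕ, ((‖trigSum s a τ (i - l + c)‖ : ℂ) ^ 2) =
        ∑ j ∈ s, ∑ k ∈ s, (a j * a k : ℂ) * (e (i * (τ j - τ k)) * e (-(l * (τ j - τ k)))) *
          e (c * (τ j - τ k)) := by
      intro i l
      have := normSq_trigSum s a τ (i - l + c)
      push_cast at this
      rw [this]
      refine Finset.sum_congr rfl fun j _ => Finset.sum_congr rfl fun k _ => ?_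
      rw [← e_add, mul_assoc (_ * _ : ℂ), ← e_add]
      congr 2; ring
    simp only [this]
    simp only [Finset.sum_comm (s := Finset.range K) (t := s)]
    refine Finset.sum_congr rfl fun j _ => Finset.sum_congr rfl fun k _ => ?_
    simp only [← Finset.sum_mul]
    congr 1
    rw [← Complex.mul_conj', map_sum, Finset.sum_mul_sum, Finset.mul_sum]
    refine Finset.sum_congr rfl fun i _ => ?_
    rw [Finset.mul_sum]
    refine Finset.sum_congr rfl fun l _ => ?_
    rw [star_e]
  have h0 := key 0
  simp only [add_zero, Int.cast_zero, zero_mul, e_zero, mul_one, ← Complex.ofReal_sum] at h0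
  have h0' := Complex.ofReal_injective h0
  rw [h0']
  have hc := congrArg norm (key c)
  rw [Complex.norm_real, Real.norm_of_nonneg (by positivity)] at hc
  rw [hc]
  refine (norm_sum_le _ _).trans (Finset.sum_le_sum fun j hj => ?_)
  refine (norm_sum_le _ _).trans (Finset.sum_le_sum fun k hk => ?_)
  rw [norm_mul, norm_e, mul_one, Complex.norm_real, Real.norm_of_nonneg]
  have := ha j hj
  have := ha k hk
  positivity

/-- For a sum with nonnegative coefficients, the mean square over any interval of length `K` is
bounded by that over the initial interval of length `2 K`: a Fejér window majorizes the interval,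
and may be moved to the origin. -/
theorem block_le (ha : ∀ j ∈ s, 0 ≤ a j) (K : ℕ) (c : ℕ) :
    ∑ m ∈ Finset.Icc 1 K, ‖trigSum s a τ (m + c : ℕ)‖ ^ 2 ≤
      2 * ‖trigSum s a τ 0‖ ^ 2 +
        4 * ∑ m ∈ Finset.Icc 1 (2 * K), ‖trigSum s a τ (m : ℕ)‖ ^ 2 := by
  rcases Nat.eq_zero_or_pos K with rfl | hK
  · simp
  have h := fejer_shift_le s τ ha (2 * K) c
  set f : ℤ → ℝ := fun m => ‖trigSum s a τ m‖ ^ 2 with hf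
  have hf0 : ∀ m, 0 ≤ f m := fun m => by positivity
  have hfneg : ∀ m, f (-m) = f m := fun m => by simp only [hf, norm_trigSum_neg]
  -- every difference `1 ≤ m ≤ K` occurs at least `K` times in the window of length `2 K`
  have hlow : K * ∑ m ∈ Finset.Icc 1 K, f (m + c : ℕ) ≤
      ∑ i ∈ Finset.range (2 * K), ∑ l ∈ Finset.range (2 * K), f (i - l + c) := by
    rw [Finset.sum_comm]
    calc K * ∑ m ∈ Finset.Icc 1 K, f (m + c : ℕ)
        = ∑ l ∈ Finset.range K, ∑ m ∈ Finset.Icc 1 K, f (m + c : ℕ) := by simp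
      _ ≤ ∑ l ∈ Finset.range K, ∑ i ∈ Finset.range (2 * K), f (i - l + c) := by
          refine Finset.sum_le_sum fun l hl => ?_
          rw [Finset.mem_range] at hl
          calc ∑ m ∈ Finset.Icc 1 K, f (m + c : ℕ)
              = ∑ i ∈ (Finset.Icc 1 K).map (addRightEmbedding l), f (i - l + c) := by
                rw [Finset.sum_map]
                refine Finset.sum_congr rfl fun m _ => ?_
                simp
            _ ≤ _ := by
                refine Finset.sum_le_sum_of_subset_of_nonneg ?_ fun _ _ _ => hf0 _
                intro i hi
                simp only [Finset.mem_map, Finset.mem_Icc, addRightEmbedding_apply] at hi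
                obtain ⟨m, hm, rfl⟩ := hi
                rw [Finset.mem_range]; omega
      _ ≤ _ := Finset.sum_le_sum_of_subset_of_nonneg
          (Finset.range_subset_range.mpr (by omega))
          fun _ _ _ => Finset.sum_nonneg fun _ _ => hf0 _
  -- conversely, no difference occurs more than `2 K` times
  have hup : ∑ i ∈ Finset.range (2 * K), ∑ l ∈ Finset.range (2 * K), f (i - l) ≤
      (2 * K : ℕ) * (f 0 + 2 * ∑ m ∈ Finset.Icc 1 (2 * K), f (m : ℕ)) := by
    rw [← nsmul_eq_mul]
    refine (Finset.sum_le_card_nsmul (Finset.range (2 * K)) _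
      (f 0 + 2 * ∑ m ∈ Finset.Icc 1 (2 * K), f (m : ℕ)) fun i hi => ?_).trans_eq (by simp)
    rw [Finset.mem_range] at hi
    calc ∑ l ∈ Finset.range (2 * K), f (i - l)
        = ∑ m ∈ (Finset.range (2 * K)).image (fun l : ℕ => (i - l : ℤ)), f m := by
          rw [Finset.sum_image]
          intro x _ y _ hxy
          simp only at hxy; omega
      _ ≤ ∑ m ∈ {0} ∪ ((Finset.Icc 1 (2 * K)).image (fun l : ℕ => (l : ℤ)) ∪
            (Finset.Icc 1 (2 * K)).image (fun l : ℕ => (-l : ℤ))), f m := by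
          refine Finset.sum_le_sum_of_subset_of_nonneg ?_ fun _ _ _ => hf0 _
          intro m hm
          simp only [Finset.mem_image, Finset.mem_range, Finset.mem_singleton, Finset.mem_union,
            Finset.mem_Icc] at hm ⊢
          obtain ⟨l, hl, rfl⟩ := hm
          rcases lt_trichotomy i l with h | h | h
          · exact Or.inr (Or.inr ⟨l - i, by omega, by omega⟩)
          · exact Or.inl (by omega)
          · exact Or.inr (Or.inl ⟨i - l, by omega, by omega⟩)
      _ ≤ f 0 + (∑ m ∈ Finset.Icc 1 (2 * K), f (m : ℕ) +
            ∑ m ∈ Finset.Icc 1 (2 * K), f (m : ℕ)) := by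
          have hu : ∀ A B : Finset ℤ, ∑ m ∈ A ∪ B, f m ≤ ∑ m ∈ A, f m + ∑ m ∈ B, f m := by
            intro A B
            rw [← Finset.sum_union_inter]
            exact le_add_of_nonneg_right (Finset.sum_nonneg fun _ _ => hf0 _)
          refine (hu _ _).trans (add_le_add (by simp) ((hu _ _).trans (add_le_add ?_ ?_)))
          · rw [Finset.sum_image fun x _ y _ hxy => by simpa using hxy]
          · rw [Finset.sum_image fun x _ y _ hxy => by simpa using hxy]
            simp only [hfneg]; rfl
      _ = _ := by ring
  have : (K : ℝ) * ∑ m ∈ Finset.Icc 1 K, f (m + c : ℕ) ≤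
      K * (2 * f 0 + 4 * ∑ m ∈ Finset.Icc 1 (2 * K), f (m : ℕ)) := by
    refine (hlow.trans h).trans (hup.trans_eq ?_)
    push_cast; ring
  exact le_of_mul_le_mul_left this (by exact_mod_cast hK)

end PositiveDefinite

end

section

open scoped SchwartzMap FourierTransform

/-! ### Weighted sums of a Schwartz function against a measure on the positive integers -/

theorem schwartz_decay (f : 𝓢(ℝ, ℂ)) (k : ℕ) : ∃ D : ℝ, 0 ≤ D ∧ ∀ x : ℝ, |x| ^ k * ‖f x‖ ≤ D := by
  obtain ⟨D, hD⟩ := f.decay k 0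
  refine ⟨D, hD.1.le, fun x => ?_⟩
  simpa using hD.2 x

theorem integrable_schwartz_mul (f : 𝓢(ℝ, ℂ)) : Integrable fun x : ℝ => ‖f x‖ * (1 + |x|) := by
  have h0 := f.integrable_pow_mul volume 0
  have h1 := f.integrable_pow_mul volume 1
  refine (h0.add h1).congr (Eventually.of_forall fun x => ?_)
  simp only [Pi.add_apply, pow_zero, pow_one, Real.norm_eq_abs]; ring

/-- Summation by parts for a Schwartz function against a measure of linear growth. -/
theorem hasSum_schwartz_abel (Q : 𝓢(ℝ, ℂ)) {N : ℝ} (hN : 0 < N) {c : ℕ → ℝ} (hc : ∀ m, 0 ≤ c m)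
    {C : ℝ} (hC : 0 ≤ C)
    (hb : ∀ x : ℝ, 0 ≤ x → ∑ m ∈ Finset.Icc 1 ⌊N * x⌋₊, c m ≤ C * (1 + x)) :
    HasSum (fun m : ℕ => Q ((m + 1 : ℕ) / N) * (c (m + 1) : ℂ))
      (-∫ x in Set.Ioi (0 : ℝ), deriv Q x * ((∑ m ∈ Finset.Icc 1 ⌊N * x⌋₊, c m : ℝ) : ℂ)) := by
  have hb' : ∀ n : ℕ, ∑ m ∈ Finset.Icc 1 n, c m ≤ C * (1 + n / N) := by
    intro n
    have := hb (n / N) (by positivity)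
    rwa [mul_div_cancel₀ _ hN.ne', Nat.floor_natCast] at this
  obtain ⟨D2, hD2, hQ2⟩ := schwartz_decay Q 2
  obtain ⟨D3, hD3, hQ3⟩ := schwartz_decay Q 3
  -- the terms are `O(m⁻²)`
  have hterm : ∀ n : ℕ, 1 ≤ n → ∀ t : ℝ, 0 ≤ t → t ≤ C * (1 + n / N) →
      ‖Q (n / N) * (t : ℂ)‖ ≤ C * (D2 + D3) * N ^ 2 / (n : ℝ) ^ 2 := by
    intro n hn t ht htn
    have hn' : (0 : ℝ) < n := by exact_mod_cast hn
    have h2 := hQ2 (n / N)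
    have h3 := hQ3 (n / N)
    rw [abs_of_pos (by positivity)] at h2 h3
    rw [norm_mul, Complex.norm_real, Real.norm_of_nonneg ht]
    calc ‖Q (n / N)‖ * t ≤ ‖Q (n / N)‖ * (C * (1 + n / N)) := by gcongr
      _ = C * (((n / N) ^ 2 * ‖Q (n / N)‖) + ((n / N) ^ 3 * ‖Q (n / N)‖)) * N ^ 2 / n ^ 2 := by
        field_simp
      _ ≤ _ := by gcongr
  have hsum : Summable fun m : ℕ => Q ((m + 1 : ℕ) / N) * (c (m + 1) : ℂ) := by
    refine Summable.of_norm_bounded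
      (g := fun m : ℕ => C * (D2 + D3) * N ^ 2 / ((m + 1 : ℕ) : ℝ) ^ 2)
      ?_ fun m => hterm (m + 1) (by omega) _ (hc _) ((hb' (m + 1)).trans' ?_)
    · simp only [div_eq_mul_inv]
      exact ((summable_nat_add_iff 1).mpr
        (Real.summable_nat_pow_inv.mpr one_lt_two)).mul_left _
    · exact Finset.single_le_sum (f := c) (fun _ _ => hc _) (by simp)
  -- the summation formula starts at `0`, and the term there is set to zero
  set c' : ℕ → ℂ := fun m => if m = 0 then 0 else (c m : ℂ) with hc'
  have hS : ∀ n : ℕ, ∑ k ∈ Finset.Icc 0 n, c' k = ((∑ m ∈ Finset.Icc 1 n, c m : ℝ) : ℂ) := by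
    intro n
    rw [Finset.Icc_eq_cons_Ioc (Nat.zero_le _), Finset.sum_cons, Complex.ofReal_sum]
    simp only [hc', if_true, zero_add]
    refine Finset.sum_congr rfl fun m hm => ?_
    rw [if_neg (by simp at hm; omega)]
  have hdiff : ∀ t : ℝ, HasDerivAt (fun t : ℝ => Q (t / N)) (deriv Q (t / N) * (1 / N : ℝ)) t := by
    intro t
    have h1 : HasDerivAt (fun t : ℝ => t / N) (1 / N) t := (hasDerivAt_id t).div_const N
    have h2 := (Q.differentiable.differentiableAt (x := t / N)).hasDerivAt
    have := h2.scomp t h1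
    rw [Complex.real_smul, mul_comm] at this
    exact this
  have hderiv : deriv (fun t : ℝ => Q (t / N)) = fun t => deriv Q (t / N) * (1 / N : ℝ) :=
    funext fun t => (hdiff t).deriv
  have hQ' : Continuous (deriv Q) := by
    have := (SchwartzMap.derivCLM ℂ ℂ Q).continuous
    exact this
  have hint : Integrable fun t : ℝ => ‖deriv Q (t / N)‖ * (1 / N) * (C * (1 + |t / N|)) := by
    have := (integrable_schwartz_mul (SchwartzMap.derivCLM ℂ ℂ Q)).comp_div hN.ne'
    refine (this.mul_const (1 / N * C)).congr (Eventually.of_forall fun t => ?_)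
    simp only [SchwartzMap.derivCLM_apply]; ring
  have hmain := tendsto_sum_mul_atTop_nhds_one_sub_integral (𝕜 := ℂ)
    (f := fun t : ℝ => Q (t / N)) c'
    (fun t _ => (hdiff t).differentiableAt)
    (by rw [hderiv]; exact Continuous.locallyIntegrable (by fun_prop) |>.locallyIntegrableOn _)
    (l := 0) ?_ (g := fun t : ℝ => ((‖deriv Q (t / N)‖ * (1 / N) * (C * (1 + |t / N|)) : ℝ) : ℂ))
    ?_ (hint.ofReal.integrableAtFilter _)
  · rw [zero_sub] at hmain
    -- substitution of `t = N x`
    have hval : ∫ t in Set.Ioi (0 : ℝ), deriv (fun t : ℝ => Q (t / N)) t *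
        ∑ k ∈ Finset.Icc 0 ⌊t⌋₊, c' k =
        ∫ x in Set.Ioi (0 : ℝ), deriv Q x * ((∑ m ∈ Finset.Icc 1 ⌊N * x⌋₊, c m : ℝ) : ℂ) := by
      rw [hderiv]
      simp only [hS]
      have := integral_comp_mul_left_Ioi' (fun t : ℝ => deriv Q (t / N) * ((1 / N : ℝ) : ℂ) *
        ((∑ m ∈ Finset.Icc 1 ⌊t⌋₊, c m : ℝ) : ℂ)) 0 hN
      rw [mul_zero] at this
      rw [← this, ← integral_smul]
      refine integral_congr_ae (Eventually.of_forall fun x => ?_)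
      have hN' : (N : ℂ) ≠ 0 := by exact_mod_cast hN.ne'
      simp only [mul_div_cancel_left₀ x hN.ne', Complex.real_smul]
      push_cast
      field_simp
    rw [hval] at hmain
    refine (hsum.hasSum_iff_tendsto_nat).mpr ?_
    have h2 : ∀ n : ℕ, ∑ k ∈ Finset.Icc 0 n, Q ((k : ℝ) / N) * c' k =
        ∑ m ∈ Finset.range n, Q ((m + 1 : ℕ) / N) * (c (m + 1) : ℂ) := by
      intro n
      rw [← Nat.range_succ_eq_Icc_zero, Finset.sum_range_succ']
      simp [hc']
    exact hmain.congr h2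
  · simp only [hS]
    have h0 : Tendsto (fun n : ℕ => C * (D2 + D3) * N ^ 2 / (n : ℝ) ^ 2) atTop (𝓝 0) :=
      tendsto_const_nhds.div_atTop
        ((tendsto_pow_atTop two_ne_zero).comp tendsto_natCast_atTop_atTop)
    refine squeeze_zero_norm' ?_ h0
    filter_upwards [eventually_ge_atTop 1] with n hn
    exact hterm n hn _ (Finset.sum_nonneg fun _ _ => hc _) (hb' n)
  · simp only [hS, hderiv]
    refine Asymptotics.IsBigO.of_bound 1 ?_
    filter_upwards [eventually_ge_atTop 0] with t ht
    have h1 : ∑ m ∈ Finset.Icc 1 ⌊t⌋₊, c m ≤ C * (1 + |t / N|) := by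
      have := hb (t / N) (by positivity)
      rwa [mul_div_cancel₀ _ hN.ne', ← abs_of_nonneg (show 0 ≤ t / N by positivity)] at this
    have h2 : 0 ≤ ∑ m ∈ Finset.Icc 1 ⌊t⌋₊, c m := Finset.sum_nonneg fun _ _ => hc _
    rw [one_mul, norm_mul, norm_mul, Complex.norm_real, Complex.norm_real, Complex.norm_real,
      Real.norm_of_nonneg h2, Real.norm_of_nonneg (show 0 ≤ 1 / N by positivity),
      Real.norm_of_nonneg (by positivity)]
    gcongr

/-- If the measures `∑ c_k(m) δ_{m / N_k}` on `(0, ∞)` converge to `g` times Lebesgue measure on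
initial intervals, with uniformly linear growth, then they converge against Schwartz functions. -/
theorem tendsto_tsum_schwartz (Q : 𝓢(ℝ, ℂ)) {N : ℕ → ℝ} (hN : ∀ᶠ k in atTop, 0 < N k)
    {c : ℕ → ℕ → ℝ} (hc : ∀ k m, 0 ≤ c k m) {C g : ℝ} (hC : 0 ≤ C)
    (hb : ∀ᶠ k in atTop, ∀ x : ℝ, 0 ≤ x → ∑ m ∈ Finset.Icc 1 ⌊N k * x⌋₊, c k m ≤ C * (1 + x))
    (hl : ∀ x : ℝ, 0 < x →
      Tendsto (fun k => ∑ m ∈ Finset.Icc 1 ⌊N k * x⌋₊, c k m) atTop (𝓝 (g * x))) :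
    Tendsto (fun k => ∑' m : ℕ, Q ((m + 1 : ℕ) / N k) * (c k (m + 1) : ℂ)) atTop
      (𝓝 (g * ∫ x in Set.Ioi (0 : ℝ), Q x)) := by
  have hQ' : Continuous (deriv Q) := (SchwartzMap.derivCLM ℂ ℂ Q).continuous
  have hmeas : ∀ k, Measurable fun x : ℝ => ((∑ m ∈ Finset.Icc 1 ⌊N k * x⌋₊, c k m : ℝ) : ℂ) := by
    intro k
    have h1 : Measurable fun n : ℕ => ((∑ m ∈ Finset.Icc 1 n, c k m : ℝ) : ℂ) := measurable_from_top
    exact h1.comp (Nat.measurable_floor.comp (measurable_const_mul _))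
  have hint := integrable_schwartz_mul (SchwartzMap.derivCLM ℂ ℂ Q)
  -- dominated convergence in the formula obtained by summation by parts
  have hlim : Tendsto (fun k => -∫ x in Set.Ioi (0 : ℝ), deriv Q x *
      ((∑ m ∈ Finset.Icc 1 ⌊N k * x⌋₊, c k m : ℝ) : ℂ)) atTop
      (𝓝 (-∫ x in Set.Ioi (0 : ℝ), deriv Q x * ((g * x : ℝ) : ℂ))) := by
    refine Tendsto.neg ?_
    refine tendsto_integral_filter_of_dominated_convergence
      (fun x => C * (‖SchwartzMap.derivCLM ℂ ℂ Q x‖ * (1 + |x|))) ?_ ?_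
      (hint.const_mul C).integrableOn ?_
    · exact Eventually.of_forall fun k =>
        (hQ'.measurable.mul (hmeas k)).aestronglyMeasurable
    · filter_upwards [hb] with k hk
      filter_upwards [ae_restrict_mem measurableSet_Ioi] with x hx
      have hx : 0 < x := hx
      have h2 : 0 ≤ ∑ m ∈ Finset.Icc 1 ⌊N k * x⌋₊, c k m := Finset.sum_nonneg fun _ _ => hc _ _
      rw [norm_mul, Complex.norm_real, Real.norm_of_nonneg h2, SchwartzMap.derivCLM_apply,
        abs_of_pos hx, mul_left_comm]
      exact mul_le_mul_of_nonneg_left (hk x hx.le) (norm_nonneg _)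
    · filter_upwards [ae_restrict_mem measurableSet_Ioi] with x hx
      exact ((Complex.continuous_ofReal.tendsto _).comp (hl x hx)).const_mul _
  -- integration by parts in the limit
  have hval : -∫ x in Set.Ioi (0 : ℝ), deriv Q x * ((g * x : ℝ) : ℂ) =
      g * ∫ x in Set.Ioi (0 : ℝ), Q x := by
    have hparts := integral_Ioi_mul_deriv_eq_deriv_mul (a := (0 : ℝ)) (u := fun x : ℝ => (x : ℂ))
      (v := Q) (u' := fun _ => 1) (v' := deriv Q) (a' := 0) (b' := 0)
      (fun x _ => Complex.ofRealCLM.hasDerivAt)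
      (fun x _ => Q.differentiable.differentiableAt.hasDerivAt) ?_ ?_ ?_ ?_
    · simp only [one_mul, sub_zero, zero_sub] at hparts
      rw [← integral_const_mul]
      have : (fun x : ℝ => deriv Q x * ((g * x : ℝ) : ℂ)) = fun x => (g : ℂ) * (x * deriv Q x) := by
        funext x; push_cast; ring
      rw [this, integral_const_mul, hparts, integral_const_mul]; ring
    · refine (hint.mono' (f := fun x : ℝ => (x : ℂ) * deriv Q x)
        (by fun_prop) (Eventually.of_forall fun x => ?_)).integrableOn
      rw [norm_mul, Complex.norm_real, mul_comm, Real.norm_eq_abs, SchwartzMap.derivCLM_apply]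
      gcongr; linarith
    · refine (Q.integrable.integrableOn).congr (Eventually.of_forall fun x => ?_)
      simp
    · have : Tendsto (fun x : ℝ => (x : ℂ) * Q x) (𝓝 0) (𝓝 (((0 : ℝ) : ℂ) * Q 0)) :=
        Continuous.tendsto (by fun_prop) 0
      rw [Complex.ofReal_zero, zero_mul] at this
      exact this.mono_left nhdsWithin_le_nhds
    · obtain ⟨D, hD, h2⟩ := schwartz_decay Q 2
      refine squeeze_zero_norm' ?_
        (tendsto_const_nhds.div_atTop tendsto_id : Tendsto (fun x : ℝ => D / x) atTop (𝓝 0))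
      filter_upwards [eventually_gt_atTop 0] with x hx
      have := h2 x
      rw [abs_of_pos hx] at this
      rw [Pi.mul_apply, norm_mul, Complex.norm_real, Real.norm_of_nonneg hx.le, le_div_iff₀ hx]
      linarith
  rw [hval] at hlim
  refine hlim.congr' ?_
  filter_upwards [hN, hb] with k hk hbk
  exact (hasSum_schwartz_abel Q hk (hc k) hC hbk).tsum_eq.symm

end

section

open scoped SchwartzMap FourierTransform

/-! ### From mean values of Weyl sums to pair correlation -/

theorem sum_Icc_one_add (f : ℕ → ℝ) (A K : ℕ) :
    ∑ m ∈ Finset.Icc 1 (A + K), f m =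
      ∑ m ∈ Finset.Icc 1 A, f m + ∑ m ∈ Finset.Icc 1 K, f (m + A) := by
  induction K with
  | zero => simp
  | succ K ih =>
    rw [← add_assoc, Finset.sum_Icc_succ_top (by omega), Finset.sum_Icc_succ_top (by omega), ih,
      add_assoc, show K + 1 + A = A + K + 1 by ring]

/-- The mean square of a sum with nonnegative coefficients grows at most linearly, at a rate given
by its values on an initial interval. -/
theorem sum_normSq_trigSum_le {ι : Type*} (s : Finset ι) {a : ι → ℝ} (τ : ι → ℝ)
    (ha : ∀ j ∈ s, 0 ≤ a j) (K q : ℕ) :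
    ∑ m ∈ Finset.Icc 1 (K * q), ‖trigSum s a τ (m : ℕ)‖ ^ 2 ≤
      q * (2 * ‖trigSum s a τ 0‖ ^ 2 +
        4 * ∑ m ∈ Finset.Icc 1 (2 * K), ‖trigSum s a τ (m : ℕ)‖ ^ 2) := by
  induction q with
  | zero => simp
  | succ q ih =>
    rw [mul_add, mul_one, sum_Icc_one_add]
    have := block_le s τ ha K (K * q)
    push_cast at this ⊢
    linarith

theorem integral_fourier_schwartz (H : 𝓢(ℝ, ℂ)) : ∫ x, 𝓕 H x = H 0 := by
  have h : 𝓕⁻ (𝓕 H) = H := FourierTransform.fourierInv_fourier_eq H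
  have h0 : 𝓕⁻ (𝓕 H) 0 = H 0 := by rw [h]
  rw [← h0, SchwartzMap.fourierInv_coe, Real.fourierInv_eq']
  simp

theorem fourier_zero_eq_integral (H : 𝓢(ℝ, ℂ)) : 𝓕 H 0 = ∫ x, H x := by
  rw [SchwartzMap.fourier_coe, fourier_eq_integral_e]
  simp [e_zero]

/-- The squares times `α`, the frequencies of the Weyl sums `∑ a_j e(m j² α)`. -/
noncomputable def sqFreq (α : ℝ) (j : ℕ) : ℝ := (j : ℝ) ^ 2 * α

section Core

variable {α : ℝ} {u : ℕ → ℕ} {a : ℕ → ℕ → ℝ} {L : ℕ → ℕ} {I₁ I₂ : ℝ}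

/-- The weight `|∑ a_j e(m j² α)|² / N²` at `m`, where `N = u k`. -/
noncomputable def weylMass (α : ℝ) (u : ℕ → ℕ) (a : ℕ → ℕ → ℝ) (L : ℕ → ℕ) (k : ℕ) (m : ℤ) : ℝ :=
  ‖trigSum (Finset.range (L k)) (a k) (sqFreq α) m‖ ^ 2 / (u k : ℝ) ^ 2

theorem weylMass_neg (k : ℕ) (m : ℤ) : weylMass α u a L k (-m) = weylMass α u a L k m := by
  simp only [weylMass, norm_trigSum_neg]

theorem weylMass_zero (ha : ∀ k j, 0 ≤ a k j) (k : ℕ) :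
    weylMass α u a L k 0 = ((1 / (u k : ℝ)) * ∑ j ∈ Finset.range (L k), a k j) ^ 2 := by
  have : trigSum (Finset.range (L k)) (a k) (sqFreq α) 0 =
      ((∑ j ∈ Finset.range (L k), a k j : ℝ) : ℂ) := by
    simp [trigSum, e_zero]
  rw [weylMass, this, Complex.norm_real, Real.norm_of_nonneg (Finset.sum_nonneg fun _ _ => ha _ _)]
  ring

theorem weylMass_nonneg (k : ℕ) (m : ℤ) : 0 ≤ weylMass α u a L k m := by
  unfold weylMass; positivity

/-- The cumulative masses grow at most linearly, uniformly in `k`. -/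
theorem exists_sum_weylMass_le (hN : ∀ᶠ k in atTop, (0 : ℝ) < u k) (ha : ∀ k j, 0 ≤ a k j)
    (hw0 : Tendsto (fun k => weylMass α u a L k 0) atTop (𝓝 (I₁ ^ 2)))
    (h3 : ∀ x : ℝ, 0 < x → Tendsto (fun k => ∑ m ∈ Finset.Icc 1 ⌊(u k : ℝ) * x⌋₊,
      weylMass α u a L k (m : ℕ)) atTop (𝓝 (I₂ * x))) :
    ∃ C : ℝ, 0 ≤ C ∧ ∀ᶠ k in atTop, ∀ x : ℝ, 0 ≤ x →
      ∑ m ∈ Finset.Icc 1 ⌊(u k : ℝ) * x⌋₊, weylMass α u a L k (m : ℕ) ≤ C * (1 + x) := by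
  -- the interval `[1, N x]` is covered by `⌊x⌋ + 1` intervals of length `N`, each of which is
  -- compared with `[1, 2 N]`
  have hlim := (hw0.const_mul 2).add ((h3 2 two_pos).const_mul 4)
  refine ⟨max 0 (2 * I₁ ^ 2 + 4 * (I₂ * 2) + 1), le_max_left _ _, ?_⟩
  filter_upwards [hN, hlim.eventually_le_const (lt_add_one _)] with k hk hle x hx
  have h := sum_normSq_trigSum_le (Finset.range (L k)) (sqFreq α) (fun j _ => ha k j) (u k)
    (⌊x⌋₊ + 1)
  have h' := div_le_div_of_nonneg_right h (show (0 : ℝ) ≤ (u k : ℝ) ^ 2 by positivity)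
  rw [Finset.sum_div, mul_div_assoc, add_div, mul_div_assoc, mul_div_assoc, Finset.sum_div] at h'
  have h2 : ⌊(u k : ℝ) * 2⌋₊ = 2 * u k := by
    rw [show (u k : ℝ) * 2 = ((2 * u k : ℕ) : ℝ) by push_cast; ring, Nat.floor_natCast]
  rw [h2] at hle
  have h'' : ∑ m ∈ Finset.Icc 1 (u k * (⌊x⌋₊ + 1)), weylMass α u a L k (m : ℕ) ≤
      ((⌊x⌋₊ + 1 : ℕ) : ℝ) * (2 * weylMass α u a L k 0 +
        4 * ∑ m ∈ Finset.Icc 1 (2 * u k), weylMass α u a L k (m : ℕ)) := h'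
  calc _ ≤ ∑ m ∈ Finset.Icc 1 (u k * (⌊x⌋₊ + 1)), weylMass α u a L k (m : ℕ) := by
        refine Finset.sum_le_sum_of_subset_of_nonneg (Finset.Icc_subset_Icc_right ?_)
          fun _ _ _ => weylMass_nonneg _ _
        refine Nat.floor_le_of_le ?_
        push_cast
        gcongr
        exact (Nat.lt_floor_add_one x).le
    _ ≤ _ := h''
    _ ≤ (1 + x) * max 0 (2 * I₁ ^ 2 + 4 * (I₂ * 2) + 1) := by
        have hfl : ((⌊x⌋₊ + 1 : ℕ) : ℝ) ≤ 1 + x := by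
          push_cast; linarith [Nat.floor_le hx]
        have : 0 ≤ ∑ m ∈ Finset.Icc 1 (2 * u k), weylMass α u a L k (m : ℕ) :=
          Finset.sum_nonneg fun _ _ => weylMass_nonneg _ _
        have h0 := weylMass_nonneg (α := α) (u := u) (a := a) (L := L) k 0
        exact mul_le_mul hfl (hle.trans (le_max_right _ _))
          (add_nonneg (mul_nonneg zero_le_two h0) (mul_nonneg zero_le_four this)) (by linarith)
    _ = _ := mul_comm _ _

theorem tsum_int_split {F : ℤ → ℂ} (hF : Summable F) :
    ∑' m, F m = F 0 + ∑' n : ℕ, F (n + 1 : ℕ) + ∑' n : ℕ, F (-(n + 1 : ℕ)) := by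
  have s1 : Summable fun n : ℕ => F n :=
    hF.comp_injective (i := fun n : ℕ => (n : ℤ)) Nat.cast_injective
  have s2 : Summable fun n : ℕ => F (-(n + 1)) :=
    hF.comp_injective (i := fun n : ℕ => (-((n : ℤ) + 1))) fun x y h => by simpa using h
  rw [tsum_of_nat_of_neg_add_one s1 s2, s1.tsum_eq_zero_add]
  push_cast
  rfl

/-- Summation of a Schwartz function against the masses of all `m ∈ ℤ`. The mass at `m = 0` has to
be kept apart; it tends to `I₁²`. -/
theorem tendsto_tsum_weylMass (hu : Tendsto u atTop atTop) (ha : ∀ k j, 0 ≤ a k j)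
    (h1 : Tendsto (fun k => (1 / (u k : ℝ)) * ∑ j ∈ Finset.range (L k), a k j) atTop (𝓝 I₁))
    (h3 : ∀ x : ℝ, 0 < x → Tendsto (fun k => ∑ m ∈ Finset.Icc 1 ⌊(u k : ℝ) * x⌋₊,
      weylMass α u a L k (m : ℕ)) atTop (𝓝 (I₂ * x)))
    (Q : 𝓢(ℝ, ℂ)) :
    Tendsto (fun k => ∑' m : ℤ, Q (m / (u k : ℝ)) * (weylMass α u a L k m : ℂ)) atTop
      (𝓝 (I₁ ^ 2 * Q 0 + I₂ * ∫ x, Q x)) := by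
  have hN : ∀ᶠ k in atTop, (0 : ℝ) < u k := by
    filter_upwards [hu.eventually_gt_atTop 0] with k hk
    exact_mod_cast hk
  have hnn : ∀ k m, 0 ≤ weylMass α u a L k m := weylMass_nonneg
  have hw0 : Tendsto (fun k => weylMass α u a L k 0) atTop (𝓝 (I₁ ^ 2)) := by
    simp only [weylMass_zero ha]; exact h1.pow 2
  obtain ⟨C, hC, hb⟩ := exists_sum_weylMass_le hN ha hw0 h3
  have hc : ∀ k m, 0 ≤ (fun k m : ℕ => weylMass α u a L k (m : ℕ)) k m := fun k m => hnn _ _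
  have hpos := tendsto_tsum_schwartz Q hN hc hC hb h3
  have hneg := tendsto_tsum_schwartz (dilate (-1) (by norm_num) Q) hN hc hC hb h3
  have htot := ((hw0.ofReal.const_mul (Q 0)).add hpos).add hneg
  have hlimit : Q 0 * ((I₁ ^ 2 : ℝ) : ℂ) + I₂ * (∫ x in Set.Ioi (0 : ℝ), Q x) +
      I₂ * (∫ x in Set.Ioi (0 : ℝ), dilate (-1) (by norm_num) Q x) =
      I₁ ^ 2 * Q 0 + I₂ * ∫ x, Q x := by
    have : ∫ x in Set.Ioi (0 : ℝ), dilate (-1) (by norm_num) Q x = ∫ x in Set.Iic 0, Q x := by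
      simp only [dilate_apply, neg_one_mul]
      rw [integral_comp_neg_Ioi (0 : ℝ) (fun x => Q x), neg_zero]
    have hadd := intervalIntegral.integral_Iic_add_Ioi (μ := volume) (b := (0 : ℝ))
      Q.integrable.integrableOn Q.integrable.integrableOn
    rw [this, ← hadd]
    push_cast; ring
  rw [hlimit] at htot
  refine htot.congr' ?_
  filter_upwards [hN] with k hk
  have hsum : Summable fun m : ℤ => Q (m / (u k : ℝ)) * (weylMass α u a L k m : ℂ) := by
    refine Summable.of_norm_bounded
      (g := fun m : ℤ => ‖Q (m / (u k : ℝ))‖ * weylMass α u a L k 0)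
      ((summable_schwartz_int Q _ hk).norm.mul_right _) fun m => ?_
    rw [norm_mul, Complex.norm_real, Real.norm_of_nonneg (hnn _ _)]
    refine mul_le_mul_of_nonneg_left ?_ (norm_nonneg _)
    rw [weylMass_zero ha, weylMass]
    have := norm_trigSum_le (Finset.range (L k)) (sqFreq α) (fun j _ => ha k j) m
    rw [mul_pow, one_div, inv_pow, mul_comm, ← div_eq_mul_inv]
    gcongr
  rw [tsum_int_split hsum]
  congr 1
  · congr 1
    simp
  · refine tsum_congr fun m => ?_
    rw [dilate_apply, weylMass_neg]
    congr 2
    push_cast; ring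

/-- The smoothed pair correlation sum of `j² α` with weights `a`. By Poisson summation, the sum
over all pairs is a sum of `𝓕 h` against the masses; its limit is `I₁² ∫ h + I₂ h(0)`, and the
diagonal contributes `I₂ h(0)`. -/
theorem tendsto_weighted_pairs (hu : Tendsto u atTop atTop) (ha : ∀ k j, 0 ≤ a k j)
    (h1 : Tendsto (fun k => (1 / (u k : ℝ)) * ∑ j ∈ Finset.range (L k), a k j) atTop (𝓝 I₁))
    (h2 : Tendsto (fun k => (1 / (u k : ℝ)) * ∑ j ∈ Finset.range (L k), a k j ^ 2) atTop (𝓝 I₂))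
    (h3 : ∀ x : ℝ, 0 < x → Tendsto (fun k => ∑ m ∈ Finset.Icc 1 ⌊(u k : ℝ) * x⌋₊,
      weylMass α u a L k (m : ℕ)) atTop (𝓝 (I₂ * x)))
    (h : ℝ → ℝ) (hh : ContDiff ℝ (⊤ : ℕ∞) h) (hs : HasCompactSupport h) :
    Tendsto (fun k => (1 / (u k : ℝ)) * ∑ j ∈ Finset.range (L k), ∑ i ∈ Finset.range (L k),
      if j = i then 0 else a k j * a k i *
        ∑' n : ℤ, h (u k * ((j : ℝ) ^ 2 * α - (i : ℝ) ^ 2 * α + n))) atTop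
      (𝓝 (I₁ ^ 2 * ∫ x, h x)) := by
  have hs' : HasCompactSupport fun x => (h x : ℂ) := hs.comp_left Complex.ofReal_zero
  set H : 𝓢(ℝ, ℂ) := hs'.toSchwartzMap (Complex.ofRealCLM.contDiff.comp hh) with hH
  have hHa : ∀ x, H x = (h x : ℂ) := fun x => rfl
  have hN : ∀ᶠ k in atTop, (0 : ℝ) < u k := by
    filter_upwards [hu.eventually_gt_atTop 0] with k hk
    exact_mod_cast hk
  have hfull := tendsto_tsum_weylMass hu ha h1 h3 (𝓕 H)
  rw [integral_fourier_schwartz, fourier_zero_eq_integral] at hfull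
  -- on the diagonal, only `n = 0` contributes once `N` is large
  have hdiag : ∀ᶠ k in atTop, ∑' n : ℤ, h (u k * (n : ℝ)) = h 0 := by
    obtain ⟨R, hR⟩ := hs.isCompact.isBounded.subset_closedBall 0
    filter_upwards [(tendsto_natCast_atTop_atTop.comp hu).eventually_gt_atTop R, hN] with k hk hk0
    rw [tsum_eq_single 0]
    · simp
    · intro n hn
      by_contra hne
      have := hR (subset_tsupport _ (Function.mem_support.mpr hne))
      rw [mem_closedBall_zero_iff, Real.norm_eq_abs, abs_mul, abs_of_pos hk0] at this
      have hn1 : (1 : ℝ) ≤ |(n : ℝ)| := by exact_mod_cast Int.one_le_abs hn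
      simp only [Function.comp] at hk
      nlinarith
  have hre := (Complex.continuous_re.tendsto _).comp hfull
  have hsub := hre.sub (h2.mul_const (h 0))
  have hlimit : (I₁ ^ 2 * (∫ x, H x) + I₂ * H 0 : ℂ).re - I₂ * h 0 = I₁ ^ 2 * ∫ x, h x := by
    simp only [hHa]
    rw [integral_complex_ofReal]
    norm_cast
    simp
  rw [hlimit] at hsub
  refine hsub.congr' ?_
  filter_upwards [hN, hdiag] with k hk hd
  have hP : ∀ t : ℝ, ((∑' n : ℤ, h (u k * (t + n)) : ℝ) : ℂ) =
      (1 / (u k : ℝ) : ℂ) * ∑' m : ℤ, 𝓕 H (m / (u k : ℝ)) * e (m * t) := by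
    intro t
    rw [Complex.ofReal_tsum]
    exact poisson_dilate (u k) hk H t
  have hsm : ∀ t : ℝ, Summable fun m : ℤ => 𝓕 H (m / (u k : ℝ)) * e (m * t) := by
    intro t
    refine Summable.of_norm ?_
    simp only [norm_mul, norm_e, mul_one]
    exact (summable_schwartz_int (𝓕 H) _ hk).norm
  have hall : ((1 / (u k : ℝ) * ∑ j ∈ Finset.range (L k), ∑ i ∈ Finset.range (L k),
      a k j * a k i * ∑' n : ℤ, h (u k * ((j : ℝ) ^ 2 * α - (i : ℝ) ^ 2 * α + n)) : ℝ) : ℂ) =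
      ∑' m : ℤ, 𝓕 H (m / (u k : ℝ)) * (weylMass α u a L k m : ℂ) := by
    push_cast
    have hkC : ((u k : ℝ) : ℂ) ≠ 0 := by exact_mod_cast hk.ne'
    have hP' := hP
    push_cast at hP'
    simp only [hP']
    have : ∀ m : ℤ, 𝓕 H (m / (u k : ℝ)) * (weylMass α u a L k m : ℂ) =
        ∑ j ∈ Finset.range (L k), ∑ i ∈ Finset.range (L k), (1 / (u k : ℂ) ^ 2 * (a k j * a k i)) *
          (𝓕 H (m / (u k : ℝ)) * e (m * ((j : ℝ) ^ 2 * α - (i : ℝ) ^ 2 * α))) := by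
      intro m
      rw [weylMass, Complex.ofReal_div, normSq_trigSum]
      simp only [sqFreq]
      push_cast
      rw [Finset.sum_div, Finset.mul_sum]
      refine Finset.sum_congr rfl fun j _ => ?_
      rw [Finset.sum_div, Finset.mul_sum]
      refine Finset.sum_congr rfl fun i _ => ?_
      ring
    simp only [this]
    rw [Summable.tsum_finsetSum fun j _ => summable_sum fun i _ => (hsm _).mul_left _,
      Finset.mul_sum]
    refine Finset.sum_congr rfl fun j _ => ?_
    rw [Summable.tsum_finsetSum fun i _ => (hsm _).mul_left _, Finset.mul_sum]
    refine Finset.sum_congr rfl fun i _ => ?_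
    rw [tsum_mul_left]
    ring
  have hall' := congrArg Complex.re hall
  rw [Complex.ofReal_re] at hall'
  simp only [Function.comp]
  rw [← hall', mul_assoc, ← mul_sub]
  congr 1
  rw [Finset.sum_mul, ← Finset.sum_sub_distrib]
  refine Finset.sum_congr rfl fun j hj => ?_
  have hsplit : ∀ i, (if j = i then 0 else a k j * a k i *
        ∑' n : ℤ, h (u k * ((j : ℝ) ^ 2 * α - (i : ℝ) ^ 2 * α + n))) =
      a k j * a k i * ∑' n : ℤ, h (u k * ((j : ℝ) ^ 2 * α - (i : ℝ) ^ 2 * α + n)) -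
        if j = i then a k j ^ 2 * h 0 else 0 := by
    intro i
    split_ifs with hji
    · subst hji
      simp only [sub_self, zero_add, hd]; ring
    · simp
  simp only [hsplit]
  rw [Finset.sum_sub_distrib, Finset.sum_ite_eq, if_pos hj]

end Core

end

/-! ### Sandwiching the pair correlation function -/

theorem summable_lattice {h : ℝ → ℝ} (hs : HasCompactSupport h) {N : ℝ} (hN : 0 < N) (t : ℝ) :
    Summable fun n : ℤ => h (N * (t + n)) := by
  obtain ⟨R, hR⟩ := hs.isCompact.isBounded.subset_closedBall 0
  refine summable_of_hasFiniteSupport ((Set.finite_Icc ⌊-(R / N) - t⌋ ⌈R / N - t⌉).subset ?_)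
  intro n hn
  have := hR (subset_tsupport _ hn)
  rw [mem_closedBall_zero_iff, Real.norm_eq_abs, abs_mul, abs_of_pos hN, mul_comm,
    ← le_div_iff₀ hN, abs_le] at this
  constructor
  · rw [Int.floor_le_iff]; linarith
  · rw [Int.le_ceil_iff]; linarith

open Classical in
/-- The pair correlation function as a sum of indicators. -/
theorem pairCorrelation_eq_sum (a b α : ℝ) {N : ℕ} (hN : 0 < N) :
    pairCorrelation a b α N = (1 / (N : ℝ)) * ∑ p ∈ Finset.Icc 1 N ×ˢ Finset.Icc 1 N,
      if p.1 ≠ p.2 ∧ ∃ n : ℤ, N * ((p.1 : ℝ) ^ 2 * α - (p.2 : ℝ) ^ 2 * α + n) ∈ Set.Icc a b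
      then 1 else 0 := by
  have hN' : (0 : ℝ) < N := by exact_mod_cast hN
  rw [pairCorrelation, Finset.sum_boole, ← Set.ncard_coe_finset]
  congr 3
  ext ⟨j, i⟩
  simp only [Set.mem_ofPred_eq, Finset.coe_filter, Finset.mem_product, Finset.mem_Icc]
  constructor
  · rintro ⟨h1, h2, h3, h4, h5, t, ht, n, hn⟩
    refine ⟨⟨⟨h1, h2⟩, h3, h4⟩, h5, -n, ?_⟩
    have : (N : ℝ) * ((j : ℝ) ^ 2 * α - (i : ℝ) ^ 2 * α + ((-n : ℤ) : ℝ)) = t * N := by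
      rw [hn]; push_cast; ring
    rw [this]
    exact ⟨(div_le_iff₀ hN').mp ht.1, (le_div_iff₀ hN').mp ht.2⟩
  · rintro ⟨⟨⟨h1, h2⟩, h3, h4⟩, h5, n, hn⟩
    refine ⟨h1, h2, h3, h4, h5, (j : ℝ) ^ 2 * α - (i : ℝ) ^ 2 * α + n, ?_, -n, by push_cast; ring⟩
    exact ⟨(div_le_iff₀ hN').mpr (by linarith [hn.1]), (le_div_iff₀ hN').mpr (by linarith [hn.2])⟩

theorem pairCorrelation_nonneg (a b α : ℝ) (N : ℕ) : 0 ≤ pairCorrelation a b α N := by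
  unfold pairCorrelation; positivity

/-- Weights `a k j` on `j < L k`, at scale `u k`, that have a mean value `I₁`, a mean square `I₂`,
and whose Weyl sums have the mean square predicted by the diagonal terms. -/
def MeanSquareLaw (α : ℝ) (u : ℕ → ℕ) (a : ℕ → ℕ → ℝ) (L : ℕ → ℕ) (I₁ I₂ : ℝ) : Prop :=
  (∀ k j, 0 ≤ a k j) ∧
  Tendsto (fun k => (1 / (u k : ℝ)) * ∑ j ∈ Finset.range (L k), a k j) atTop (𝓝 I₁) ∧
  Tendsto (fun k => (1 / (u k : ℝ)) * ∑ j ∈ Finset.range (L k), a k j ^ 2) atTop (𝓝 I₂) ∧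
  ∀ x : ℝ, 0 < x → Tendsto (fun k => ∑ m ∈ Finset.Icc 1 ⌊(u k : ℝ) * x⌋₊,
      weylMass α u a L k (m : ℕ)) atTop (𝓝 (I₂ * x))

section Sandwich

variable {α : ℝ} {u : ℕ → ℕ}

/-- The upper bound, from weights above the indicator function of `[1, N]` and a smooth function
above that of `[A, B]`. -/
theorem eventually_pairCorrelation_lt (hu : Tendsto u atTop atTop)
    {a : ℕ → ℕ → ℝ} {L : ℕ → ℕ} {I₁ I₂ : ℝ} (hw : MeanSquareLaw α u a L I₁ I₂)
    (hone : ∀ k, ∀ j ∈ Finset.Icc 1 (u k), 1 ≤ a k j ∧ j < L k)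
    {A B t c : ℝ} (hAB : A ≤ B) (ht : 0 < t) (hc : I₁ ^ 2 * (B - A + 4 * t) < c) :
    ∀ᶠ k in atTop, pairCorrelation A B α (u k) < c := by
  classical
  obtain ⟨ha, h1, h2, h3⟩ := hw
  let h : ContDiffBump ((A + B) / 2) := ⟨(B - A) / 2 + t, (B - A) / 2 + 2 * t, by linarith,
    by linarith⟩
  have hlim := tendsto_weighted_pairs hu ha h1 h2 h3 h h.contDiff h.hasCompactSupport
  have hint : ∫ x, h x ≤ B - A + 4 * t := by
    refine (h.integral_le_measure_closedBall (μ := volume)).trans ?_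
    rw [Real.volume_real_closedBall (by have := h.rOut_pos; exact this.le)]
    change 2 * ((B - A) / 2 + 2 * t) ≤ _
    linarith
  have hlt : I₁ ^ 2 * ∫ x, h x < c :=
    (mul_le_mul_of_nonneg_left hint (sq_nonneg _)).trans_lt hc
  filter_upwards [hlim.eventually_lt_const hlt, hu.eventually_gt_atTop 0] with k hk hk0
  refine lt_of_le_of_lt ?_ hk
  have hk0' : (0 : ℝ) < u k := by exact_mod_cast hk0
  rw [pairCorrelation_eq_sum _ _ _ hk0, ← Finset.sum_product']
  refine mul_le_mul_of_nonneg_left ?_ (by positivity)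
  have hnn : ∀ x : ℕ × ℕ, 0 ≤ (if x.1 = x.2 then 0 else a k x.1 * a k x.2 *
        ∑' n : ℤ, h (u k * ((x.1 : ℝ) ^ 2 * α - (x.2 : ℝ) ^ 2 * α + n))) := by
    intro x
    split_ifs
    · exact le_rfl
    · exact mul_nonneg (mul_nonneg (ha _ _) (ha _ _)) (tsum_nonneg fun n => h.nonneg)
  refine (Finset.sum_le_sum fun p hp => ?_).trans
    (Finset.sum_le_sum_of_subset_of_nonneg (s := Finset.Icc 1 (u k) ×ˢ Finset.Icc 1 (u k)) ?_
      fun x _ _ => hnn x)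
  · split_ifs with hP heq heq
    · exact absurd heq hP.1
    · obtain ⟨n, hn⟩ := hP.2
      rw [Finset.mem_product] at hp
      have hj := (hone k _ hp.1).1
      have hi := (hone k _ hp.2).1
      have h1n : h (u k * ((p.1 : ℝ) ^ 2 * α - (p.2 : ℝ) ^ 2 * α + n)) = 1 := by
        refine h.one_of_mem_closedBall ?_
        rw [Metric.mem_closedBall, Real.dist_eq, abs_le]
        change -((B - A) / 2 + t) ≤ _ ∧ _ ≤ ((B - A) / 2 + t)
        constructor <;> linarith [hn.1, hn.2]
      have hts : 1 ≤ ∑' n : ℤ, h (u k * ((p.1 : ℝ) ^ 2 * α - (p.2 : ℝ) ^ 2 * α + n)) := by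
        rw [← h1n]
        exact (summable_lattice h.hasCompactSupport hk0' _).le_tsum n fun _ _ => h.nonneg
      calc (1 : ℝ) = 1 * 1 * 1 := by norm_num
        _ ≤ _ := by gcongr
    · exact le_rfl
    · exact mul_nonneg (mul_nonneg (ha _ _) (ha _ _)) (tsum_nonneg fun n => h.nonneg)
  · refine Finset.product_subset_product ?_ ?_ <;>
    · intro j hj
      exact Finset.mem_range.mpr (hone k j hj).2

/-- The lower bound, from weights below the indicator function of `[1, N]` and a smooth function
below that of `[A, B]`. -/
theorem eventually_lt_pairCorrelation (hu : Tendsto u atTop atTop)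
    {a : ℕ → ℕ → ℝ} {L : ℕ → ℕ} {I₁ I₂ : ℝ} (hw : MeanSquareLaw α u a L I₁ I₂)
    (hone : ∀ k j, a k j ≤ if j ∈ Finset.Icc 1 (u k) then 1 else 0)
    {A B t c : ℝ} (ht : 0 < t) (htAB : 4 * t < B - A) (hc : c < I₁ ^ 2 * (B - A - 4 * t)) :
    ∀ᶠ k in atTop, c < pairCorrelation A B α (u k) := by
  classical
  obtain ⟨ha, h1, h2, h3⟩ := hw
  let h : ContDiffBump ((A + B) / 2) := ⟨(B - A) / 2 - 2 * t, (B - A) / 2 - t, by linarith,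
    by linarith⟩
  have hlim := tendsto_weighted_pairs hu ha h1 h2 h3 h h.contDiff h.hasCompactSupport
  have hint : B - A - 4 * t ≤ ∫ x, h x := by
    refine le_trans ?_ (h.measure_closedBall_le_integral (μ := volume))
    rw [Real.volume_real_closedBall (by have := h.rIn_pos; exact this.le)]
    change _ ≤ 2 * ((B - A) / 2 - 2 * t)
    linarith
  have hlt : c < I₁ ^ 2 * ∫ x, h x :=
    hc.trans_le (mul_le_mul_of_nonneg_left hint (sq_nonneg _))
  have hbig := (tendsto_natCast_atTop_atTop (R := ℝ)).comp hu
  filter_upwards [hlim.eventually_const_lt hlt, hu.eventually_gt_atTop 0,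
    hbig.eventually_gt_atTop (B - A)] with k hk hk0 hkAB
  refine lt_of_lt_of_le hk ?_
  have hk0' : (0 : ℝ) < u k := by exact_mod_cast hk0
  simp only [Function.comp] at hkAB
  have hsupp : ∀ x, h x ≠ 0 → x ∈ Set.Icc A B := by
    intro x hx
    have : x ∈ Function.support h := hx
    rw [h.support_eq, Metric.mem_ball, Real.dist_eq, abs_lt] at this
    change -((B - A) / 2 - t) < _ ∧ _ < ((B - A) / 2 - t) at this
    constructor <;> linarith [this.1, this.2]
  rw [pairCorrelation_eq_sum _ _ _ hk0, ← Finset.sum_product']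
  refine mul_le_mul_of_nonneg_left ?_ (by positivity)
  have hzero : ∀ x : ℕ × ℕ, x ∉ Finset.Icc 1 (u k) ×ˢ Finset.Icc 1 (u k) →
      a k x.1 * a k x.2 = 0 := by
    intro x hx
    rw [Finset.mem_product, not_and_or] at hx
    rcases hx with hx | hx
    · have := hone k x.1
      rw [if_neg hx] at this
      rw [le_antisymm this (ha _ _), zero_mul]
    · have := hone k x.2
      rw [if_neg hx] at this
      rw [le_antisymm this (ha _ _), mul_zero]
  have hle1 : ∀ j, a k j ≤ 1 := fun j => (hone k j).trans (by split_ifs <;> norm_num)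
  set S := Finset.range (L k) ×ˢ Finset.range (L k)
  set T := Finset.Icc 1 (u k) ×ˢ Finset.Icc 1 (u k)
  calc _ = ∑ x ∈ S with x ∈ T, (if x.1 = x.2 then 0 else a k x.1 * a k x.2 *
        ∑' n : ℤ, h (u k * ((x.1 : ℝ) ^ 2 * α - (x.2 : ℝ) ^ 2 * α + n))) := by
        refine (Finset.sum_filter_of_ne fun x _ hx => ?_).symm
        by_contra hxT
        rw [hzero x hxT, zero_mul, ite_self] at hx
        exact hx rfl
    _ ≤ ∑ x ∈ S with x ∈ T, (if x.1 ≠ x.2 ∧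
          ∃ n : ℤ, u k * ((x.1 : ℝ) ^ 2 * α - (x.2 : ℝ) ^ 2 * α + n) ∈ Set.Icc A B
          then 1 else 0) := by
        refine Finset.sum_le_sum fun p _ => ?_
        split_ifs with heq hP hP
        · exact zero_le_one
        · exact le_rfl
        · obtain ⟨hne, n, hn⟩ := hP
          -- the translates of `[A, B]` by multiples of `N > B - A` are disjoint
          rw [tsum_eq_single n]
          · calc _ ≤ (1 : ℝ) * 1 * 1 := by
                  exact mul_le_mul (mul_le_mul (hle1 _) (hle1 _) (ha _ _) zero_le_one) h.le_one
                    h.nonneg (by norm_num)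
              _ = 1 := by norm_num
          · intro m hm
            by_contra hne0
            have hm' := hsupp _ hne0
            have h1 : (u k : ℝ) * |((m - n : ℤ) : ℝ)| ≤ B - A := by
              calc (u k : ℝ) * |((m - n : ℤ) : ℝ)| = |(u k : ℝ) * ((m - n : ℤ) : ℝ)| := by
                    rw [abs_mul, abs_of_pos hk0']
                _ ≤ _ := ?_
              rw [abs_le]
              push_cast
              constructor <;> nlinarith [hm'.1, hm'.2, hn.1, hn.2]
            have h2 : (1 : ℝ) ≤ |((m - n : ℤ) : ℝ)| := by
              exact_mod_cast Int.one_le_abs (sub_ne_zero.mpr hm)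
            nlinarith
        · have : ∀ n : ℤ, h (u k * ((p.1 : ℝ) ^ 2 * α - (p.2 : ℝ) ^ 2 * α + n)) = 0 := by
            intro n
            by_contra hne0
            exact hP ⟨heq, n, hsupp _ hne0⟩
          simp [this]
    _ ≤ _ := by
        refine Finset.sum_le_sum_of_subset_of_nonneg (fun x hx => (Finset.mem_filter.mp hx).2) ?_
        intro x _ _
        split_ifs <;> norm_num

/-- If the indicator function of `[1, N]` can be approximated from above and from below by weights
obeying the mean square law, the pair correlation is that of random points. -/
theorem tendsto_pairCorrelation_of_weights (hu : Tendsto u atTop atTop)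
    (hup : ∀ δ : ℝ, 0 < δ → ∃ a L I₁ I₂, MeanSquareLaw α u a L I₁ I₂ ∧
      (∀ k, ∀ j ∈ Finset.Icc 1 (u k), 1 ≤ a k j ∧ j < L k) ∧ I₁ ^ 2 ≤ 1 + δ)
    (hlo : ∀ δ : ℝ, 0 < δ → ∃ a L I₁ I₂, MeanSquareLaw α u a L I₁ I₂ ∧
      (∀ k j, a k j ≤ if j ∈ Finset.Icc 1 (u k) then 1 else 0) ∧ 1 - δ ≤ I₁ ^ 2)
    (A B : ℝ) (hAB : A ≤ B) :
    Tendsto (fun k => pairCorrelation A B α (u k)) atTop (𝓝 (B - A)) := by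
  rw [tendsto_order]
  constructor
  · intro c hc
    rcases lt_or_ge c 0 with hc0 | hc0
    · exact Eventually.of_forall fun k => hc0.trans_le (pairCorrelation_nonneg _ _ _ _)
    have hlim : Tendsto (fun t : ℝ => (1 - t) * (B - A - 4 * t)) (𝓝[>] 0) (𝓝 (B - A)) := by
      have : Tendsto (fun t : ℝ => (1 - t) * (B - A - 4 * t)) (𝓝 0)
        (𝓝 ((1 - 0) * (B - A - 4 * 0))) := Continuous.tendsto (by fun_prop) 0
      simp only [sub_zero, mul_zero, one_mul] at this
      exact this.mono_left nhdsWithin_le_nhds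
    have hsmall : ∀ᶠ t : ℝ in 𝓝[>] 0, 4 * t < B - A := by
      have : Tendsto (fun t : ℝ => 4 * t) (𝓝 0) (𝓝 (4 * 0)) := Continuous.tendsto (by fun_prop) 0
      rw [mul_zero] at this
      exact (this.mono_left nhdsWithin_le_nhds).eventually_lt_const (hc0.trans_lt hc)
    obtain ⟨t, ⟨ht1, ht2⟩, ht⟩ :=
      ((hlim.eventually_const_lt hc).and hsmall |>.and self_mem_nhdsWithin).exists
    have ht : 0 < t := ht
    obtain ⟨a, L, I₁, I₂, hw, hone, hI⟩ := hlo t ht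
    refine eventually_lt_pairCorrelation hu hw hone ht ht2 (ht1.trans_le ?_)
    gcongr
  · intro c hc
    have hlim : Tendsto (fun t : ℝ => (1 + t) * (B - A + 4 * t)) (𝓝[>] 0) (𝓝 (B - A)) := by
      have : Tendsto (fun t : ℝ => (1 + t) * (B - A + 4 * t)) (𝓝 0)
        (𝓝 ((1 + 0) * (B - A + 4 * 0))) := Continuous.tendsto (by fun_prop) 0
      simp only [add_zero, mul_zero, one_mul] at this
      exact this.mono_left nhdsWithin_le_nhds
    obtain ⟨t, ht1, ht⟩ := ((hlim.eventually_lt_const hc).and self_mem_nhdsWithin).exists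
    have ht : 0 < t := ht
    obtain ⟨a, L, I₁, I₂, hw, hone, hI⟩ := hup t ht
    refine eventually_pairCorrelation_lt hu hw hone hAB ht (lt_of_le_of_lt ?_ ht1)
    gcongr

end Sandwich

/-! ### Passing from fourth powers to all integers -/

/-- The number of pairs grows with `N` and with the interval `[A / N, B / N]`. -/
theorem mul_pairCorrelation_le {α A B A' B' : ℝ} {N N' : ℕ} (hN : 0 < N) (hNN : N ≤ N')
    (hA : A' / N' ≤ A / N) (hB : B / N ≤ B' / N') :
    N * pairCorrelation A B α N ≤ N' * pairCorrelation A' B' α N' := by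
  have h1 : (0 : ℝ) < N := by exact_mod_cast hN
  have h2 : (0 : ℝ) < N' := by exact_mod_cast hN.trans_le hNN
  unfold pairCorrelation
  rw [← mul_assoc, ← mul_assoc, mul_one_div_cancel h1.ne', mul_one_div_cancel h2.ne', one_mul,
    one_mul]
  norm_cast
  refine Set.ncard_le_ncard ?_ ?_
  · rintro ⟨j, i⟩ ⟨q1, q2, q3, q4, q5, t, ht, n, hn⟩
    exact ⟨q1, q2.trans hNN, q3, q4.trans hNN, q5, t, ⟨hA.trans ht.1, ht.2.trans hB⟩, n, hn⟩
  · refine ((Set.finite_Icc 1 N').prod (Set.finite_Icc 1 N')).subset ?_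
    rintro ⟨j, i⟩ ⟨q1, q2, q3, q4, -⟩
    exact ⟨⟨q1, q2⟩, q3, q4⟩

/-- Convergence along fourth powers suffices, as the ratio of consecutive fourth powers tends to
one and the number of pairs is monotone. -/
theorem tendsto_pairCorrelation_of_pow_four {α : ℝ}
    (h : ∀ A B : ℝ, A ≤ B →
      Tendsto (fun k : ℕ => pairCorrelation A B α (k ^ 4)) atTop (𝓝 (B - A)))
    (A B : ℝ) (hAB : A ≤ B) : Tendsto (fun N : ℕ => pairCorrelation A B α N) atTop (𝓝 (B - A)) := by
  -- `K N` is the integer part of the fourth root of `N`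
  set K : ℕ → ℕ := fun N => Nat.sqrt (Nat.sqrt N) with hK
  have hK1 : ∀ N, K N ^ 4 ≤ N := fun N => by
    calc K N ^ 4 = (K N ^ 2) ^ 2 := by ring
      _ ≤ Nat.sqrt N ^ 2 := Nat.pow_le_pow_left (Nat.sqrt_le' _) 2
      _ ≤ N := Nat.sqrt_le' _
  have hK2 : ∀ N, N ≤ (K N + 1) ^ 4 := fun N => by
    calc N ≤ (Nat.sqrt N + 1) ^ 2 := (Nat.lt_succ_sqrt' N).le
      _ ≤ ((K N + 1) ^ 2) ^ 2 := Nat.pow_le_pow_left (Nat.lt_succ_sqrt' _) 2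
      _ = (K N + 1) ^ 4 := by ring
  have hKt : Tendsto K atTop atTop := by
    rw [tendsto_atTop]
    intro b
    filter_upwards [eventually_ge_atTop (b ^ 4)] with N hN
    by_contra hlt
    push Not at hlt
    have : N < b ^ 4 := by
      have h1 : Nat.sqrt N < b ^ 2 := by rw [← Nat.sqrt_lt']; exact hlt
      calc N < (b ^ 2) ^ 2 := by rw [← Nat.sqrt_lt']; exact h1
        _ = b ^ 4 := by ring
    omega
  have hratio : Tendsto (fun N : ℕ => (((K N + 1 : ℕ) : ℝ) / (K N : ℝ)) ^ 4) atTop (𝓝 1) := by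
    have h1 : Tendsto (fun n : ℕ => ((n + 1 : ℕ) : ℝ) / (n : ℝ)) atTop (𝓝 1) := by
      have : Tendsto (fun n : ℕ => 1 + 1 / (n : ℝ)) atTop (𝓝 (1 + 0)) :=
        tendsto_const_nhds.add tendsto_one_div_atTop_nhds_zero_nat
      rw [add_zero] at this
      refine this.congr' ?_
      filter_upwards [eventually_gt_atTop 0] with n hn
      have : (n : ℝ) ≠ 0 := by exact_mod_cast hn.ne'
      push_cast; field_simp
    simpa using (h1.comp hKt).pow 4
  have hup : Tendsto (fun N : ℕ => (((K N + 1) ^ 4 : ℕ) : ℝ) / N) atTop (𝓝 1) := by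
    refine tendsto_of_tendsto_of_tendsto_of_le_of_le' tendsto_const_nhds hratio ?_ ?_
    · filter_upwards [eventually_gt_atTop 0] with N hN
      rw [le_div_iff₀ (by exact_mod_cast hN), one_mul]
      exact_mod_cast hK2 N
    · filter_upwards [hKt.eventually_gt_atTop 0, eventually_gt_atTop 0] with N hN hN0
      rw [div_pow]
      push_cast
      have : (0 : ℝ) < K N := by exact_mod_cast hN
      gcongr
      exact_mod_cast hK1 N
  have hlo : Tendsto (fun N : ℕ => ((K N ^ 4 : ℕ) : ℝ) / N) atTop (𝓝 1) := by
    have hinv : Tendsto (fun N : ℕ => ((((K N + 1 : ℕ) : ℝ) / (K N : ℝ)) ^ 4)⁻¹) atTop (𝓝 1) := by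
      simpa using hratio.inv₀ one_ne_zero
    refine tendsto_of_tendsto_of_tendsto_of_le_of_le' hinv tendsto_const_nhds ?_ ?_
    · filter_upwards [eventually_gt_atTop 0] with N hN0
      rw [← inv_pow, inv_div, div_pow]
      push_cast
      have : (0 : ℝ) < N := by exact_mod_cast hN0
      gcongr
      exact_mod_cast hK2 N
    · filter_upwards [eventually_gt_atTop 0] with N hN
      rw [div_le_one (by exact_mod_cast hN)]
      exact_mod_cast hK1 N
  rw [tendsto_order]
  constructor
  · intro c hc
    rcases lt_or_ge c 0 with hc0 | hc0
    · exact Eventually.of_forall fun k => hc0.trans_le (pairCorrelation_nonneg _ _ _ _)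
    set ε := (B - A - c) / 4 with hε
    have hεpos : 0 < ε := by linarith
    have hlim := hlo.mul ((h (A + ε) (B - ε) (by linarith)).comp hKt)
    have hAl : Tendsto (fun N : ℕ => A * (((K N ^ 4 : ℕ) : ℝ) / N)) atTop (𝓝 (A * 1)) :=
      hlo.const_mul A
    have hBl : Tendsto (fun N : ℕ => B * (((K N ^ 4 : ℕ) : ℝ) / N)) atTop (𝓝 (B * 1)) :=
      hlo.const_mul B
    filter_upwards [hlim.eventually_const_lt (u := c) (by linarith),
      hAl.eventually_lt_const (u := A + ε) (by linarith),
      hBl.eventually_const_lt (u := B - ε) (by linarith), eventually_gt_atTop 0,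
      hKt.eventually_gt_atTop 0] with N h1 h2 h3 hN hKN
    have hN' : (0 : ℝ) < N := by exact_mod_cast hN
    have hKN' : (0 : ℝ) < ((K N ^ 4 : ℕ) : ℝ) := by exact_mod_cast pow_pos hKN 4
    refine h1.trans_le ?_
    have := mul_pairCorrelation_le (α := α) (A := A + ε) (B := B - ε) (A' := A) (B' := B)
      (pow_pos hKN 4) (hK1 N) ?_ ?_
    · rw [div_mul_eq_mul_div, div_le_iff₀ hN', mul_comm (pairCorrelation _ _ _ _)]
      exact this
    · rw [le_div_iff₀ hKN', div_mul_eq_mul_div, ← mul_div_assoc']; exact h2.le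
    · rw [div_le_iff₀ hKN', div_mul_eq_mul_div, ← mul_div_assoc']; exact h3.le
  · intro c hc
    set ε := (c - (B - A)) / 4 with hε
    have hεpos : 0 < ε := by linarith
    have hlim := hup.mul ((h (A - ε) (B + ε) (by linarith)).comp
      ((tendsto_add_atTop_nat 1).comp hKt))
    have hAl := hup.const_mul A
    have hBl := hup.const_mul B
    filter_upwards [hlim.eventually_lt_const (u := c) (by linarith),
      hAl.eventually_const_lt (u := A - ε) (by linarith),
      hBl.eventually_lt_const (u := B + ε) (by linarith), eventually_gt_atTop 0] with N h1 h2 h3 hN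
    have hN' : (0 : ℝ) < N := by exact_mod_cast hN
    have hKN' : (0 : ℝ) < (((K N + 1) ^ 4 : ℕ) : ℝ) := by positivity
    refine lt_of_le_of_lt ?_ h1
    have := mul_pairCorrelation_le (α := α) (A := A) (B := B) (A' := A - ε) (B' := B + ε)
      hN (hK2 N) ?_ ?_
    · rw [div_mul_eq_mul_div, le_div_iff₀ hN', mul_comm (pairCorrelation _ _ _ _)]
      exact this
    · rw [div_le_iff₀ hKN', div_mul_eq_mul_div, ← mul_div_assoc']; exact h2.le
    · rw [le_div_iff₀ hKN', div_mul_eq_mul_div, ← mul_div_assoc']; exact h3.le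

/-! ### The divisor bound -/

theorem exists_pow_le_mul_two_pow (r : ℕ) : ∃ K : ℕ, 1 ≤ K ∧ ∀ v : ℕ, (v + 1) ^ r ≤ K * 2 ^ v := by
  have h := tendsto_pow_const_div_const_pow_of_one_lt r (one_lt_two (α := ℝ))
  obtain ⟨C, hC⟩ := h.bddAbove_range
  refine ⟨max 1 (2 * ⌈C⌉₊), le_max_left _ _, fun v => ?_⟩
  have h1 := hC ⟨v + 1, rfl⟩
  simp only at h1
  rw [div_le_iff₀ (by positivity)] at h1
  have h2 : ((v + 1 : ℕ) : ℝ) ^ r ≤ (2 * ⌈C⌉₊) * 2 ^ v := by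
    calc _ ≤ C * 2 ^ (v + 1) := h1
      _ ≤ ⌈C⌉₊ * 2 ^ (v + 1) := by gcongr; exact Nat.le_ceil C
      _ = _ := by ring
  have h3 : (v + 1) ^ r ≤ (2 * ⌈C⌉₊) * 2 ^ v := by exact_mod_cast h2
  exact h3.trans (Nat.mul_le_mul_right _ (le_max_right _ _))

/-- The number of divisors of `n` is `O(n^{1/r})` for every `r`. -/
theorem exists_card_divisors_pow_le (r : ℕ) :
    ∃ C : ℕ, ∀ n : ℕ, n ≠ 0 → n.divisors.card ^ r ≤ C * n := by
  obtain ⟨K, hK1, hK⟩ := exists_pow_le_mul_two_pow r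
  refine ⟨K ^ (2 ^ r), fun n hn => ?_⟩
  rw [Nat.card_divisors hn, ← Finset.prod_pow]
  calc ∏ p ∈ n.primeFactors, (n.factorization p + 1) ^ r
      ≤ ∏ p ∈ n.primeFactors, (if p < 2 ^ r then K else 1) * p ^ n.factorization p := by
        -- a prime `p ≥ 2 ^ r` contributes `(v + 1) ^ r ≤ 2 ^ (r v) ≤ p ^ v`; for the others, the
        -- constant `K` is needed
        refine Finset.prod_le_prod' fun p hp => ?_
        have hp2 := (Nat.prime_of_mem_primeFactors hp).two_le
        split_ifs with hlt
        · exact (hK _).trans (Nat.mul_le_mul_left _ (Nat.pow_le_pow_left hp2 _))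
        · push Not at hlt
          rw [one_mul]
          calc _ ≤ (2 ^ n.factorization p) ^ r :=
                Nat.pow_le_pow_left (Nat.lt_two_pow_self) r
            _ = (2 ^ r) ^ n.factorization p := by rw [← pow_mul, ← pow_mul, mul_comm]
            _ ≤ _ := Nat.pow_le_pow_left hlt _
    _ = (∏ p ∈ n.primeFactors, if p < 2 ^ r then K else 1) * n := by
        rw [Finset.prod_mul_distrib]
        congr 1
        exact Nat.prod_factorization_pow_eq_self hn
    _ ≤ K ^ (2 ^ r) * n := by
        refine Nat.mul_le_mul_right _ ?_
        rw [← Finset.prod_filter, Finset.prod_const]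
        refine Nat.pow_le_pow_right hK1 ?_
        refine (Finset.card_le_card (t := Finset.range (2 ^ r)) fun p hp => ?_).trans_eq (by simp)
        exact Finset.mem_range.mpr (Finset.mem_filter.mp hp).2

/-! ### Mean squares of trigonometric polynomials -/

theorem integral_e_intCast_mul (n l : ℤ) :
    ∫ α in Set.Ioc (n : ℝ) (n + 1), e (l * α) = if l = 0 then 1 else 0 := by
  rw [← intervalIntegral.integral_of_le (by linarith)]
  split_ifs with hl
  · simp [hl, e_zero]
  · have hc : (2 * Real.pi * Complex.I * l : ℂ) ≠ 0 := by
      have : (l : ℂ) ≠ 0 := by exact_mod_cast hl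
      simp [Real.pi_ne_zero, this]
    have h := integral_exp_mul_complex (a := (n : ℝ)) (b := n + 1) hc
    have h2 : ∀ α : ℝ, e (l * α) = Complex.exp (2 * Real.pi * Complex.I * l * α) := by
      intro α; rw [e]; congr 1; push_cast; ring
    simp only [h2]
    rw [h, ← h2, ← h2]
    have : e (l * (n + 1)) = e (l * n) := by
      rw [mul_add, e_add, mul_one, e_intCast, mul_one]
    rw [this, sub_self, zero_div]

/-- By orthogonality, the mean square of a trigonometric polynomial over a unit interval counts
the coincidences among its frequencies. -/
theorem integral_normSq_sum_e {ι : Type*} (T : Finset ι) (ν : ι → ℤ) (n : ℤ) :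
    ∫ α in Set.Ioc (n : ℝ) (n + 1), ‖∑ t ∈ T, e (ν t * α)‖ ^ 2 =
      ((T ×ˢ T).filter fun p => ν p.1 = ν p.2).card := by
  have h : ∀ α : ℝ, ((‖∑ t ∈ T, e (ν t * α)‖ ^ 2 : ℝ) : ℂ) =
      ∑ p ∈ T ×ˢ T, e ((ν p.1 - ν p.2 : ℤ) * α) := by
    intro α
    rw [Complex.ofReal_pow, ← Complex.mul_conj', map_sum, Finset.sum_mul_sum,
      Finset.sum_product]
    refine Finset.sum_congr rfl fun j _ => Finset.sum_congr rfl fun k _ => ?_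
    rw [star_e, ← e_add]
    congr 1; push_cast; ring
  apply Complex.ofReal_injective
  rw [← integral_complex_ofReal]
  simp only [h]
  rw [integral_finsetSum]
  · simp only [integral_e_intCast_mul, sub_eq_zero]
    rw [Finset.sum_boole]
    simp
  · intro p _
    exact (Continuous.integrableOn_Icc (by fun_prop)).mono_set Set.Ioc_subset_Icc_self

/-- The triples `(m, j, i)` with `m ≤ M` and `j ≠ i ≤ N`. -/
def offDiagonal (M N : ℕ) : Finset (ℕ × ℕ × ℕ) :=
  (Finset.Icc 1 M ×ˢ Finset.Icc 1 N ×ˢ Finset.Icc 1 N).filter fun t => t.2.1 ≠ t.2.2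

/-- The frequency `m (j² - i²)` of a triple `(m, j, i)`. -/
def tripleFreq (t : ℕ × ℕ × ℕ) : ℤ := t.1 * ((t.2.1 : ℤ) ^ 2 - (t.2.2 : ℤ) ^ 2)

theorem card_fiber_le (M N : ℕ) {l : ℤ} (hl : l ≠ 0) :
    ((offDiagonal M N).filter fun t => tripleFreq t = l).card ≤ l.natAbs.divisors.card ^ 2 := by
  rw [pow_two, ← Finset.card_product]
  -- `m` and `j + i` divide `l`, and they determine `j - i`
  refine Finset.card_le_card_of_injOn (fun t => (t.1, t.2.1 + t.2.2)) ?_ ?_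
  · rintro ⟨m, j, i⟩ ht
    rw [Finset.mem_coe, Finset.mem_filter] at ht
    simp only [tripleFreq] at ht
    have hl' : l.natAbs ≠ 0 := by simpa using hl
    simp only [Finset.coe_product, Set.mem_prod, Finset.mem_coe, Nat.mem_divisors]
    refine ⟨⟨?_, hl'⟩, ?_, hl'⟩
    · rw [← Int.natCast_dvd]; exact ⟨_, ht.2.symm⟩
    · rw [← Int.natCast_dvd]; exact ⟨m * (j - i), by rw [← ht.2]; push_cast; ring⟩
  · rintro ⟨m, j, i⟩ ht ⟨m', j', i'⟩ ht' heq
    rw [Finset.mem_coe, Finset.mem_filter, offDiagonal, Finset.mem_filter] at ht ht'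
    simp only [tripleFreq, Finset.mem_product, Finset.mem_Icc] at ht ht'
    simp only [Prod.mk.injEq] at heq
    obtain ⟨rfl, hs⟩ := heq
    have h1 : (m : ℤ) ≠ 0 := by have := ht.1.1.1.1; omega
    have h2 : ((j : ℤ) + i) ≠ 0 := by have := ht.1.1.2.1.1; omega
    have hs' : (j : ℤ) + i = j' + i' := by exact_mod_cast hs
    have h3 : (m : ℤ) * (((j : ℤ) + i) * (j - i)) = m * (((j : ℤ) + i) * (j' - i')) := by
      calc _ = (m : ℤ) * ((j : ℤ) ^ 2 - (i : ℤ) ^ 2) := by ring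
        _ = l := ht.2
        _ = (m : ℤ) * ((j' : ℤ) ^ 2 - (i' : ℤ) ^ 2) := ht'.2.symm
        _ = _ := by rw [hs']; ring
    have h4 := mul_left_cancel₀ h2 (mul_left_cancel₀ h1 h3)
    simp only [Prod.mk.injEq, true_and]
    omega

theorem tripleFreq_ne_zero {M N : ℕ} {t : ℕ × ℕ × ℕ} (ht : t ∈ offDiagonal M N) :
    tripleFreq t ≠ 0 := by
  obtain ⟨m, j, i⟩ := t
  simp only [offDiagonal, Finset.mem_filter, Finset.mem_product, Finset.mem_Icc] at ht
  simp only [tripleFreq]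
  refine mul_ne_zero (by have := ht.1.1.1; omega) ?_
  rw [show (j : ℤ) ^ 2 - (i : ℤ) ^ 2 = (j + i) * (j - i) by ring]
  refine mul_ne_zero (by have := ht.1.2.1.1; omega) ?_
  have := ht.2
  omega

theorem natAbs_tripleFreq_le {M N : ℕ} {t : ℕ × ℕ × ℕ} (ht : t ∈ offDiagonal M N) :
    (tripleFreq t).natAbs ≤ M * N ^ 2 := by
  obtain ⟨m, j, i⟩ := t
  simp only [offDiagonal, Finset.mem_filter, Finset.mem_product, Finset.mem_Icc] at ht
  simp only [tripleFreq]
  rw [Int.natAbs_mul, Int.natAbs_natCast]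
  refine Nat.mul_le_mul ht.1.1.2 ?_
  have h1 : j ^ 2 ≤ N ^ 2 := Nat.pow_le_pow_left ht.1.2.1.2 2
  have h2 : i ^ 2 ≤ N ^ 2 := Nat.pow_le_pow_left ht.1.2.2.2 2
  zify at h1 h2
  have h3 : (0 : ℤ) ≤ (j : ℤ) ^ 2 := by positivity
  have h4 : (0 : ℤ) ≤ (i : ℤ) ^ 2 := by positivity
  zify
  rw [abs_le]
  constructor <;> linarith

/-- For each `x` there is a constant `D` such that the number of solutions of
`m (j² - i²) = m' (j'² - i'²)` with `m, m' ≤ x N`, `N = k ^ 4`, is at most `D k² N³`. -/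
theorem exists_card_solutions_le (x : ℕ) : ∃ D : ℕ, ∀ k M : ℕ, M ≤ x * k ^ 4 →
    ((offDiagonal M (k ^ 4) ×ˢ offDiagonal M (k ^ 4)).filter
      fun p => tripleFreq p.1 = tripleFreq p.2).card ≤ D * k ^ 14 := by
  -- the frequencies are at most `x k ^ 12`, so that they have `O(k)` divisors
  obtain ⟨C, hC⟩ := exists_card_divisors_pow_le 12
  refine ⟨(x * (C * x) ^ 2), fun k M hM => ?_⟩
  rw [Finset.card_filter, Finset.sum_product]
  simp only [← Finset.card_filter]
  have hd : ∀ t ∈ offDiagonal M (k ^ 4),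
      ((offDiagonal M (k ^ 4)).filter fun s => tripleFreq t = tripleFreq s).card ≤
        (C * x * k) ^ 2 := by
    intro t ht
    have h0 := tripleFreq_ne_zero ht
    have h1 := card_fiber_le M (k ^ 4) h0
    simp only [eq_comm (b := tripleFreq t)] at h1
    refine h1.trans (Nat.pow_le_pow_left ?_ 2)
    have h0' : (tripleFreq t).natAbs ≠ 0 := by simpa using h0
    rw [← Nat.pow_le_pow_iff_left (n := 12) (by norm_num)]
    have hM' : (tripleFreq t).natAbs ≤ x * k ^ 12 := by
      refine (natAbs_tripleFreq_le ht).trans ((Nat.mul_le_mul_right _ hM).trans_eq ?_)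
      ring
    have hCx : C * x ≠ 0 := by
      intro h
      have : 0 < (tripleFreq t).natAbs.divisors.card := by
        rw [Finset.card_pos]; exact ⟨1, by simp [h0]⟩
      have h2 := (hC _ h0').trans (Nat.mul_le_mul_left C hM')
      rw [← mul_assoc, h, zero_mul] at h2
      have := pow_pos this 12
      omega
    calc _ ≤ C * (tripleFreq t).natAbs := hC _ h0'
      _ ≤ C * (x * k ^ 12) := Nat.mul_le_mul_left _ hM'
      _ = (C * x) * k ^ 12 := by ring
      _ ≤ (C * x) ^ 12 * k ^ 12 := Nat.mul_le_mul_right _ (Nat.le_self_pow (by norm_num) _)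
      _ = _ := by ring
  refine (Finset.sum_le_card_nsmul _ _ _ hd).trans ?_
  have hcard : (offDiagonal M (k ^ 4)).card ≤ x * k ^ 12 := by
    refine (Finset.card_filter_le _ _).trans ?_
    rw [Finset.card_product, Finset.card_product, Nat.card_Icc, Nat.card_Icc]
    calc _ ≤ (x * k ^ 4) * ((k ^ 4) * (k ^ 4)) := by
          simp only [Nat.add_sub_cancel]
          exact Nat.mul_le_mul_right _ hM
      _ = _ := by ring
  rw [smul_eq_mul]
  refine (Nat.mul_le_mul_right _ hcard).trans_eq ?_
  ring

/-! ### Almost every `α` -/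

/-- The off-diagonal part of `∑_{m ≤ M} |∑_{j ≤ N} e(m j² α)|²`. -/
noncomputable def offDiagonalSum (M N : ℕ) (α : ℝ) : ℂ :=
  ∑ t ∈ offDiagonal M N, e (tripleFreq t * α)

/-- The mean square over a unit interval is `O(k ^ 14 / k ^ 16)`, which is summable in `k`; hence
the sums tend to zero almost everywhere. -/
theorem ae_tendsto_offDiagonalSum (q : ℝ) :
    ∀ᵐ α : ℝ, Tendsto (fun k : ℕ => offDiagonalSum ⌊((k ^ 4 : ℕ) : ℝ) * q⌋₊ (k ^ 4) α /
      ((k ^ 4 : ℕ) : ℂ) ^ 2) atTop (𝓝 0) := by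
  have hcover : (⋃ n : ℤ, Set.Ioc (n : ℝ) (n + 1)) = Set.univ := iUnion_Ioc_intCast ℝ
  rw [← Measure.restrict_univ (μ := (volume : Measure ℝ)), ← hcover, ae_restrict_iUnion_iff]
  intro n
  obtain ⟨D, hD⟩ := exists_card_solutions_le ⌈q⌉₊
  set f : ℕ → ℝ → ℝ := fun k α => ‖offDiagonalSum ⌊((k ^ 4 : ℕ) : ℝ) * q⌋₊ (k ^ 4) α /
      ((k ^ 4 : ℕ) : ℂ) ^ 2‖ ^ 2 with hf
  have hcont : ∀ k, Continuous (f k) := by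
    intro k; simp only [hf, offDiagonalSum]; fun_prop
  have hint : ∀ k, ∫ α in Set.Ioc (n : ℝ) (n + 1), f k α ≤ D * ((k : ℝ) ^ 2)⁻¹ := by
    intro k
    simp only [hf, norm_div, div_pow, offDiagonalSum]
    rw [integral_div, integral_normSq_sum_e]
    have h1 := hD k ⌊((k ^ 4 : ℕ) : ℝ) * q⌋₊ (Nat.floor_le_of_le (by
      push_cast; rw [mul_comm]; gcongr; exact Nat.le_ceil q))
    rcases Nat.eq_zero_or_pos k with rfl | hk
    · simp
    have hk' : (0 : ℝ) < k := by exact_mod_cast hk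
    rw [norm_pow, Complex.norm_natCast, div_le_iff₀ (by positivity)]
    calc _ ≤ ((D * k ^ 14 : ℕ) : ℝ) := by exact_mod_cast h1
      _ = _ := by push_cast; field_simp
  have hfin : ∫⁻ α in Set.Ioc (n : ℝ) (n + 1), ∑' k, ENNReal.ofReal (f k α) ≠ ⊤ := by
    rw [lintegral_tsum fun k => ((hcont k).measurable.ennreal_ofReal).aemeasurable]
    refine ne_top_of_le_ne_top (b := ∑' k : ℕ, ENNReal.ofReal (D * ((k : ℝ) ^ 2)⁻¹)) ?_
      (ENNReal.tsum_le_tsum fun k => ?_)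
    · rw [← ENNReal.ofReal_tsum_of_nonneg (fun k => by positivity)
        ((Real.summable_nat_pow_inv.mpr one_lt_two).mul_left _)]
      exact ENNReal.ofReal_ne_top
    · rw [← ofReal_integral_eq_lintegral_ofReal
        ((hcont k).integrableOn_Icc.mono_set Set.Ioc_subset_Icc_self)
        (Eventually.of_forall fun α => by positivity)]
      exact ENNReal.ofReal_le_ofReal (hint k)
  have hae := ae_lt_top (Measurable.tsum fun k =>
    ((hcont k).measurable.ennreal_ofReal)) hfin
  filter_upwards [hae] with α hα
  have h0 := ENNReal.tendsto_atTop_zero_of_tsum_ne_top hα.ne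
  have h1 : Tendsto (fun k => f k α) atTop (𝓝 0) := by
    have := (ENNReal.tendsto_toReal ENNReal.zero_ne_top).comp h0
    refine this.congr fun k => ?_
    exact ENNReal.toReal_ofReal (by positivity)
  rw [tendsto_zero_iff_norm_tendsto_zero]
  have h2 := (Real.continuous_sqrt.tendsto _).comp h1
  rw [Real.sqrt_zero] at h2
  exact h2.congr fun k => Real.sqrt_sq (norm_nonneg _)

/-- The indicator function of `[1, N]`. -/
def indicatorWeight (N j : ℕ) : ℝ := if j ∈ Finset.Icc 1 N then 1 else 0

theorem sum_indicatorWeight_mul (N : ℕ) (f : ℕ → ℂ) :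
    ∑ j ∈ Finset.range (N + 1), (indicatorWeight N j : ℂ) * f j = ∑ j ∈ Finset.Icc 1 N, f j := by
  simp only [indicatorWeight, apply_ite Complex.ofReal, Complex.ofReal_one, Complex.ofReal_zero,
    ite_mul, one_mul, zero_mul]
  rw [← Finset.sum_filter]
  refine Finset.sum_congr ?_ fun _ _ => rfl
  ext j
  simp only [Finset.mem_filter, Finset.mem_range, Finset.mem_Icc]
  omega

theorem sum_indicatorWeight (N : ℕ) : ∑ j ∈ Finset.range (N + 1), indicatorWeight N j = N := by
  have := sum_indicatorWeight_mul N fun _ => 1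
  simp only [mul_one, Finset.sum_const, Nat.card_Icc, Nat.add_sub_cancel, nsmul_eq_mul] at this
  exact_mod_cast this

theorem sum_normSq_indicatorWeight (α : ℝ) (M N : ℕ) :
    ((∑ m ∈ Finset.Icc 1 M, ‖trigSum (Finset.range (N + 1)) (indicatorWeight N) (sqFreq α)
      (m : ℕ)‖ ^ 2 : ℝ) : ℂ) = M * N + offDiagonalSum M N α := by
  rw [Complex.ofReal_sum]
  simp only [normSq_trigSum, mul_assoc, ← Finset.mul_sum, sum_indicatorWeight_mul]
  have hsplit : ∀ m : ℕ, ∑ j ∈ Finset.Icc 1 N, ∑ i ∈ Finset.Icc 1 N,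
      e (((m : ℤ) : ℝ) * (sqFreq α j - sqFreq α i)) = N + ∑ p ∈ Finset.Icc 1 N ×ˢ Finset.Icc 1 N,
        if p.1 ≠ p.2 then e (tripleFreq (m, p) * α) else 0 := by
    intro m
    have : (N : ℂ) = ∑ j ∈ Finset.Icc 1 N, ∑ i ∈ Finset.Icc 1 N, if j = i then 1 else 0 := by
      rw [Finset.sum_congr rfl fun j hj => by rw [Finset.sum_ite_eq, if_pos hj]]
      simp
    rw [Finset.sum_product, this, ← Finset.sum_add_distrib]
    refine Finset.sum_congr rfl fun j _ => ?_
    rw [← Finset.sum_add_distrib]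
    refine Finset.sum_congr rfl fun i _ => ?_
    by_cases hji : j = i
    · simp [hji, e_zero]
    · simp only [hji, ne_eq, not_false_eq_true, if_true, if_false, zero_add, tripleFreq, sqFreq]
      congr 1; push_cast; ring
  simp only [hsplit]
  rw [Finset.sum_add_distrib, offDiagonalSum, offDiagonal, Finset.sum_filter, Finset.sum_product]
  simp

theorem meanSquareLaw_indicatorWeight {α : ℝ}
    (h : ∀ q : ℚ, 0 < q → Tendsto (fun k : ℕ => offDiagonalSum ⌊((k ^ 4 : ℕ) : ℝ) * q⌋₊ (k ^ 4) α /
      ((k ^ 4 : ℕ) : ℂ) ^ 2) atTop (𝓝 0)) :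
    MeanSquareLaw α (fun k => k ^ 4) (fun k => indicatorWeight (k ^ 4)) (fun k => k ^ 4 + 1)
      1 1 := by
  have hpos : ∀ᶠ k : ℕ in atTop, (0 : ℝ) < ((k ^ 4 : ℕ) : ℝ) := by
    filter_upwards [eventually_gt_atTop 0] with k hk
    exact_mod_cast pow_pos hk 4
  have hnn : ∀ N j, 0 ≤ indicatorWeight N j := fun N j => by
    unfold indicatorWeight; split_ifs <;> norm_num
  have hsq : ∀ N j, indicatorWeight N j ^ 2 = indicatorWeight N j := fun N j => by
    unfold indicatorWeight; split_ifs <;> norm_num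
  have h1 : Tendsto (fun k : ℕ => (1 / ((k ^ 4 : ℕ) : ℝ)) *
      ∑ j ∈ Finset.range (k ^ 4 + 1), indicatorWeight (k ^ 4) j) atTop (𝓝 1) := by
    refine tendsto_const_nhds.congr' ?_
    filter_upwards [hpos] with k hk
    rw [sum_indicatorWeight, one_div_mul_cancel hk.ne']
  refine ⟨fun k j => hnn _ _, h1, by simpa only [hsq] using h1, ?_⟩
  -- the cumulative masses are monotone in `x`, so that rational `x` suffice
  set F : ℕ → ℝ → ℝ := fun k x => ∑ m ∈ Finset.Icc 1 ⌊((k ^ 4 : ℕ) : ℝ) * x⌋₊,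
    weylMass α (fun k => k ^ 4) (fun k => indicatorWeight (k ^ 4)) (fun k => k ^ 4 + 1) k (m : ℕ)
    with hF
  have hu : Tendsto (fun k : ℕ => ((k ^ 4 : ℕ) : ℝ)) atTop atTop :=
    tendsto_natCast_atTop_atTop.comp (tendsto_pow_atTop (by norm_num))
  have hrat : ∀ q : ℚ, 0 < q → Tendsto (fun k => F k q) atTop (𝓝 q) := by
    intro q hq
    have hq' : (0 : ℝ) < q := by exact_mod_cast hq
    have hfl : Tendsto (fun k : ℕ => (⌊((k ^ 4 : ℕ) : ℝ) * q⌋₊ : ℝ) / ((k ^ 4 : ℕ) : ℝ)) atTop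
        (𝓝 q) := by
      have := (tendsto_nat_floor_mul_div_atTop hq'.le).comp hu
      simpa only [Function.comp_def, mul_comm] using this
    have hsum := hfl.add ((Complex.continuous_re.tendsto _).comp (h q hq))
    rw [Complex.zero_re, add_zero] at hsum
    refine hsum.congr' ?_
    filter_upwards [hpos] with k hk
    apply Complex.ofReal_injective
    simp only [hF, weylMass, ← Finset.sum_div, Function.comp]
    have hreal := congrArg Complex.re
      (sum_normSq_indicatorWeight α ⌊((k ^ 4 : ℕ) : ℝ) * q⌋₊ (k ^ 4))
    rw [Complex.ofReal_re, Complex.add_re] at hreal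
    rw [hreal]
    congr 1
    have : ((k ^ 4 : ℕ) : ℂ) ^ 2 = (((((k ^ 4 : ℕ) : ℝ)) ^ 2 : ℝ) : ℂ) := by push_cast; rfl
    rw [this, Complex.div_ofReal_re]
    have h2 : ((⌊((k ^ 4 : ℕ) : ℝ) * q⌋₊ : ℂ) * ((k ^ 4 : ℕ) : ℂ)).re =
        (⌊((k ^ 4 : ℕ) : ℝ) * q⌋₊ : ℝ) * ((k ^ 4 : ℕ) : ℝ) := by
      rw [← Complex.ofReal_natCast, ← Complex.ofReal_natCast, ← Complex.ofReal_mul,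
        Complex.ofReal_re]
    rw [h2, add_div]
    congr 1
    field_simp
  have hmono : ∀ k, Monotone (F k) := by
    intro k x y hxy
    refine Finset.sum_le_sum_of_subset_of_nonneg (Finset.Icc_subset_Icc_right
      (Nat.floor_le_floor ?_)) fun _ _ _ => weylMass_nonneg _ _
    gcongr
  intro x hx
  change Tendsto (fun k => F k x) atTop (𝓝 (1 * x))
  rw [one_mul, tendsto_order]
  constructor
  · intro c hc
    obtain ⟨q, hq1, hq2⟩ := exists_rat_btwn (max_lt hc hx)
    have hq0 : (0 : ℚ) < q := by exact_mod_cast (le_max_right c 0).trans_lt hq1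
    filter_upwards [(hrat q hq0).eventually_const_lt ((le_max_left c 0).trans_lt hq1)] with k hk
    exact hk.trans_le (hmono k hq2.le)
  · intro c hc
    obtain ⟨q, hq1, hq2⟩ := exists_rat_btwn hc
    have hq0 : (0 : ℚ) < q := by exact_mod_cast hx.trans hq1
    filter_upwards [(hrat q hq0).eventually_lt_const hq2] with k hk
    exact (hmono k hq1.le).trans_lt hk

/-- The theorem of Rudnick and Sarnak. -/
theorem ae_tendsto_pairCorrelation : ∀ᵐ α : ℝ, ∀ a b : ℝ, a ≤ b →
    Tendsto (fun N : ℕ => pairCorrelation a b α N) atTop (𝓝 (b - a)) := by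
  have h : ∀ᵐ α : ℝ, ∀ q : ℚ, Tendsto (fun k : ℕ =>
      offDiagonalSum ⌊((k ^ 4 : ℕ) : ℝ) * q⌋₊ (k ^ 4) α / ((k ^ 4 : ℕ) : ℂ) ^ 2) atTop (𝓝 0) :=
    ae_all_iff.mpr fun q => ae_tendsto_offDiagonalSum q
  filter_upwards [h] with α hα
  have hlaw := meanSquareLaw_indicatorWeight fun q _ => hα q
  refine tendsto_pairCorrelation_of_pow_four fun A B hAB => ?_
  refine tendsto_pairCorrelation_of_weights (u := fun k => k ^ 4)
    (tendsto_pow_atTop (by norm_num)) (fun δ hδ => ?_) (fun δ hδ => ?_) A B hAB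
  · refine ⟨_, _, 1, 1, hlaw, fun k j hj => ⟨by simp [indicatorWeight, Finset.mem_Icc.mp hj], ?_⟩,
      by linarith⟩
    have := (Finset.mem_Icc.mp hj).2
    omega
  · exact ⟨_, _, 1, 1, hlaw, fun k j => le_rfl, by linarith⟩

section

open Matrix EisensteinSeries

/-! ### The lattice of a point of the upper half-plane -/

/-- The point `(c z + d) / √y` of the unimodular lattice attached to `z = x + iy`, for
`v = (c, d)`. -/
noncomputable def latticePt (v : Fin 2 → ℤ) (z : ℍ) : ℂ :=
  ((v 0 : ℂ) * z + v 1) / (Real.sqrt z.im : ℂ)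

/-- The squared length `|c z + d|² / y`. -/
noncomputable def latticeSq (v : Fin 2 → ℤ) (z : ℍ) : ℝ := ‖latticePt v z‖ ^ 2

theorem latticePt_zero (z : ℍ) : latticePt 0 z = 0 := by simp [latticePt]

theorem latticeSq_eq (v : Fin 2 → ℤ) (z : ℍ) :
    latticeSq v z = v 0 ^ 2 * z.im + (v 0 * z.re + v 1) ^ 2 / z.im := by
  have hy := z.im_pos
  rw [latticeSq, latticePt, norm_div, div_pow, Complex.norm_real, Real.norm_eq_abs, sq_abs,
    Real.sq_sqrt hy.le, ← Complex.normSq_eq_norm_sq, Complex.normSq_apply]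
  simp only [Complex.add_re, Complex.mul_re, Complex.intCast_re, UpperHalfPlane.coe_re,
    Complex.intCast_im, UpperHalfPlane.coe_im, Complex.add_im, Complex.mul_im, zero_mul, sub_zero,
    add_zero]
  field_simp
  ring

theorem latticePt_smul (v : Fin 2 → ℤ) (n : ℤ) (z : ℍ) :
    latticePt (n • v) z = n * latticePt v z := by
  simp only [latticePt, Pi.smul_apply, smul_eq_mul, Int.cast_mul]; ring

theorem latticeSq_smul (v : Fin 2 → ℤ) (n : ℤ) (z : ℍ) :
    latticeSq (n • v) z = (n : ℝ) ^ 2 * latticeSq v z := by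
  rw [latticeSq, latticePt_smul, norm_mul, mul_pow, latticeSq, Complex.norm_intCast, sq_abs]

/-- The factor `c z + d`. -/
noncomputable def autFactor (γ : SL(2, ℤ)) (z : ℍ) : ℂ := (γ 1 0 : ℂ) * z + γ 1 1

theorem autFactor_ne_zero (γ : SL(2, ℤ)) (z : ℍ) : autFactor γ z ≠ 0 :=
  UpperHalfPlane.denom_ne_zero (γ : GL (Fin 2) ℝ) z

theorem im_smul_eq (γ : SL(2, ℤ)) (z : ℍ) : (γ • z).im = z.im / ‖autFactor γ z‖ ^ 2 := by
  rw [ModularGroup.im_smul_eq_div_normSq, Complex.normSq_eq_norm_sq]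
  rfl

theorem vecMul_zero (v : Fin 2 → ℤ) (γ : SL(2, ℤ)) :
    (v ᵥ* γ.1) 0 = v 0 * γ 0 0 + v 1 * γ 1 0 := by
  simp [Matrix.vecMul, dotProduct, Fin.sum_univ_two]

theorem vecMul_one' (v : Fin 2 → ℤ) (γ : SL(2, ℤ)) :
    (v ᵥ* γ.1) 1 = v 0 * γ 0 1 + v 1 * γ 1 1 := by
  simp [Matrix.vecMul, dotProduct, Fin.sum_univ_two]

/-- The lattice of `γ z` is that of `z`, rotated by the argument of `c z + d` and with its vectors
permuted. -/
theorem latticePt_modular (v : Fin 2 → ℤ) (γ : SL(2, ℤ)) (z : ℍ) :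
    latticePt v (γ • z) = latticePt (v ᵥ* γ.1) z * (‖autFactor γ z‖ / autFactor γ z) := by
  have h0 := autFactor_ne_zero γ z
  have hn : (‖autFactor γ z‖ : ℂ) ≠ 0 := by simpa using h0
  have hy : (Real.sqrt z.im : ℂ) ≠ 0 := by
    simpa using (Real.sqrt_pos.mpr z.im_pos).ne'
  rw [latticePt, latticePt, im_smul_eq, Real.sqrt_div' _ (sq_nonneg _),
    Real.sqrt_sq (norm_nonneg _), UpperHalfPlane.coe_specialLinearGroup_apply, vecMul_zero,
    vecMul_one']
  simp only [algebraMap_int_eq, eq_intCast]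
  push_cast
  have h1 : ((γ 1 0 : ℂ) * z + γ 1 1) = autFactor γ z := rfl
  have h2 : (v 0 * ((γ 0 0 * z + γ 0 1) / autFactor γ z) + v 1 : ℂ) =
      ((v 0 * γ 0 0 + v 1 * γ 1 0) * z + (v 0 * γ 0 1 + v 1 * γ 1 1)) / autFactor γ z := by
    rw [eq_div_iff h0, add_mul, mul_assoc, div_mul_cancel₀ _ h0, ← h1]
    ring
  rw [h1, h2]
  generalize autFactor γ z = D at h0 hn
  field_simp

theorem latticeSq_modular (v : Fin 2 → ℤ) (γ : SL(2, ℤ)) (z : ℍ) :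
    latticeSq v (γ • z) = latticeSq (v ᵥ* γ.1) z := by
  have h0 : ‖autFactor γ z‖ ≠ 0 := by simpa using autFactor_ne_zero γ z
  rw [latticeSq, latticePt_modular, norm_mul, norm_div, Complex.norm_real, norm_norm, div_self h0,
    mul_one, latticeSq]

/-- Right multiplication by `γ` on `ℤ²`. -/
def vecMulEquiv (γ : SL(2, ℤ)) : (Fin 2 → ℤ) ≃ (Fin 2 → ℤ) where
  toFun v := v ᵥ* γ.1
  invFun v := v ᵥ* (γ⁻¹).1
  left_inv v := by
    have h : γ.1 * (γ⁻¹).1 = 1 := congrArg Subtype.val (mul_inv_cancel γ)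
    change (v ᵥ* γ.1) ᵥ* (γ⁻¹).1 = v
    exact (vecMul_vecMul _ _ _).trans ((congrArg _ h).trans (vecMul_one _))
  right_inv v := by
    have h : (γ⁻¹).1 * γ.1 = 1 := congrArg Subtype.val (inv_mul_cancel γ)
    change (v ᵥ* (γ⁻¹).1) ᵥ* γ.1 = v
    exact (vecMul_vecMul _ _ _).trans ((congrArg _ h).trans (vecMul_one _))

/-! ### The sign character -/

/-- The sign of `(c, d)`: zero for odd `c`, and `(-1)^{cd/2}` for even `c`. -/
def thetaSign (v : Fin 2 → ℤ) : ℤ :=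
  if 2 ∣ v 0 then (if 4 ∣ v 0 ∨ 2 ∣ v 1 then 1 else -1) else 0

theorem abs_thetaSign_le (v : Fin 2 → ℤ) : |(thetaSign v : ℝ)| ≤ 1 := by
  unfold thetaSign; split_ifs <;> simp

theorem thetaSign_zero : thetaSign 0 = 1 := by simp [thetaSign]

/-- The sign depends on `c` modulo `4` and, for even `c`, on `d` modulo `2`; both are preserved by
`Γ₁(4)`. -/
theorem thetaSign_vecMul (v : Fin 2 → ℤ) {γ : SL(2, ℤ)} (hγ : γ ∈ CongruenceSubgroup.Gamma1 4) :
    thetaSign (v ᵥ* γ.1) = thetaSign v := by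
  rw [CongruenceSubgroup.Gamma1_mem] at hγ
  obtain ⟨h1, h2, h3⟩ := hγ
  have h1' : (4 : ℤ) ∣ γ 0 0 - 1 := by
    refine (ZMod.intCast_zmod_eq_zero_iff_dvd _ 4).mp ?_
    push_cast; rw [h1, sub_self]
  have h2' : (4 : ℤ) ∣ γ 1 1 - 1 := by
    refine (ZMod.intCast_zmod_eq_zero_iff_dvd _ 4).mp ?_
    push_cast; rw [h2, sub_self]
  have h3' : (4 : ℤ) ∣ γ 1 0 := (ZMod.intCast_zmod_eq_zero_iff_dvd _ 4).mp h3
  obtain ⟨a, ha⟩ := h1'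
  obtain ⟨d, hd⟩ := h2'
  obtain ⟨c, hc⟩ := h3'
  have e0 : (v ᵥ* γ.1) 0 = v 0 + 4 * (a * v 0 + c * v 1) := by
    rw [vecMul_zero, hc, show γ 0 0 = 4 * a + 1 by omega]; ring
  have e1 : (v ᵥ* γ.1) 1 = v 1 + v 0 * γ 0 1 + 4 * (d * v 1) := by
    rw [vecMul_one', show γ 1 1 = 4 * d + 1 by omega]; ring
  unfold thetaSign
  rw [e0, e1]
  have c1 : (2 ∣ v 0 + 4 * (a * v 0 + c * v 1)) ↔ 2 ∣ v 0 := by omega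
  have c2 : (4 ∣ v 0 + 4 * (a * v 0 + c * v 1)) ↔ 4 ∣ v 0 := by omega
  simp only [c1, c2]
  by_cases hv : 2 ∣ v 0
  · have c3 : (2 ∣ v 1 + v 0 * γ 0 1 + 4 * (d * v 1)) ↔ 2 ∣ v 1 := by
      obtain ⟨k, hk⟩ := hv
      rw [hk, mul_assoc]; omega
    simp only [c3]
  · simp only [hv, if_false]

/-! ### Lattice sums -/

/-- Continuous even functions on the plane that decay like `|w|⁻⁴`. -/
structure Admissible (Φ : ℂ → ℝ) : Prop where
  continuous : Continuous Φ
  even : ∀ w, Φ (-w) = Φ w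
  decay : ∃ C : ℝ, 0 ≤ C ∧ ∀ w, |Φ w| ≤ C * (1 / (1 + ‖w‖ ^ 2) ^ 2)

/-- The signed lattice sum `∑ χ(v) Φ(e^{-it/2} (c z + d) / √y)`. -/
noncomputable def latticeSum (Φ : ℂ → ℝ) (z : ℍ) (t : ℝ) : ℝ :=
  ∑' v : Fin 2 → ℤ, thetaSign v * Φ (Complex.exp (-(t / 2) * Complex.I) * latticePt v z)

theorem norm_exp_half (t : ℝ) : ‖Complex.exp (-(t / 2) * Complex.I)‖ = 1 := by
  rw [show (-(t / 2) * Complex.I : ℂ) = ((-(t / 2) : ℝ) : ℂ) * Complex.I by push_cast; ring]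
  exact Complex.norm_exp_ofReal_mul_I _

theorem abs_term_le {Φ : ℂ → ℝ} {C : ℝ} (hC : ∀ w, |Φ w| ≤ C * (1 / (1 + ‖w‖ ^ 2) ^ 2))
    (v : Fin 2 → ℤ) (z : ℍ) (t : ℝ) :
    ‖thetaSign v * Φ (Complex.exp (-(t / 2) * Complex.I) * latticePt v z)‖ ≤
      C * (1 / (1 + latticeSq v z) ^ 2) := by
  rw [norm_mul, Real.norm_eq_abs, Real.norm_eq_abs]
  have := hC (Complex.exp (-(t / 2) * Complex.I) * latticePt v z)
  rw [norm_mul, norm_exp_half, one_mul] at this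
  calc _ ≤ 1 * |Φ (Complex.exp (-(t / 2) * Complex.I) * latticePt v z)| := by
        gcongr; exact abs_thetaSign_le v
    _ ≤ _ := by rw [one_mul]; exact this

/-- A summable majorant of the lattice sums on a vertical strip. -/
noncomputable def latticeMajorant (K : ℝ) (v : Fin 2 → ℤ) : ℝ :=
  K * ‖v‖ ^ (-4 : ℝ) + if v = 0 then 1 else 0

theorem summable_latticeMajorant (K : ℝ) : Summable (latticeMajorant K) :=
  ((summable_one_div_norm_rpow (by norm_num : (2 : ℝ) < 4)).mul_left K).add
    (summable_of_hasFiniteSupport ((Set.finite_singleton 0).subset fun v hv => by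
      by_contra h; simp_all))

theorem one_div_le_majorant {A B B' : ℝ} (hB : 0 < B) {z : ℍ}
    (hz : z ∈ UpperHalfPlane.verticalStrip A B)
    (hz' : z.im ≤ B') (v : Fin 2 → ℤ) :
    1 / (1 + latticeSq v z) ^ 2 ≤
      latticeMajorant (B' ^ 2 * (r ⟨⟨A, B⟩, hB⟩) ^ (-4 : ℝ)) v := by
  by_cases hv : v = 0
  · subst hv
    simp only [latticeMajorant, if_true, norm_zero]
    rw [latticeSq, latticePt_zero, Real.zero_rpow (by norm_num)]
    simp
  · have hy := z.im_pos
    have h1 := summand_bound_of_mem_verticalStrip (k := 4) (by norm_num) v hB hz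
    simp only [latticeMajorant, if_neg hv, add_zero]
    have hpos : 0 < ‖(v 0 : ℂ) * z + v 1‖ :=
      (mul_pos (r_pos z) (norm_pos_iff.mpr hv)).trans_le (r_mul_max_le z hv)
    rw [Real.rpow_neg hpos.le] at h1
    have hsq : latticeSq v z = ‖(v 0 : ℂ) * z + v 1‖ ^ 2 / z.im := by
      rw [latticeSq, latticePt, norm_div, div_pow, Complex.norm_real, Real.norm_eq_abs, sq_abs,
        Real.sq_sqrt hy.le]
    set q := ‖(v 0 : ℂ) * z + v 1‖
    calc 1 / (1 + latticeSq v z) ^ 2 ≤ 1 / (latticeSq v z) ^ 2 := by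
          rw [hsq]
          gcongr
          linarith
      _ = z.im ^ 2 * (q ^ (4 : ℝ))⁻¹ := by
          rw [hsq, show (4 : ℝ) = ((4 : ℕ) : ℝ) by norm_num, Real.rpow_natCast]
          field_simp
      _ ≤ B' ^ 2 * (r ⟨⟨A, B⟩, hB⟩ ^ (-4 : ℝ) * ‖v‖ ^ (-4 : ℝ)) := by gcongr
      _ = _ := by ring

theorem summable_one_div_latticeSq (z : ℍ) :
    Summable fun v : Fin 2 → ℤ => 1 / (1 + latticeSq v z) ^ 2 :=
  Summable.of_nonneg_of_le (fun v => by positivity)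
    (one_div_le_majorant (A := |z.re|) z.im_pos ⟨le_rfl, le_rfl⟩ le_rfl)
    (summable_latticeMajorant _)

theorem Admissible.summable {Φ : ℂ → ℝ} (hΦ : Admissible Φ) (z : ℍ) (t : ℝ) :
    Summable fun v : Fin 2 → ℤ =>
      thetaSign v * Φ (Complex.exp (-(t / 2) * Complex.I) * latticePt v z) := by
  obtain ⟨C, hC0, hC⟩ := hΦ.decay
  exact Summable.of_norm_bounded ((summable_one_div_latticeSq z).mul_left C)
    fun v => abs_term_le hC v z t

theorem continuous_latticePt (v : Fin 2 → ℤ) : Continuous (latticePt v) := by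
  unfold latticePt
  refine Continuous.div (by fun_prop) (by fun_prop) fun z => ?_
  simpa using (Real.sqrt_pos.mpr z.im_pos).ne'

/-- The series converges uniformly on a neighbourhood of each point. -/
theorem Admissible.continuous_latticeSum {Φ : ℂ → ℝ} (hΦ : Admissible Φ) :
    Continuous fun p : ℍ × ℝ => latticeSum Φ p.1 p.2 := by
  obtain ⟨C, hC0, hC⟩ := hΦ.decay
  rw [continuous_iff_continuousAt]
  rintro ⟨z, t⟩
  set U : Set ℍ := {w | |w.re| < |z.re| + 1 ∧ z.im / 2 < w.im ∧ w.im < z.im + 1} with hU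
  have hUo : IsOpen U := by
    have h1 : IsOpen {w : ℍ | |w.re| < |z.re| + 1} :=
      isOpen_lt UpperHalfPlane.continuous_re.abs continuous_const
    have h2 : IsOpen {w : ℍ | z.im / 2 < w.im} :=
      isOpen_lt continuous_const UpperHalfPlane.continuous_im
    have h3 : IsOpen {w : ℍ | w.im < z.im + 1} :=
      isOpen_lt UpperHalfPlane.continuous_im continuous_const
    exact h1.inter (h2.inter h3)
  have hy := z.im_pos
  have hzU : z ∈ U := ⟨by linarith, by linarith, by linarith⟩
  obtain ⟨K, hK⟩ : ∃ K, ∀ w ∈ U, ∀ v, 1 / (1 + latticeSq v w) ^ 2 ≤ latticeMajorant K v :=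
    ⟨_, fun w hw v => one_div_le_majorant (half_pos hy) ⟨hw.1.le, hw.2.1.le⟩ hw.2.2.le v⟩
  have hcont : ContinuousOn (fun p : ℍ × ℝ => ∑' v : Fin 2 → ℤ, (thetaSign v : ℝ) *
      Φ (Complex.exp (-(p.2 / 2) * Complex.I) * latticePt v p.1)) (U ×ˢ Set.univ) := by
    refine continuousOn_tsum (fun v => Continuous.continuousOn ?_)
      ((summable_latticeMajorant K).mul_left C) ?_
    · have h1 := continuous_latticePt v
      have h2 : Continuous fun p : ℍ × ℝ => Complex.exp (-(p.2 / 2) * Complex.I) := by fun_prop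
      exact continuous_const.mul (hΦ.continuous.comp (h2.mul (h1.comp continuous_fst)))
    · rintro v ⟨w, s⟩ ⟨hw, -⟩
      exact (abs_term_le hC v w s).trans (mul_le_mul_of_nonneg_left (hK w hw v) hC0)
  exact hcont.continuousAt ((hUo.prod isOpen_univ).mem_nhds ⟨hzU, trivial⟩)

theorem Admissible.latticeSum_periodic {Φ : ℂ → ℝ} (hΦ : Admissible Φ) (z : ℍ) :
    Function.Periodic (latticeSum Φ z) (2 * Real.pi) := by
  intro t
  refine tsum_congr fun v => ?_
  have : Complex.exp (-(((t + 2 * Real.pi : ℝ) : ℂ) / 2) * Complex.I) =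
      -Complex.exp (-(t / 2) * Complex.I) := by
    rw [show (-(((t + 2 * Real.pi : ℝ) : ℂ) / 2) * Complex.I) =
      -(t / 2) * Complex.I + -(Real.pi * Complex.I) by push_cast; ring, Complex.exp_add,
      Complex.exp_neg_pi_mul_I]
    ring
  rw [this, neg_mul, hΦ.even]

/-- The lattice sum as a function on the unit tangent bundle. -/
noncomputable def tangentSum (Φ : ℂ → ℝ) (p : UnitTangent) : ℂ :=
  (latticeSum Φ p.1 p.2.toReal : ℂ)

theorem Admissible.tangentSum_coe {Φ : ℂ → ℝ} (hΦ : Admissible Φ) (z : ℍ) (t : ℝ) :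
    tangentSum Φ (z, (t : Real.Angle)) = (latticeSum Φ z t : ℂ) := by
  rw [tangentSum]
  congr 1
  have h : (((t : Real.Angle).toReal : ℝ) : Real.Angle) = (t : Real.Angle) :=
    Real.Angle.coe_toReal _
  obtain ⟨k, hk⟩ := Real.Angle.angle_eq_iff_two_pi_dvd_sub.mp h
  rw [show (t : Real.Angle).toReal = t + k * (2 * Real.pi) by linarith]
  exact (hΦ.latticeSum_periodic z).int_mul k t

theorem Admissible.continuous_tangentSum {Φ : ℂ → ℝ} (hΦ : Admissible Φ) :
    Continuous (tangentSum Φ) := by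
  have hq : IsOpenQuotientMap (fun p : ℍ × ℝ => ((p.1, (p.2 : Real.Angle)) : UnitTangent)) :=
    IsOpenQuotientMap.id.prodMap QuotientAddGroup.isOpenQuotientMap_mk
  rw [hq.isQuotientMap.continuous_iff]
  have : (tangentSum Φ ∘ fun p : ℍ × ℝ => ((p.1, (p.2 : Real.Angle)) : UnitTangent)) =
      fun p => (latticeSum Φ p.1 p.2 : ℂ) := by
    funext p; exact hΦ.tangentSum_coe p.1 p.2
  rw [this]
  exact Complex.continuous_ofReal.comp hΦ.continuous_latticeSum

end

section

open Matrix EisensteinSeries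

/-! ### Invariance of the lattice sums -/

/-- The inclusion of `SL(2, ℤ)` in `SL(2, ℝ)`. -/
noncomputable def intoReal : SL(2, ℤ) →* SL(2, ℝ) :=
  Matrix.SpecialLinearGroup.map (Int.castRingHom ℝ)

theorem intoReal_apply (γ : SL(2, ℤ)) (i j : Fin 2) : intoReal γ i j = (γ i j : ℝ) := by
  simp [intoReal]

theorem intoReal_smul (γ : SL(2, ℤ)) (z : ℍ) : intoReal γ • z = γ • z := by
  ext
  rw [UpperHalfPlane.coe_specialLinearGroup_apply, UpperHalfPlane.coe_specialLinearGroup_apply]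
  simp [intoReal_apply]

/-- The map from `SL(2, ℤ)` to `PSL(2, ℝ)`. -/
noncomputable def intoPSL : SL(2, ℤ) →* PSL(2, ℝ) :=
  (QuotientGroup.mk' (Subgroup.center SL(2, ℝ))).comp intoReal

theorem intoPSL_smul (γ : SL(2, ℤ)) (z : ℍ) : intoPSL γ • z = γ • z := intoReal_smul γ z

theorem Gamma14Bar_eq : Gamma14Bar = (CongruenceSubgroup.Gamma1 4).map intoPSL := rfl

theorem center_entries {c : SL(2, ℝ)} (hc : c ∈ Subgroup.center SL(2, ℝ)) :
    ∃ r : ℝ, (r = 1 ∨ r = -1) ∧ c 0 0 = r ∧ c 0 1 = 0 ∧ c 1 0 = 0 ∧ c 1 1 = r := by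
  obtain ⟨r, -, h00, h01, h10, h11⟩ := center_scalar hc
  refine ⟨r, ?_, h00, h01, h10, h11⟩
  have h := c.det_coe
  rw [Matrix.det_fin_two, h00, h01, h10, h11] at h
  exact mul_self_eq_one_iff.mp (by linarith)

theorem sl_mul_apply (g h : SL(2, ℝ)) (i j : Fin 2) :
    (g * h) i j = g i 0 * h 0 j + g i 1 * h 1 j := by
  simp [Matrix.mul_apply, Fin.sum_univ_two]

/-- Two elements of `SL(2, ℝ)` with the same class in `PSL(2, ℝ)` agree up to sign. -/
theorem exists_sign_of_mk_eq {g h : SL(2, ℝ)} (e : (g : PSL(2, ℝ)) = (h : PSL(2, ℝ))) :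
    ∃ r : ℝ, (r = 1 ∨ r = -1) ∧ ∀ i j, h i j = r * g i j := by
  obtain ⟨r, hr, h00, h01, h10, h11⟩ := center_entries (QuotientGroup.eq.mp e)
  refine ⟨r, hr, fun i j => ?_⟩
  have : h i j = (g * (g⁻¹ * h)) i j := by rw [mul_inv_cancel_left]
  rw [this, sl_mul_apply]
  fin_cases j
  · simp only [Fin.zero_eta, h00, h10]; ring
  · simp only [Fin.mk_one, h01, h11]; ring

theorem exists_of_mem_Gamma14Bar {g : SL(2, ℝ)} (hg : (g : PSL(2, ℝ)) ∈ Gamma14Bar) :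
    ∃ δ ∈ CongruenceSubgroup.Gamma1 4, ∃ r : ℝ, (r = 1 ∨ r = -1) ∧
      ∀ i j, g i j = r * (δ i j : ℝ) := by
  obtain ⟨δ, hδ, h⟩ := hg
  obtain ⟨r, hr, h⟩ := exists_sign_of_mk_eq (g := intoReal δ) h
  exact ⟨δ, hδ, r, hr, fun i j => by rw [h, intoReal_apply]⟩

/-- The rotation of the lattice is compensated by the change of the angle; the sign `r`, which is
the ambiguity in lifting an element of `PSL(2, ℝ)`, does not matter for even `Φ`. -/
theorem Admissible.latticeSum_modular {Φ : ℂ → ℝ} (hΦ : Admissible Φ) {γ : SL(2, ℤ)}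
    (hγ : γ ∈ CongruenceSubgroup.Gamma1 4) {r : ℝ} (hr : r = 1 ∨ r = -1) (z : ℍ) (t : ℝ) :
    latticeSum Φ (γ • z) (t - 2 * Complex.arg (r * autFactor γ z)) = latticeSum Φ z t := by
  have h0 := autFactor_ne_zero γ z
  have hr0 : (r : ℂ) ≠ 0 := by rcases hr with rfl | rfl <;> simp
  have hrn : ‖(r : ℂ)‖ = 1 := by rcases hr with rfl | rfl <;> simp
  have hexp : Complex.exp (-(((t - 2 * Complex.arg (r * autFactor γ z) : ℝ) : ℂ) / 2) *
      Complex.I) = Complex.exp (-(t / 2) * Complex.I) * (r * autFactor γ z / ‖autFactor γ z‖) := by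
    have h1 := Complex.norm_mul_exp_arg_mul_I (r * autFactor γ z)
    rw [norm_mul, hrn, one_mul] at h1
    have hn : (‖autFactor γ z‖ : ℂ) ≠ 0 := by simpa using h0
    rw [show (-(((t - 2 * Complex.arg (r * autFactor γ z) : ℝ) : ℂ) / 2) * Complex.I) =
      -(t / 2) * Complex.I + Complex.arg (r * autFactor γ z) * Complex.I by push_cast; ring,
      Complex.exp_add]
    congr 1
    rw [eq_div_iff hn, mul_comm]
    exact h1
  rw [latticeSum, latticeSum, ← (vecMulEquiv γ).tsum_eq fun v : Fin 2 → ℤ =>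
    (thetaSign v : ℝ) * Φ (Complex.exp (-(t / 2) * Complex.I) * latticePt v z)]
  refine tsum_congr fun v => ?_
  have hv : vecMulEquiv γ v = v ᵥ* γ.1 := rfl
  rw [hv, thetaSign_vecMul v hγ, hexp, latticePt_modular]
  have hn : (‖autFactor γ z‖ : ℂ) ≠ 0 := by simpa using h0
  have : Complex.exp (-(t / 2) * Complex.I) * (r * autFactor γ z / ‖autFactor γ z‖) *
      (latticePt (v ᵥ* γ.1) z * (‖autFactor γ z‖ / autFactor γ z)) =
      r * (Complex.exp (-(t / 2) * Complex.I) * latticePt (v ᵥ* γ.1) z) := by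
    field_simp
  rw [this]
  rcases hr with rfl | rfl
  · simp
  · simp [hΦ.even]

theorem Admissible.isInvariant_tangentSum {Φ : ℂ → ℝ} (hΦ : Admissible Φ) :
    IsInvariant Gamma14Bar (tangentSum Φ) := by
  rintro g hg ⟨z, θ⟩
  obtain ⟨t, rfl⟩ := Real.Angle.induction_on (p := fun θ => ∃ t : ℝ, (t : Real.Angle) = θ) θ
    fun t => ⟨t, rfl⟩
  obtain ⟨δ, hδ, r, hr, h⟩ := exists_of_mem_Gamma14Bar hg
  have hr0 : (r : ℂ) ≠ 0 := by rcases hr with rfl | rfl <;> simp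
  have hz : g • z = δ • z := by
    ext
    simp only [UpperHalfPlane.coe_specialLinearGroup_apply, h]
    simp only [Algebra.algebraMap_self, RingHom.id_apply, algebraMap_int_eq, eq_intCast]
    push_cast
    rw [mul_assoc, mul_assoc, ← mul_add, ← mul_add, mul_div_mul_left _ _ hr0]
  rw [tangentAct, hz, ← Real.Angle.coe_sub, hΦ.tangentSum_coe, hΦ.tangentSum_coe]
  congr 1
  rw [← hΦ.latticeSum_modular hδ hr z t]
  congr 4
  rw [h, h, autFactor]
  push_cast
  ring

end

section

open Matrix ModularGroup

/-! ### The height function -/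

theorem smul_infty_eq_iff (g : SL(2, ℝ)) :
    (g : PSL(2, ℝ)) • (OnePoint.infty : OnePoint ℝ) = OnePoint.infty ↔ g 1 0 = 0 := by
  rw [mk_smul_boundary]
  exact OnePoint.smul_infty_eq_self_iff

theorem im_real_smul (g : SL(2, ℝ)) (z : ℍ) :
    (g • z).im = z.im / ((g 1 0 * z.re + g 1 1) ^ 2 + (g 1 0 * z.im) ^ 2) := by
  have h := UpperHalfPlane.im_smul_eq_div_normSq (g : GL (Fin 2) ℝ) z
  have h1 : Complex.normSq (UpperHalfPlane.denom (g : GL (Fin 2) ℝ) z) =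
      (g 1 0 * z.re + g 1 1) ^ 2 + (g 1 0 * z.im) ^ 2 := by
    simp [UpperHalfPlane.denom, Complex.normSq_apply]; ring
  rw [h1] at h
  change (SpecialLinearGroup.toGL g • z).im = _
  simpa using h

theorem translation_eq : translation = intoPSL T := by
  refine congrArg _ ?_
  ext i j
  rw [intoReal_apply]
  fin_cases i <;> fin_cases j <;> simp [T]

theorem intoPSL_neg (γ : SL(2, ℤ)) : intoPSL (-γ) = intoPSL γ := by
  refine QuotientGroup.eq.mpr ?_
  rw [Matrix.SpecialLinearGroup.mem_center_iff]
  refine ⟨-1, by simp, ?_⟩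
  have : (intoReal (-γ))⁻¹ * intoReal γ = -1 := by
    rw [inv_mul_eq_iff_eq_mul]
    ext i j
    simp [intoReal_apply]
  rw [this]
  ext i j
  fin_cases i <;> fin_cases j <;> simp

theorem one_le_of_eq_intCast {x : ℝ} (hx : 0 < x) {n : ℤ} (h : x = n) : 1 ≤ x := by
  rw [h] at hx ⊢
  exact_mod_cast (Int.cast_pos.mp hx : 0 < n)

/-- If `g⁻¹ (1 1; 0 1) g` has integral entries up to sign, then `Im (g z) ≤ max (y, 1/y)`: for
`g = (a b; c d)` the entries include `d²` and `-c²`, and one of these integers is not zero. -/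
theorem im_le_of_conj_mem {g : SL(2, ℝ)}
    (hg : (g : PSL(2, ℝ))⁻¹ * translation * g ∈ Gamma14Bar) (z : ℍ) :
    (g • z).im ≤ max z.im (1 / z.im) := by
  have hT : translation = ((intoReal T : SL(2, ℝ)) : PSL(2, ℝ)) := translation_eq
  rw [hT] at hg
  obtain ⟨δ, -, r, hr, h⟩ := exists_of_mem_Gamma14Bar (g := g⁻¹ * intoReal T * g) hg
  have h01 := h 0 1
  have h10 := h 1 0
  have hdet := g.det_coe
  rw [Matrix.det_fin_two] at hdet
  have i00 : g⁻¹ 0 0 = g 1 1 := by simp [adjugate_fin_two]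
  have i01 : g⁻¹ 0 1 = -g 0 1 := by simp [adjugate_fin_two]
  have i10 : g⁻¹ 1 0 = -g 1 0 := by simp [adjugate_fin_two]
  have i11 : g⁻¹ 1 1 = g 0 0 := by simp [adjugate_fin_two]
  have t00 : T 0 0 = 1 := rfl
  have t01 : T 0 1 = 1 := rfl
  have t10 : T 1 0 = 0 := rfl
  have t11 : T 1 1 = 1 := rfl
  simp only [sl_mul_apply, intoReal_apply, i00, i01, i10, i11, t00, t01, t10, t11, Int.cast_one,
    Int.cast_zero] at h01 h10
  have hd : g 1 1 ^ 2 = r * δ 0 1 := by rw [← h01]; ring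
  have hc : g 1 0 ^ 2 = -(r * δ 1 0) := by rw [← h10]; ring
  obtain ⟨m, hm⟩ : ∃ m : ℤ, g 1 1 ^ 2 = m := by
    rcases hr with rfl | rfl
    · exact ⟨δ 0 1, by rw [hd]; simp⟩
    · exact ⟨-δ 0 1, by rw [hd]; simp⟩
  obtain ⟨n, hn⟩ : ∃ n : ℤ, g 1 0 ^ 2 = n := by
    rcases hr with rfl | rfl
    · exact ⟨-δ 1 0, by rw [hc]; simp⟩
    · exact ⟨δ 1 0, by rw [hc]; simp⟩
  have hy := z.im_pos
  rw [im_real_smul]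
  by_cases h0 : g 1 0 = 0
  · have hd0 : g 1 1 ≠ 0 := by
      intro h1; rw [h0, h1] at hdet; simp at hdet
    have h1 := one_le_of_eq_intCast (by positivity) hm
    refine le_max_of_le_left ?_
    rw [h0]
    simp only [zero_mul, zero_add]
    exact div_le_self hy.le (by nlinarith)
  · have h1 := one_le_of_eq_intCast (by positivity) hn
    refine le_max_of_le_right ?_
    rw [div_le_div_iff₀ (by positivity) hy]
    nlinarith [sq_nonneg (g 1 0 * z.re + g 1 1), sq_nonneg z.im]

/-- The supremum in the definition of the height is that of a bounded set. -/
theorem bddAbove_heights (z : ℍ) :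
    BddAbove {t : ℝ | ∃ N ∈ cuspNormalizers Gamma14Bar, ∃ W ∈ Gamma14Bar,
      t = (N • (W • z)).im} := by
  refine ⟨max z.im (1 / z.im), ?_⟩
  rintro _ ⟨N, hN, W, hW, rfl⟩
  obtain ⟨g, hg⟩ := QuotientGroup.mk_surjective (N * W)
  have hgz : N • (W • z) = g • z := by rw [← mul_smul, ← hg, mk_smul]
  rw [hgz]
  refine im_le_of_conj_mem ?_ z
  have h1 : N⁻¹ * translation * N ∈ Gamma14Bar := by
    have : N⁻¹ * translation * N ∈ Subgroup.zpowers (N⁻¹ * translation * N) :=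
      Subgroup.mem_zpowers _
    rw [← (show _ = _ from hN)] at this
    exact this.1
  change (QuotientGroup.mk g : PSL(2, ℝ))⁻¹ * translation * QuotientGroup.mk g ∈ Gamma14Bar
  rw [hg, show (N * W)⁻¹ * translation * (N * W) = W⁻¹ * (N⁻¹ * translation * N) * W by group]
  exact mul_mem (mul_mem (inv_mem hW) h1) hW

/-- Congruence modulo `4` is preserved by conjugation, so that `γ⁻¹ (1 4; 0 1) γ` lies in
`Γ₁(4)`. -/
theorem conj_T_pow_four_mem (γ : SL(2, ℤ)) :
    γ⁻¹ * T ^ (4 : ℤ) * γ ∈ CongruenceSubgroup.Gamma1 4 := by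
  have hdet := γ.det_coe
  rw [Matrix.det_fin_two] at hdet
  have h : T ^ (4 : ℤ) ∈ CongruenceSubgroup.Gamma 4 := by
    rw [CongruenceSubgroup.Gamma_mem, coe_T_zpow]
    decide
  have h2 : γ⁻¹ * T ^ (4 : ℤ) * γ ∈ CongruenceSubgroup.Gamma 4 := by
    simpa using (CongruenceSubgroup.Gamma_normal 4).conj_mem _ h γ⁻¹
  rw [CongruenceSubgroup.Gamma_mem] at h2
  rw [CongruenceSubgroup.Gamma1_mem]
  exact ⟨h2.1, h2.2.2.2, h2.2.2.1⟩

/-- An element of `SL(2, ℤ)` with vanishing lower left entry is a translation up to sign. -/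
theorem intoPSL_eq_T_zpow {σ : SL(2, ℤ)} (h : σ 1 0 = 0) :
    ∃ n : ℤ, intoPSL σ = intoPSL (T ^ n) := by
  have hdet := σ.det_coe
  rw [Matrix.det_fin_two, h, mul_zero, sub_zero] at hdet
  rcases Int.mul_eq_one_iff_eq_one_or_neg_one.mp hdet with ⟨h0, h1⟩ | ⟨h0, h1⟩
  · refine ⟨σ 0 1, congrArg _ ?_⟩
    ext i j
    rw [coe_T_zpow]
    fin_cases i <;> fin_cases j <;> simp [h, h0, h1]
  · refine ⟨-σ 0 1, ?_⟩
    rw [← intoPSL_neg]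
    refine congrArg _ ?_
    ext i j
    rw [coe_T_zpow]
    fin_cases i <;> fin_cases j <;> simp [h, h0, h1]

/-- The diagonal matrix with entries `1/√w` and `√w`. -/
noncomputable def widthMatrix (w : ℝ) (hw : 0 < w) : SL(2, ℝ) :=
  ⟨!![1 / Real.sqrt w, 0; 0, Real.sqrt w], by
    have := (Real.sqrt_pos.mpr hw).ne'
    simp [Matrix.det_fin_two, this]⟩

theorem widthMatrix_conj (w : ℕ) (hw : 0 < (w : ℝ)) :
    (widthMatrix w hw)⁻¹ * intoReal T * widthMatrix w hw = intoReal (T ^ (w : ℤ)) := by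
  have h0 := (Real.sqrt_pos.mpr hw).ne'
  have h1 := Real.mul_self_sqrt hw.le
  rw [mul_assoc, inv_mul_eq_iff_eq_mul]
  ext i j
  rw [sl_mul_apply, sl_mul_apply]
  simp only [intoReal_apply, coe_T_zpow]
  fin_cases i <;> fin_cases j <;> simp [widthMatrix, T]
  field_simp
  linarith

/-- The height is at least a quarter of the imaginary part of every image under `SL(2, ℤ)`, the
cusps of `Γ₁(4)` having width at most `4`. -/
theorem im_le_height (γ : SL(2, ℤ)) (z : ℍ) : (γ • z).im / 4 ≤ height Gamma14Bar z := by
  -- the translations `(1 n; 0 1)` that are conjugated into `Γ` by `γ` form a group `w ℤ`, where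
  -- `w` is the width of the cusp `γ⁻¹ ∞`
  let I : AddSubgroup ℤ :=
    { carrier := {n | intoPSL (γ⁻¹ * T ^ n * γ) ∈ Gamma14Bar}
      zero_mem' := by simp
      add_mem' := fun {m n} hm hn => by
        have : γ⁻¹ * T ^ (m + n) * γ = (γ⁻¹ * T ^ m * γ) * (γ⁻¹ * T ^ n * γ) := by
          group
        change intoPSL _ ∈ Gamma14Bar
        rw [this, map_mul]
        exact mul_mem hm hn
      neg_mem' := fun {m} hm => by
        have : γ⁻¹ * T ^ (-m) * γ = (γ⁻¹ * T ^ m * γ)⁻¹ := by group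
        change intoPSL _ ∈ Gamma14Bar
        rw [this, map_inv]
        exact inv_mem hm }
  have hI : ∀ n, n ∈ I ↔ intoPSL (γ⁻¹ * T ^ n * γ) ∈ Gamma14Bar := fun n => Iff.rfl
  obtain ⟨w, hw⟩ : ∃ w : ℕ, ∀ n, n ∈ I ↔ (w : ℤ) ∣ n := by
    obtain ⟨a, ha⟩ := Int.subgroup_cyclic I
    refine ⟨a.natAbs, fun n => ?_⟩
    rw [ha, ← AddSubgroup.zmultiples_eq_closure, Int.mem_zmultiples_iff, Int.natAbs_dvd]
  have h4 : (w : ℤ) ∣ 4 := (hw 4).mp ((hI 4).mpr ⟨_, conj_T_pow_four_mem γ, rfl⟩)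
  have hw4 : w ≤ 4 := Nat.le_of_dvd (by norm_num) (by exact_mod_cast h4)
  have hw0 : 0 < w := Nat.pos_of_ne_zero fun h => by rw [h] at h4; norm_num at h4
  have hw0' : (0 : ℝ) < w := by exact_mod_cast hw0
  set D : PSL(2, ℝ) := QuotientGroup.mk (widthMatrix w hw0') with hD
  have hDinf : D • (OnePoint.infty : OnePoint ℝ) = OnePoint.infty :=
    (smul_infty_eq_iff _).mpr (by simp [widthMatrix])
  have hTinf : translation • (OnePoint.infty : OnePoint ℝ) = OnePoint.infty :=
    (smul_infty_eq_iff _).mpr (by simp)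
  have hDT : D⁻¹ * translation * D = intoPSL (T ^ (w : ℤ)) := by
    rw [translation_eq]
    exact congrArg QuotientGroup.mk (widthMatrix_conj w hw0')
  set N : PSL(2, ℝ) := D * intoPSL γ with hN
  have hconj : N⁻¹ * translation * N = intoPSL (γ⁻¹ * T ^ (w : ℤ) * γ) := by
    rw [map_mul, map_mul, map_inv, ← hDT, hN]; group
  -- after scaling by the width, `N` belongs to the set of cusp normalizers
  have hmem : N ∈ cuspNormalizers Gamma14Bar := by
    change _ = _
    refine le_antisymm ?_ ?_
    · rintro x ⟨hx, hxs⟩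
      have hx' := hx
      obtain ⟨δ, hδ, rfl⟩ := hx
      have hs : intoPSL (γ * δ * γ⁻¹) • (OnePoint.infty : OnePoint ℝ) = OnePoint.infty := by
        have h1 : intoPSL δ • (N⁻¹ • (OnePoint.infty : OnePoint ℝ)) = N⁻¹ • OnePoint.infty := hxs
        have h2 : N⁻¹ • (OnePoint.infty : OnePoint ℝ) = (intoPSL γ)⁻¹ • OnePoint.infty := by
          rw [hN, _root_.mul_inv_rev, mul_smul, inv_smul_eq_iff.mpr hDinf.symm]
        rw [h2] at h1
        rw [map_mul, map_mul, map_inv, mul_smul, mul_smul, h1, smul_inv_smul]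
      have h10 : (γ * δ * γ⁻¹) 1 0 = 0 := by
        have := (smul_infty_eq_iff _).mp hs
        rw [intoReal_apply] at this
        exact_mod_cast this
      obtain ⟨n, hn⟩ := intoPSL_eq_T_zpow h10
      have hx2 : intoPSL δ = intoPSL (γ⁻¹ * T ^ n * γ) := by
        rw [map_mul, map_mul, ← hn, ← map_mul, ← map_mul]
        congr 1; group
      have hnI : n ∈ I := by
        rw [hI, ← hx2]; exact hx'
      obtain ⟨k, hk⟩ := (hw n).mp hnI
      refine ⟨k, ?_⟩
      change (N⁻¹ * translation * N) ^ k = intoPSL δ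
      rw [hx2, hconj, ← map_zpow, hk, _root_.zpow_mul]
      congr 1
      have := conj_zpow (i := k) (a := γ⁻¹) (b := T ^ (w : ℤ))
      rw [inv_inv] at this
      exact this
    · rw [Subgroup.zpowers_le]
      refine ⟨?_, ?_⟩
      · change N⁻¹ * translation * N ∈ Gamma14Bar
        rw [hconj]
        exact (hI w).mp ((hw w).mpr dvd_rfl)
      · change (N⁻¹ * translation * N) • (N⁻¹ • (OnePoint.infty : OnePoint ℝ)) = _
        rw [mul_smul, mul_smul, smul_inv_smul, hTinf]
  have hle : (N • ((1 : PSL(2, ℝ)) • z)).im ≤ height Gamma14Bar z :=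
    le_csSup (bddAbove_heights z) ⟨N, hmem, 1, one_mem _, rfl⟩
  refine le_trans ?_ hle
  rw [one_smul, hN, mul_smul, intoPSL_smul, hD]
  change _ ≤ (widthMatrix w hw0' • (γ • z)).im
  have hy := (γ • z).im_pos
  have h5 : (w : ℝ) ≤ 4 := by exact_mod_cast hw4
  rw [im_real_smul]
  simp only [widthMatrix]
  simp only [of_apply, cons_val', cons_val_zero, cons_val_one, cons_val_fin_one, zero_mul, zero_add,
    Real.sq_sqrt hw0'.le]
  norm_num
  exact div_le_div_of_nonneg_left hy.le hw0' h5

end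

section

open Matrix ModularGroup

/-! ### Growth of the lattice sums in the cusps -/

theorem sum_range_inv_sq_le {s : ℝ} (hs : 0 < s) (N : ℕ) :
    ∑ n ∈ Finset.range N, 1 / (s + (n + 1)) ^ 2 ≤ 1 / s := by
  have h : ∑ n ∈ Finset.range N, 1 / (s + (n + 1)) ^ 2 ≤ 1 / s - 1 / (s + N) := by
    induction N with
    | zero => simp
    | succ N ih =>
      rw [Finset.sum_range_succ]
      have h1 : 1 / (s + (N + 1)) ^ 2 ≤ 1 / (s + N) - 1 / (s + (N + 1 : ℝ)) := by
        rw [div_sub_div _ _ (by positivity) (by positivity), div_le_div_iff₀ (by positivity)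
          (by positivity)]
        have : (0 : ℝ) ≤ s + N := by positivity
        nlinarith
      push_cast
      linarith
  have : (0 : ℝ) ≤ 1 / (s + N) := by positivity
  linarith

theorem tsum_nat_le {y : ℝ} (hy : 0 < y) {f : ℕ → ℝ} (hf0 : ∀ n, 0 ≤ f n)
    (hf : ∀ n : ℕ, f n ≤ 1 / (1 + (n + 1 : ℝ) ^ 2 / (4 * y))) :
    ∑' n : ℕ, ENNReal.ofReal (f n) ≤ ENNReal.ofReal (4 * Real.sqrt y) := by
  refine ENNReal.tsum_le_of_sum_range_le fun N => ?_
  rw [← ENNReal.ofReal_sum_of_nonneg fun n _ => hf0 n]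
  refine ENNReal.ofReal_le_ofReal ?_
  have hs : 0 < Real.sqrt y := Real.sqrt_pos.mpr hy
  have hsq := Real.mul_self_sqrt hy.le
  set s := Real.sqrt y
  calc ∑ n ∈ Finset.range N, f n
      ≤ ∑ n ∈ Finset.range N, 2 * (2 * s) ^ 2 * (1 / (2 * s + (n + 1)) ^ 2) := by
        refine Finset.sum_le_sum fun n _ => (hf n).trans ?_
        rw [← hsq]
        have : 1 / (1 + (n + 1 : ℝ) ^ 2 / (4 * (s * s))) =
          (2 * s) ^ 2 / ((2 * s) ^ 2 + (n + 1) ^ 2) := by field_simp; ring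
        rw [this, mul_one_div, div_le_div_iff₀ (by positivity) (by positivity)]
        have : (2 * s + (n + 1)) ^ 2 ≤ 2 * ((2 * s) ^ 2 + (n + 1) ^ 2) := by
          nlinarith [sq_nonneg (2 * s - (n + 1))]
        nlinarith [sq_nonneg s]
    _ = 2 * (2 * s) ^ 2 * ∑ n ∈ Finset.range N, 1 / (2 * s + (n + 1)) ^ 2 := by
        rw [Finset.mul_sum]
    _ ≤ 2 * (2 * s) ^ 2 * (1 / (2 * s)) := by
        gcongr; exact sum_range_inv_sq_le (by positivity) N
    _ = 4 * s := by field_simp; ring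

theorem tsum_int_shift_le {y : ℝ} (hy : 0 < y) (u : ℝ) :
    ∑' d : ℤ, ENNReal.ofReal (1 / (1 + (d + u) ^ 2 / y)) ≤
      ENNReal.ofReal (1 + 8 * Real.sqrt y) := by
  -- the shift may be reduced to `|w| ≤ 1/2`
  rw [← (Equiv.subRight (round u)).tsum_eq]
  set w := u - round u with hw
  have hw2 : |w| ≤ 1 / 2 := abs_sub_round u
  have hfun : (fun d : ℤ =>
      ENNReal.ofReal (1 / (1 + (((Equiv.subRight (round u)) d : ℤ) + u) ^ 2 / y))) =
      fun d : ℤ => ENNReal.ofReal (1 / (1 + (d + w) ^ 2 / y)) := by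
    funext d
    rw [Equiv.subRight_apply, hw]; push_cast; ring_nf
  rw [hfun, tsum_of_nat_of_neg_add_one ENNReal.summable ENNReal.summable,
    tsum_eq_zero_add' ENNReal.summable]
  obtain ⟨hw3, hw4⟩ := abs_le.mp hw2
  have h1 : ∑' n : ℕ, ENNReal.ofReal (1 / (1 + (((n + 1 : ℕ) : ℤ) + w) ^ 2 / y)) ≤
      ENNReal.ofReal (4 * Real.sqrt y) := by
    refine tsum_nat_le hy (fun n => by positivity) fun n => ?_
    push_cast
    have h : (n + 1 : ℝ) ^ 2 / (4 * y) ≤ (n + 1 + w) ^ 2 / y := by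
      rw [← div_div]
      gcongr
      have : (0 : ℝ) ≤ n := by positivity
      nlinarith
    gcongr
  have h2 : ∑' n : ℕ, ENNReal.ofReal (1 / (1 + (((-(n + 1) : ℤ) : ℝ) + w) ^ 2 / y)) ≤
      ENNReal.ofReal (4 * Real.sqrt y) := by
    refine tsum_nat_le hy (fun n => by positivity) fun n => ?_
    push_cast
    have h : (n + 1 : ℝ) ^ 2 / (4 * y) ≤ (-(n + 1) + w) ^ 2 / y := by
      rw [← div_div]
      gcongr
      have : (0 : ℝ) ≤ n := by positivity
      nlinarith
    gcongr
  have h0 : ENNReal.ofReal (1 / (1 + (((0 : ℕ) : ℤ) + w) ^ 2 / y)) ≤ ENNReal.ofReal 1 := by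
    refine ENNReal.ofReal_le_ofReal ?_
    rw [div_le_one (by positivity)]
    have : 0 ≤ ((((0 : ℕ) : ℤ) : ℝ) + w) ^ 2 / y := by positivity
    linarith
  calc _ ≤ ENNReal.ofReal 1 + ENNReal.ofReal (4 * Real.sqrt y) +
        ENNReal.ofReal (4 * Real.sqrt y) := add_le_add (add_le_add h0 h1) h2
    _ = _ := by
      rw [← ENNReal.ofReal_add (by positivity) (by positivity),
        ← ENNReal.ofReal_add (by positivity) (by positivity)]
      ring_nf

/-- For `y ≥ 1/2`, the sum over the lattice of `z` is at most of the order of `√y`: each row `c`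
is a lattice of spacing `1/√y` in a line, and the weights of the rows are summable. -/
theorem tsum_lattice_le {z : ℍ} (hz : 1 / 2 ≤ z.im) :
    ∑' v : Fin 2 → ℤ, 1 / (1 + latticeSq v z) ^ 2 ≤ 150 * Real.sqrt z.im := by
  have hy := z.im_pos
  have hs : 1 / 2 ≤ Real.sqrt z.im := Real.le_sqrt_of_sq_le (by linarith)
  rw [← ENNReal.ofReal_le_ofReal_iff (by positivity),
    ENNReal.ofReal_tsum_of_nonneg (fun v => by positivity) (summable_one_div_latticeSq z),
    ← (finTwoArrowEquiv ℤ).symm.tsum_eq, ENNReal.tsum_prod']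
  calc _ ≤ ∑' c : ℤ, ∑' d : ℤ, ENNReal.ofReal (1 / (1 + (c + 0 : ℝ) ^ 2 / 2)) *
        ENNReal.ofReal (1 / (1 + (d + c * z.re) ^ 2 / z.im)) := by
        refine ENNReal.tsum_le_tsum fun c => ENNReal.tsum_le_tsum fun d => ?_
        rw [← ENNReal.ofReal_mul (by positivity)]
        refine ENNReal.ofReal_le_ofReal ?_
        -- the square of `1 + |c z + d|² / y` is at least the product of a factor in `c` and a
        -- factor in `d + c x`
        rw [one_div_mul_one_div]
        refine one_div_le_one_div_of_le (by positivity) ?_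
        rw [latticeSq_eq]
        simp only [finTwoArrowEquiv_symm_apply, cons_val_zero, cons_val_one, cons_val_fin_one]
        have h1 : (c + 0 : ℝ) ^ 2 / 2 ≤ c ^ 2 * z.im := by
          rw [add_zero]; nlinarith [sq_nonneg (c : ℝ)]
        have h2 : (d + c * z.re) ^ 2 / z.im = (c * z.re + d) ^ 2 / z.im := by ring
        rw [h2]
        have h3 : 0 ≤ (c * z.re + d) ^ 2 / z.im := by positivity
        have h4 : (0 : ℝ) ≤ c ^ 2 * z.im := by positivity
        nlinarith [mul_nonneg h3 h4, mul_le_mul_of_nonneg_right h1 h3]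
    _ = ∑' c : ℤ, ENNReal.ofReal (1 / (1 + (c + 0 : ℝ) ^ 2 / 2)) *
        ∑' d : ℤ, ENNReal.ofReal (1 / (1 + (d + c * z.re) ^ 2 / z.im)) := by
        simp_rw [ENNReal.tsum_mul_left]
    _ ≤ ∑' c : ℤ, ENNReal.ofReal (1 / (1 + (c + 0 : ℝ) ^ 2 / 2)) *
        ENNReal.ofReal (1 + 8 * Real.sqrt z.im) := by
        gcongr with c
        exact tsum_int_shift_le hy _
    _ ≤ ENNReal.ofReal (1 + 8 * Real.sqrt 2) * ENNReal.ofReal (1 + 8 * Real.sqrt z.im) := by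
        rw [ENNReal.tsum_mul_right]
        gcongr
        exact tsum_int_shift_le two_pos 0
    _ ≤ ENNReal.ofReal (150 * Real.sqrt z.im) := by
        rw [← ENNReal.ofReal_mul (by positivity)]
        refine ENNReal.ofReal_le_ofReal ?_
        have : Real.sqrt 2 ≤ 3 / 2 := Real.sqrt_le_iff.mpr ⟨by norm_num, by norm_num⟩
        nlinarith [Real.sqrt_nonneg 2]

theorem tsum_lattice_modular (γ : SL(2, ℤ)) (z : ℍ) :
    ∑' v : Fin 2 → ℤ, 1 / (1 + latticeSq v (γ • z)) ^ 2 =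
      ∑' v : Fin 2 → ℤ, 1 / (1 + latticeSq v z) ^ 2 := by
  rw [← (vecMulEquiv γ).tsum_eq fun v : Fin 2 → ℤ => 1 / (1 + latticeSq v z) ^ 2]
  refine tsum_congr fun v => ?_
  rw [latticeSq_modular]
  rfl

/-- Some image of `z` under `SL(2, ℤ)` has imaginary part at least `1/2`, and the height bounds it
from above. -/
theorem tsum_lattice_le_height (z : ℍ) :
    ∑' v : Fin 2 → ℤ, 1 / (1 + latticeSq v z) ^ 2 ≤ 300 * height Gamma14Bar z ^ (1 / 2 : ℝ) := by
  obtain ⟨γ, hγ⟩ := exists_one_half_le_im_smul z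
  have h1 := im_le_height γ z
  rw [← tsum_lattice_modular γ, ← Real.sqrt_eq_rpow]
  refine (tsum_lattice_le hγ).trans ?_
  have h2 : Real.sqrt ((γ • z).im) ≤ 2 * Real.sqrt (height Gamma14Bar z) := by
    rw [show (2 : ℝ) = Real.sqrt 4 by rw [show (4 : ℝ) = 2 ^ 2 by norm_num]; simp,
      ← Real.sqrt_mul (by norm_num)]
    exact Real.sqrt_le_sqrt (by linarith)
  linarith

/-- The lattice sums belong to the class of test functions of `PSE`, with exponent `1/2`. -/
theorem Admissible.testFunction {Φ : ℂ → ℝ} (hΦ : Admissible Φ) :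
    TestFunction Gamma14Bar (1 / 2) (tangentSum Φ) := by
  refine ⟨hΦ.continuous_tangentSum, hΦ.isInvariant_tangentSum, ?_⟩
  obtain ⟨C, hC0, hC⟩ := hΦ.decay
  refine ⟨300 * C + 1, by positivity, fun z θ => ?_⟩
  have h0 : 0 ≤ height Gamma14Bar z := by
    have := im_le_height 1 z
    have := ((1 : SL(2, ℤ)) • z).im_pos
    linarith
  have h1 : ‖tangentSum Φ (z, θ)‖ ≤ C * ∑' v : Fin 2 → ℤ, 1 / (1 + latticeSq v z) ^ 2 := by
    rw [tangentSum, Complex.norm_real, ← tsum_mul_left]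
    exact tsum_of_norm_bounded ((summable_one_div_latticeSq z).mul_left C).hasSum
      fun v => abs_term_le hC v z _
  have h2 := mul_le_mul_of_nonneg_left (tsum_lattice_le_height z) hC0
  have h3 : 0 ≤ height Gamma14Bar z ^ (1 / 2 : ℝ) := Real.rpow_nonneg h0 _
  linarith

end

section

open Matrix ModularGroup
open scoped ENNReal

/-! ### Unfolding -/

/-- The function `B(1/y)` cut off to the strip `0 ≤ x < 1`. -/
noncomputable def stripKernel (B : ℝ → ℝ≥0∞) (z : ℍ) : ℝ≥0∞ :=
  if 0 ≤ z.re ∧ z.re < 1 then B (1 / z.im) else 0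

theorem measurable_stripKernel {B : ℝ → ℝ≥0∞} (hB : Measurable B) : Measurable (stripKernel B) := by
  have h1 : Measurable UpperHalfPlane.re := UpperHalfPlane.continuous_re.measurable
  have h2 : Measurable UpperHalfPlane.im := UpperHalfPlane.continuous_im.measurable
  refine Measurable.ite ?_ (hB.comp (measurable_const.div h2)) measurable_const
  exact (measurableSet_le measurable_const h1).inter (measurableSet_lt h1 measurable_const)

theorem lintegral_inv_Ioi (B : ℝ → ℝ≥0∞) :
    ∫⁻ y in Set.Ioi (0 : ℝ), ENNReal.ofReal (1 / y ^ 2) * B (1 / y) =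
      ∫⁻ t in Set.Ioi (0 : ℝ), B t := by
  have h := lintegral_image_eq_lintegral_abs_deriv_mul (s := Set.Ioi (0 : ℝ)) (f := fun y => y⁻¹)
    (f' := fun y => -(y ^ 2)⁻¹) measurableSet_Ioi
    (fun y hy => (hasDerivAt_inv (ne_of_gt hy)).hasDerivWithinAt) (inv_injective.injOn) B
  have himg : (fun y : ℝ => y⁻¹) '' Set.Ioi (0 : ℝ) = Set.Ioi 0 := by
    ext x
    constructor
    · rintro ⟨y, hy, rfl⟩
      exact inv_pos.mpr (Set.mem_Ioi.mp hy)
    · intro hx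
      exact ⟨x⁻¹, Set.mem_Ioi.mpr (inv_pos.mpr (Set.mem_Ioi.mp hx)), inv_inv x⟩
  rw [himg] at h
  rw [h]
  refine setLIntegral_congr_fun measurableSet_Ioi fun y hy => ?_
  have : |-(y ^ 2)⁻¹| = 1 / y ^ 2 := by
    rw [abs_neg, abs_of_nonneg (by positivity), one_div]
  simp only [this, one_div]

/-- In the strip, the measure `dx dy / y²` becomes `dt` for `t = 1 / y`. -/
theorem lintegral_stripKernel {B : ℝ → ℝ≥0∞} (hB : Measurable B) :
    ∫⁻ z : ℍ, stripKernel B z = ∫⁻ t in Set.Ioi (0 : ℝ), B t := by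
  set G : ℝ × ℝ → ℝ≥0∞ := fun p => (Set.Ico (0 : ℝ) 1).indicator 1 p.1 *
    (Set.Ioi (0 : ℝ)).indicator (fun y => ENNReal.ofReal (1 / y ^ 2) * B (1 / y)) p.2 with hG
  have hm1 : Measurable fun y : ℝ => ENNReal.ofReal (1 / y ^ 2) * B (1 / y) := by fun_prop
  have hGm : Measurable G := by
    refine Measurable.mul ?_ ?_
    · exact (measurable_one.indicator measurableSet_Ico).comp measurable_fst
    · exact (hm1.indicator measurableSet_Ioi).comp measurable_snd
  have hpres : MeasurePreserving UpperHalfPlane.coe (volume.comap UpperHalfPlane.coe)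
      (volume.restrict (Set.range UpperHalfPlane.coe)) :=
    ⟨UpperHalfPlane.measurable_coe,
      by rw [UpperHalfPlane.measurableEmbedding_coe.map_comap]⟩
  have hrange : ∀ w : ℂ, w ∉ Set.range UpperHalfPlane.coe →
      G (Complex.measurableEquivRealProd w) = 0 := by
    intro w hw
    have : ¬ 0 < w.im := fun h => hw ⟨⟨w, h⟩, rfl⟩
    simp only [hG, Complex.measurableEquivRealProd_apply]
    rw [Set.indicator_of_notMem (a := w.im) (by exact this), mul_zero]
  have him : Measurable UpperHalfPlane.im := UpperHalfPlane.continuous_im.measurable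
  calc ∫⁻ z : ℍ, stripKernel B z
      = ∫⁻ z : ℍ, G (Complex.measurableEquivRealProd (z : ℂ))
          ∂(volume.comap UpperHalfPlane.coe) := by
        rw [UpperHalfPlane.volume_def, lintegral_withDensity_eq_lintegral_mul _ _
          (measurable_stripKernel hB)]
        · refine lintegral_congr fun z => ?_
          have hy := z.im_pos
          have hz : z.im ∈ Set.Ioi (0 : ℝ) := hy
          simp only [Pi.mul_apply, hG, Complex.measurableEquivRealProd_apply, stripKernel,
            UpperHalfPlane.coe_re, UpperHalfPlane.coe_im]
          rw [Set.indicator_of_mem hz]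
          have hd : (((1 / NNReal.mk z.im z.im_pos.le) ^ 2 : NNReal) : ℝ≥0∞) =
              ENNReal.ofReal (1 / z.im ^ 2) := by
            rw [ENNReal.ofReal]
            congr 1
            rw [← Real.toNNReal_coe (r := (1 / NNReal.mk z.im z.im_pos.le) ^ 2)]
            congr 1
            push_cast
            rw [div_pow, one_pow]
          by_cases h : 0 ≤ z.re ∧ z.re < 1
          · have h' : z.re ∈ Set.Ico (0 : ℝ) 1 := h
            rw [if_pos h, Set.indicator_of_mem h', Pi.one_apply, one_mul, ← hd]
          · have h' : z.re ∉ Set.Ico (0 : ℝ) 1 := h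
            rw [if_neg h, Set.indicator_of_notMem h', mul_zero, zero_mul]
        · refine Measurable.coe_nnreal_ennreal ?_
          have h1 : Measurable fun z : ℍ => NNReal.mk z.im z.im_pos.le := him.subtype_mk
          exact (measurable_const.div h1).pow_const 2
    _ = ∫⁻ w in Set.range UpperHalfPlane.coe, G (Complex.measurableEquivRealProd w) :=
        hpres.lintegral_comp_emb UpperHalfPlane.measurableEmbedding_coe
          fun w => G (Complex.measurableEquivRealProd w)
    _ = ∫⁻ w : ℂ, G (Complex.measurableEquivRealProd w) := by
        refine setLIntegral_eq_of_support_subset ?_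
        intro w hw
        by_contra h
        exact hw (hrange w h)
    _ = ∫⁻ p, G p := Complex.volume_preserving_equiv_real_prod.lintegral_comp_emb
        Complex.measurableEquivRealProd.measurableEmbedding _
    _ = ∫⁻ x, ∫⁻ y, G (x, y) := by
        rw [Measure.volume_eq_prod, lintegral_prod _ hGm.aemeasurable]
    _ = ∫⁻ x, (Set.Ico (0 : ℝ) 1).indicator 1 x *
          ∫⁻ y in Set.Ioi (0 : ℝ), ENNReal.ofReal (1 / y ^ 2) * B (1 / y) := by
        refine lintegral_congr fun x => ?_
        simp only [hG]
        rw [lintegral_const_mul _ (hm1.indicator measurableSet_Ioi),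
          lintegral_indicator measurableSet_Ioi]
    _ = ∫⁻ t in Set.Ioi (0 : ℝ), B t := by
        rw [lintegral_mul_const _ (measurable_one.indicator measurableSet_Ico),
          lintegral_indicator_one measurableSet_Ico, lintegral_inv_Ioi]
        simp

theorem measurePreserving_psl_smul (g : PSL(2, ℝ)) :
    MeasurePreserving (fun z : ℍ => g • z) volume volume := by
  obtain ⟨h, rfl⟩ := QuotientGroup.mk_surjective g
  exact measurePreserving_smul (SpecialLinearGroup.toGL h) volume

instance (Γ : Subgroup PSL(2, ℝ)) : MeasurableConstSMul Γ ℍ :=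
  ⟨fun g => (measurePreserving_psl_smul g.1).measurable⟩

instance (Γ : Subgroup PSL(2, ℝ)) : SMulInvariantMeasure Γ ℍ volume :=
  ⟨fun g _ hs => (measurePreserving_psl_smul g.1).measure_preimage hs.nullMeasurableSet⟩

instance : Countable SL(2, ℤ) :=
  Function.Injective.countable (f := fun (A : SL(2, ℤ)) (i j : Fin 2) => A i j) fun A B h => by
    ext i j
    exact congrFun (congrFun h i) j

instance : Countable Gamma14Bar := by
  have : (Gamma14Bar : Set PSL(2, ℝ)).Countable := by
    rw [Gamma14Bar_eq, Subgroup.coe_map]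
    exact (Set.to_countable (CongruenceSubgroup.Gamma1 4 : Set SL(2, ℤ))).image _
  exact this.to_subtype

/-- As `-1` is not in `Γ₁(4)`, the group `Γ₁(4)` is isomorphic to its image in `PSL(2, ℝ)`. -/
noncomputable def gammaEquiv : CongruenceSubgroup.Gamma1 4 ≃ Gamma14Bar :=
  Equiv.ofBijective (fun δ => ⟨intoPSL δ.1, ⟨δ.1, δ.2, rfl⟩⟩) <| by
    constructor
    · rintro ⟨a, ha⟩ ⟨b, hb⟩ h
      have h1 : intoPSL a = intoPSL b := congrArg Subtype.val h
      obtain ⟨r, hr, h2⟩ := exists_sign_of_mk_eq (g := intoReal a) (h := intoReal b) h1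
      simp only [intoReal_apply] at h2
      rcases hr with rfl | rfl
      · refine Subtype.ext ?_
        ext i j
        have := h2 i j
        rw [one_mul] at this
        exact_mod_cast this.symm
      · exfalso
        have h3 : b 0 0 = -a 0 0 := by
          have := h2 0 0
          rw [neg_one_mul] at this
          exact_mod_cast this
        have ha0 := ((CongruenceSubgroup.Gamma1_mem 4 a).mp ha).1
        have hb0 := ((CongruenceSubgroup.Gamma1_mem 4 b).mp hb).1
        rw [h3] at hb0
        push_cast at hb0
        rw [ha0] at hb0
        exact absurd hb0 (by decide)
    · rintro ⟨_, δ, hδ, rfl⟩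
      exact ⟨⟨δ, hδ⟩, rfl⟩

theorem lintegral_eq_tsum_gamma {F : Set ℍ} (hF : IsFundamentalDomain Gamma14Bar F volume)
    (k : ℍ → ℝ≥0∞) :
    ∫⁻ z, k z = ∑' δ : CongruenceSubgroup.Gamma1 4, ∫⁻ z in F, k (δ.1 • z) := by
  rw [hF.lintegral_eq_tsum'' k, ← gammaEquiv.tsum_eq]
  refine tsum_congr fun δ => lintegral_congr fun z => congrArg k ?_
  exact intoPSL_smul δ.1 z

/-- Among the elements of `SL(2, ℤ)` with a given bottom row, there is exactly one that moves `z`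
into the strip `0 ≤ x < 1`. -/
theorem existsUnique_strip {v : Fin 2 → ℤ} (hv : IsCoprime (v 0) (v 1)) (z : ℍ) :
    ∃! γ : SL(2, ℤ), γ.1 1 = v ∧ 0 ≤ (γ • z).re ∧ (γ • z).re < 1 := by
  obtain ⟨γ, -, hγ⟩ := bottom_row_surj (R := ℤ) hv
  have hrow : ∀ n : ℤ, (T ^ n * γ).1 1 = v := by
    intro n
    rw [← hγ]
    funext j
    change ((T ^ n : SL(2, ℤ)).1 * γ.1) 1 j = _
    rw [coe_T_zpow, Matrix.mul_apply, Fin.sum_univ_two]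
    simp
  refine ⟨T ^ (-⌊(γ • z).re⌋) * γ, ⟨hrow _, ?_⟩, ?_⟩
  · rw [mul_smul, re_T_zpow_smul]
    push_cast
    constructor
    · linarith [Int.floor_le (γ • z).re]
    · linarith [Int.lt_floor_add_one (γ • z).re]
  · rintro σ ⟨h1, h2, h3⟩
    have h10 : (σ * γ⁻¹) 1 0 = 0 ∧ (σ * γ⁻¹) 1 1 = 1 := by
      have hdet := γ.det_coe
      rw [Matrix.det_fin_two] at hdet
      have e0 : σ 1 0 = γ 1 0 := congrFun (h1.trans hγ.symm) 0
      have e1 : σ 1 1 = γ 1 1 := congrFun (h1.trans hγ.symm) 1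
      constructor
      · simp [Matrix.mul_apply, Fin.sum_univ_two, adjugate_fin_two, e0, e1]; ring
      · simp [Matrix.mul_apply, Fin.sum_univ_two, adjugate_fin_two, e0, e1]; linarith
    have hT : σ * γ⁻¹ = T ^ ((σ * γ⁻¹) 0 1) := by
      have hdet := (σ * γ⁻¹).det_coe
      rw [Matrix.det_fin_two, h10.1, h10.2, mul_zero, sub_zero, mul_one] at hdet
      ext i j
      rw [coe_T_zpow]
      fin_cases i <;> fin_cases j
      · exact hdet
      · rfl
      · exact h10.1
      · exact h10.2
    set n := (σ * γ⁻¹) 0 1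
    have hσ : σ = T ^ n * γ := by rw [← hT]; group
    rw [hσ] at h2 h3 ⊢
    rw [mul_smul, re_T_zpow_smul] at h2 h3
    have : ⌊(γ • z).re⌋ = -n := by
      rw [Int.floor_eq_iff]; push_cast; constructor <;> linarith
    rw [this, neg_neg]

theorem one_div_im_smul (γ : SL(2, ℤ)) (z : ℍ) : 1 / (γ • z).im = latticeSq (γ.1 1) z := by
  have hy := z.im_pos
  rw [im_smul_eq, latticeSq, latticePt, norm_div, div_pow, Complex.norm_real, Real.norm_eq_abs,
    sq_abs, Real.sq_sqrt hy.le, one_div_div]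
  rfl

/-- The sum over `SL(2, ℤ)` of the strip kernel is a sum over primitive vectors, which are the
bottom rows. -/
theorem tsum_stripKernel (ω : (Fin 2 → ℤ) → ℝ≥0∞) (B : ℝ → ℝ≥0∞) (z : ℍ) :
    ∑' γ : SL(2, ℤ), ω (γ.1 1) * stripKernel B (γ • z) =
      ∑' v : {v : Fin 2 → ℤ // IsCoprime (v 0) (v 1)}, ω v.1 * B (latticeSq v.1 z) := by
  let row : SL(2, ℤ) → {v : Fin 2 → ℤ // IsCoprime (v 0) (v 1)} :=
    fun γ => ⟨γ.1 1, bottom_row_coprime γ⟩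
  rw [← (Equiv.sigmaFiberEquiv row).tsum_eq, ENNReal.tsum_sigma']
  refine tsum_congr fun v => ?_
  obtain ⟨γ, ⟨h1, h2⟩, h3⟩ := existsUnique_strip v.2 z
  rw [tsum_eq_single (⟨γ, Subtype.ext h1⟩ : {g // row g = v})]
  · change ω (γ.1 1) * stripKernel B (γ • z) = _
    rw [stripKernel, if_pos h2, h1, one_div_im_smul, h1]
  · rintro ⟨σ, hσ⟩ hne
    change ω (σ.1 1) * stripKernel B (σ • z) = 0
    rw [stripKernel, if_neg, mul_zero]
    intro h
    exact hne (Subtype.ext (h3 σ ⟨congrArg Subtype.val hσ, h⟩))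

/-- The decomposition of a group into the left cosets of a subgroup. -/
noncomputable def cosetEquiv {G : Type*} [Group G] (H : Subgroup G) : (G ⧸ H) × H ≃ G :=
  Equiv.ofBijective (fun p => p.1.out * p.2) <| by
    have key : ∀ p : (G ⧸ H) × H, QuotientGroup.mk (p.1.out * p.2 : G) = p.1 := fun p => by
      rw [QuotientGroup.mk_mul_of_mem _ p.2.2, QuotientGroup.out_eq']
    constructor
    · intro p q h
      have h1 : p.1 = q.1 := by rw [← key p, ← key q]; exact congrArg _ h
      refine Prod.ext h1 (Subtype.ext ?_)
      have h2 : (p.1.out * p.2 : G) = q.1.out * q.2 := h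
      rw [h1] at h2
      exact mul_left_cancel h2
    · intro g
      refine ⟨⟨QuotientGroup.mk g, ⟨(QuotientGroup.mk g : G ⧸ H).out⁻¹ * g, ?_⟩⟩, ?_⟩
      · exact QuotientGroup.eq.mp (QuotientGroup.out_eq' _)
      · exact mul_inv_cancel_left _ _

/-- The unfolding identity for sums over primitive vectors: the sum over `SL(2, ℤ)` of the strip
kernel is split into cosets of `Γ₁(4)`, and for each coset the translates of the fundamental
domain fill the half-plane. -/
theorem lintegral_primitive {F : Set ℍ} (hF : IsFundamentalDomain Gamma14Bar F volume)
    {ω : (Fin 2 → ℤ) → ℝ≥0∞}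
    (hω : ∀ v, ∀ γ ∈ CongruenceSubgroup.Gamma1 4, ω (v ᵥ* γ.1) = ω v)
    {B : ℝ → ℝ≥0∞} (hB : Measurable B) :
    ∫⁻ z in F, ∑' v : {v : Fin 2 → ℤ // IsCoprime (v 0) (v 1)}, ω v.1 * B (latticeSq v.1 z) =
      (∑' q : SL(2, ℤ) ⧸ CongruenceSubgroup.Gamma1 4, ω (q.out.1 1)) *
        ∫⁻ t in Set.Ioi (0 : ℝ), B t := by
  have hmeas : ∀ γ : SL(2, ℤ), Measurable fun z : ℍ => γ • z := fun γ =>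
    (measurePreserving_psl_smul (intoPSL γ)).measurable
  have hk := measurable_stripKernel hB
  simp_rw [← tsum_stripKernel ω B]
  have hm : ∀ γ : SL(2, ℤ), AEMeasurable (fun z : ℍ => ω (γ.1 1) * stripKernel B (γ • z))
      (volume.restrict F) := fun γ => ((hk.comp (hmeas γ)).const_mul _).aemeasurable
  rw [lintegral_tsum hm,
    ← (cosetEquiv (CongruenceSubgroup.Gamma1 4)).tsum_eq, ENNReal.tsum_prod',
    ← ENNReal.tsum_mul_right]
  refine tsum_congr fun q => ?_
  have hrow : ∀ δ : CongruenceSubgroup.Gamma1 4, ω ((q.out * δ.1).1 1) = ω (q.out.1 1) := by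
    intro δ
    rw [← hω (q.out.1 1) δ.1 δ.2]
    congr 1
  have hinv : ∫⁻ z : ℍ, stripKernel B (q.out • z) = ∫⁻ t in Set.Ioi (0 : ℝ), B t := by
    rw [← lintegral_stripKernel hB]
    exact (measurePreserving_psl_smul (intoPSL q.out)).lintegral_comp hk
  rw [← hinv, lintegral_eq_tsum_gamma hF, ← ENNReal.tsum_mul_left]
  refine tsum_congr fun δ => ?_
  change ∫⁻ z in F, ω ((q.out * δ.1).1 1) * stripKernel B ((q.out * δ.1) • z) = _
  rw [hrow]
  refine (lintegral_const_mul _ (hk.comp (hmeas (q.out * δ.1)))).trans ?_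
  congr 1
  refine lintegral_congr fun z => ?_
  change stripKernel B ((q.out * δ.1) • z) = _
  rw [mul_smul]

end

section

open Matrix ModularGroup EisensteinSeries
open scoped ENNReal

/-! ### The lengths of the lattice vectors -/

/-- Every nonzero vector is in a unique way a positive multiple of a primitive one. -/
theorem tsum_nonzero (g : (Fin 2 → ℤ) → ℝ≥0∞) :
    ∑' v, (if v = 0 then 0 else g v) =
      ∑' d : ℕ, ∑' v : {v : Fin 2 → ℤ // IsCoprime (v 0) (v 1)}, g (((d + 1 : ℕ) : ℤ) • v.1) := by
  rw [← gammaSetDivGcdSigmaEquiv.symm.tsum_eq, ENNReal.tsum_sigma',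
    tsum_eq_zero_add' ENNReal.summable]
  have h0 : ∑' b : gammaSet 1 0 0, (if gammaSetDivGcdSigmaEquiv.symm ⟨0, b⟩ = 0 then 0 else
      g (gammaSetDivGcdSigmaEquiv.symm ⟨0, b⟩)) = 0 := by
    refine ENNReal.tsum_eq_zero.mpr fun b => if_pos ?_
    rw [gammaSetDivGcdSigmaEquiv_symm_eq]
    have := gammaSet_eq_gcd_mul_divIntMap b.2
    rwa [zero_smul] at this
  rw [h0, zero_add]
  refine tsum_congr fun d => ?_
  rw [← (gammaSetDivGcdEquiv (d + 1)).symm.tsum_eq,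
    ← (Equiv.subtypeEquivRight mem_gammaSet_one).symm.tsum_eq]
  refine tsum_congr fun w => ?_
  set u := (Equiv.subtypeEquivRight mem_gammaSet_one).symm w with hu
  have hv : (gammaSetDivGcdSigmaEquiv.symm ⟨d + 1, (gammaSetDivGcdEquiv (d + 1)).symm u⟩) =
      ((d + 1 : ℕ) : ℤ) • w.1 := by
    rw [gammaSetDivGcdSigmaEquiv_symm_eq]
    change ((gammaSetDivGcdEquiv (d + 1)).symm u).1 = _
    rw [gammaSet_eq_gcd_mul_divIntMap ((gammaSetDivGcdEquiv (d + 1)).symm u).2,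
      ← gammaSetDivGcdEquiv_eq, Equiv.apply_symm_apply, natCast_zsmul]
    rfl
  rw [hv, if_neg]
  intro h
  have h' := (smul_eq_zero.mp h).resolve_left (by positivity)
  have hc := w.2
  rw [h'] at hc
  exact not_isCoprime_zero_zero hc

theorem lintegral_Ioi_comp_mul {a : ℝ} (ha : 0 < a) (B : ℝ → ℝ≥0∞) :
    ∫⁻ t in Set.Ioi (0 : ℝ), B (a * t) =
      ENNReal.ofReal (1 / a) * ∫⁻ t in Set.Ioi (0 : ℝ), B t := by
  have h := lintegral_image_eq_lintegral_abs_deriv_mul (s := Set.Ioi (0 : ℝ)) (f := fun y => a * y)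
    (f' := fun _ => a) measurableSet_Ioi
    (fun y _ => by simpa using ((hasDerivAt_id y).const_mul a).hasDerivWithinAt)
    ((mul_right_injective₀ ha.ne').injOn) B
  have himg : (fun y : ℝ => a * y) '' Set.Ioi (0 : ℝ) = Set.Ioi 0 := by
    ext x
    constructor
    · rintro ⟨y, hy, rfl⟩
      exact Set.mem_Ioi.mpr (mul_pos ha hy)
    · intro hx
      exact ⟨x / a, Set.mem_Ioi.mpr (div_pos hx ha), mul_div_cancel₀ x ha.ne'⟩
  rw [himg, lintegral_const_mul' _ _ ENNReal.ofReal_ne_top, abs_of_pos ha] at h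
  rw [h, ← mul_assoc, ← ENNReal.ofReal_mul (by positivity), one_div_mul_cancel ha.ne',
    ENNReal.ofReal_one, one_mul]

theorem continuous_latticeSq (v : Fin 2 → ℤ) : Continuous (latticeSq v) :=
  (continuous_latticePt v).norm.pow 2

/-- For a weight invariant under `Γ₁(4)`, the weighted distribution of the squared lengths of the
nonzero lattice vectors, averaged over a fundamental domain, is a multiple of Lebesgue measure. -/
theorem exists_lintegral_nonzero {F : Set ℍ} (hF : IsFundamentalDomain Gamma14Bar F volume)
    {ω : (Fin 2 → ℤ) → ℝ≥0∞} (hω1 : ∀ v, ω v ≤ 1)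
    (hω : ∀ v, ∀ γ ∈ CongruenceSubgroup.Gamma1 4, ω (v ᵥ* γ.1) = ω v) :
    ∃ κ : ℝ≥0∞, κ ≠ ∞ ∧ ∀ B : ℝ → ℝ≥0∞, Measurable B →
      ∫⁻ z in F, ∑' v : Fin 2 → ℤ, (if v = 0 then 0 else ω v * B (latticeSq v z)) =
        κ * ∫⁻ t in Set.Ioi (0 : ℝ), B t := by
  refine ⟨∑' d : ℕ, (∑' q : SL(2, ℤ) ⧸ CongruenceSubgroup.Gamma1 4,
    ω (((d + 1 : ℕ) : ℤ) • q.out.1 1)) * ENNReal.ofReal (1 / ((d + 1 : ℕ) : ℝ) ^ 2), ?_, ?_⟩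
  · have hfin : Finite (SL(2, ℤ) ⧸ CongruenceSubgroup.Gamma1 4) := inferInstance
    have := Fintype.ofFinite (SL(2, ℤ) ⧸ CongruenceSubgroup.Gamma1 4)
    have hsum : Summable fun d : ℕ => 1 / ((d + 1 : ℕ) : ℝ) ^ 2 :=
      (summable_nat_add_iff 1).mpr (Real.summable_one_div_nat_pow.mpr one_lt_two)
    refine ne_top_of_le_ne_top (ENNReal.mul_ne_top (ENNReal.natCast_ne_top
      (Fintype.card (SL(2, ℤ) ⧸ CongruenceSubgroup.Gamma1 4))) hsum.tsum_ofReal_ne_top) ?_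
    rw [← ENNReal.tsum_mul_left]
    refine ENNReal.tsum_le_tsum fun d => ?_
    gcongr
    rw [tsum_fintype]
    refine (Finset.sum_le_sum fun q _ => hω1 _).trans ?_
    simp
  · intro B hB
    have hmeas : ∀ d : ℕ, Measurable fun z : ℍ => ∑' v : {v : Fin 2 → ℤ // IsCoprime (v 0) (v 1)},
        ω (((d + 1 : ℕ) : ℤ) • v.1) * B (latticeSq (((d + 1 : ℕ) : ℤ) • v.1) z) := fun d =>
      Measurable.tsum fun v =>
        (hB.comp (continuous_latticeSq _).measurable).const_mul _
    have hsplit : ∀ z : ℍ, ∑' v : Fin 2 → ℤ, (if v = 0 then 0 else ω v * B (latticeSq v z)) =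
        ∑' d : ℕ, ∑' v : {v : Fin 2 → ℤ // IsCoprime (v 0) (v 1)},
        ω (((d + 1 : ℕ) : ℤ) • v.1) * B (latticeSq (((d + 1 : ℕ) : ℤ) • v.1) z) := fun z =>
      tsum_nonzero fun v => ω v * B (latticeSq v z)
    simp_rw [hsplit]
    rw [lintegral_tsum fun d => (hmeas d).aemeasurable, ← ENNReal.tsum_mul_right]
    refine tsum_congr fun d => ?_
    have hd : (0 : ℝ) < ((d + 1 : ℕ) : ℝ) ^ 2 := by positivity
    have h := lintegral_primitive hF (ω := fun v => ω (((d + 1 : ℕ) : ℤ) • v))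
      (fun v γ hγ => by rw [← smul_vecMul, hω _ γ hγ])
      (B := fun t => B (((d + 1 : ℕ) : ℝ) ^ 2 * t)) (hB.comp (measurable_const_mul _))
    rw [lintegral_Ioi_comp_mul hd, ← mul_assoc] at h
    rw [← h]
    refine lintegral_congr fun z => tsum_congr fun v => ?_
    rw [latticeSq_smul, Int.cast_natCast]

/-- Every lattice of this kind has a nonzero vector of squared length at most `2`, so that the
distribution of the lengths bounds the volume of the fundamental domain. -/
theorem volume_fundamental_ne_top {F : Set ℍ} (hF : IsFundamentalDomain Gamma14Bar F volume) :
    volume F ≠ ∞ := by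
  obtain ⟨κ, hκ, h⟩ := exists_lintegral_nonzero hF (ω := fun _ => 1) (fun _ => le_rfl)
    (fun _ _ _ => rfl)
  have h1 := h ((Set.Iic (2 : ℝ)).indicator 1) (measurable_one.indicator measurableSet_Iic)
  refine ne_top_of_le_ne_top (b := κ * ENNReal.ofReal 2) (ENNReal.mul_ne_top hκ
    ENNReal.ofReal_ne_top) ?_
  have h2 : ∫⁻ t in Set.Ioi (0 : ℝ), (Set.Iic (2 : ℝ)).indicator (1 : ℝ → ℝ≥0∞) t =
      ENNReal.ofReal 2 := by
    rw [lintegral_indicator_one measurableSet_Iic, Measure.restrict_apply measurableSet_Iic,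
      Set.inter_comm, Set.Ioi_inter_Iic, Real.volume_Ioc, sub_zero]
  rw [← h2, ← h1]
  calc volume F = ∫⁻ _ in F, 1 := by rw [setLIntegral_one]
    _ ≤ _ := by
      refine lintegral_mono fun z => ?_
      obtain ⟨γ, hγ⟩ := exists_one_half_le_im_smul z
      refine le_trans ?_ (ENNReal.le_tsum (γ.1 1))
      have h3 : γ.1 1 ≠ 0 := by
        intro h0
        have := bottom_row_coprime γ
        rw [show γ 1 0 = 0 from congrFun h0 0, show γ 1 1 = 0 from congrFun h0 1] at this
        exact not_isCoprime_zero_zero this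
      have h4 : latticeSq (γ.1 1) z ∈ Set.Iic (2 : ℝ) := by
        rw [← one_div_im_smul, Set.mem_Iic, div_le_iff₀ (γ • z).im_pos]
        linarith
      rw [if_neg h3, Set.indicator_of_mem h4, Pi.one_apply, one_mul]

theorem volume_fundamental_ne_zero {F : Set ℍ} (hF : IsFundamentalDomain Gamma14Bar F volume) :
    volume F ≠ 0 := by
  refine hF.measure_ne_zero fun h => ?_
  have h1 := lintegral_stripKernel (B := (Set.Iic (1 : ℝ)).indicator 1)
    (measurable_one.indicator measurableSet_Iic)
  rw [lintegral_indicator_one measurableSet_Iic, Measure.restrict_apply measurableSet_Iic,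
      Set.inter_comm, Set.Ioi_inter_Iic, Real.volume_Ioc, h] at h1
  simp at h1

/-- Functions on the half-line that decay like `t⁻²`. -/
structure RadialDecay (A : ℝ → ℝ) : Prop where
  continuous : Continuous A
  decay : ∃ C : ℝ, 0 ≤ C ∧ ∀ t, 0 ≤ t → |A t| ≤ C * (1 / (1 + t) ^ 2)

theorem RadialDecay.abs {A : ℝ → ℝ} (hA : RadialDecay A) : RadialDecay fun t => |A t| :=
  ⟨hA.continuous.abs, by simpa using hA.decay⟩

theorem RadialDecay.integrableOn {A : ℝ → ℝ} (hA : RadialDecay A) :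
    IntegrableOn A (Set.Ioi 0) := by
  obtain ⟨C, hC0, hC⟩ := hA.decay
  have h := ((integrable_one_add_norm (E := ℝ) (μ := volume) (r := 2) (by simp)).const_mul
    C).integrableOn (s := Set.Ioi 0)
  refine h.mono' hA.continuous.aestronglyMeasurable.restrict ?_
  filter_upwards [ae_restrict_mem measurableSet_Ioi] with t ht
  rw [Real.norm_eq_abs]
  refine (hC t (le_of_lt ht)).trans (le_of_eq ?_)
  rw [Real.norm_of_nonneg (le_of_lt ht), Real.rpow_neg (by have : (0:ℝ) < t := ht; positivity),
    one_div, show (2 : ℝ) = ((2 : ℕ) : ℝ) by norm_num, Real.rpow_natCast]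

/-- The distribution of the squared lengths of the vectors in an invariant set, for real test
functions. -/
theorem exists_hasSum_integral {F : Set ℍ} (hF : IsFundamentalDomain Gamma14Bar F volume)
    {S : Set (Fin 2 → ℤ)} (h0 : (0 : Fin 2 → ℤ) ∉ S)
    (hS : ∀ v, ∀ γ ∈ CongruenceSubgroup.Gamma1 4, v ᵥ* γ.1 ∈ S ↔ v ∈ S) :
    ∃ κ : ℝ, ∀ A : ℝ → ℝ, RadialDecay A →
      HasSum (S.indicator fun v => ∫ z in F, A (latticeSq v z))
        (κ * ∫ t in Set.Ioi (0 : ℝ), A t) := by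
  classical
  obtain ⟨κ, hκ, h⟩ := exists_lintegral_nonzero hF (ω := S.indicator 1)
    (fun v => Set.indicator_apply_le' (fun _ => le_rfl) fun _ => zero_le)
    (fun v γ hγ => by
      by_cases hv : v ∈ S
      · rw [Set.indicator_of_mem hv, Set.indicator_of_mem ((hS v γ hγ).mpr hv)]; rfl
      · rw [Set.indicator_of_notMem hv, Set.indicator_of_notMem fun h => hv ((hS v γ hγ).mp h)])
  -- the sum of the distributions of the individual vectors is a multiple of Lebesgue measure
  set m : S → Measure ℝ := fun v => (volume.restrict F).map (latticeSq v.1) with hm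
  have hsum : Measure.sum m = κ • volume.restrict (Set.Ioi 0) := by
    ext s hs
    have h1 := h (s.indicator 1) (measurable_one.indicator hs)
    rw [lintegral_indicator_one hs] at h1
    rw [Measure.smul_apply, smul_eq_mul, ← h1, Measure.sum_apply _ hs]
    have hmeas : ∀ v : Fin 2 → ℤ, Measurable fun z : ℍ =>
        s.indicator (1 : ℝ → ℝ≥0∞) (latticeSq v z) :=
      fun v => (measurable_one.indicator hs).comp (continuous_latticeSq v).measurable
    have h2 : ∀ z : ℍ, ∑' v : Fin 2 → ℤ, (if v = 0 then 0 else
        S.indicator (1 : (Fin 2 → ℤ) → ℝ≥0∞) v * s.indicator (1 : ℝ → ℝ≥0∞) (latticeSq v z)) =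
        ∑' v : S, s.indicator (1 : ℝ → ℝ≥0∞) (latticeSq v.1 z) := by
      intro z
      rw [tsum_subtype S fun v => s.indicator (1 : ℝ → ℝ≥0∞) (latticeSq v z)]
      refine tsum_congr fun v => ?_
      by_cases hv : v ∈ S
      · rw [if_neg fun h' : v = 0 => h0 (h' ▸ hv), Set.indicator_of_mem hv, Set.indicator_of_mem hv,
          Pi.one_apply, one_mul]
      · rw [Set.indicator_of_notMem hv, Set.indicator_of_notMem hv]; simp
    simp_rw [h2]
    have hae : ∀ v : S, AEMeasurable (fun z : ℍ => s.indicator (1 : ℝ → ℝ≥0∞) (latticeSq v.1 z))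
        (volume.restrict F) := fun v => (hmeas v.1).aemeasurable
    rw [lintegral_tsum hae]
    refine tsum_congr fun v => ?_
    rw [hm, Measure.map_apply (continuous_latticeSq v.1).measurable hs,
      ← lintegral_indicator_one ((continuous_latticeSq v.1).measurable hs)]
    rfl
  refine ⟨κ.toReal, fun A hA => ?_⟩
  have hint : Integrable A (Measure.sum m) := by
    rw [hsum]; exact hA.integrableOn.smul_measure hκ
  have h3 := hasSum_integral_measure hint
  rw [hsum, integral_smul_measure, smul_eq_mul] at h3
  rw [← hasSum_subtype_iff_indicator]
  have he : ((fun v => ∫ z in F, A (latticeSq v z)) ∘ ((↑) : S → Fin 2 → ℤ)) =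
      fun v : S => ∫ t, A t ∂(m v) := funext fun v =>
    (integral_map (continuous_latticeSq v.1).measurable.aemeasurable
      hA.continuous.aestronglyMeasurable).symm
  rw [he]
  exact h3

end

section

open Matrix

/-! ### The average of a lattice sum -/

theorem vecMul_eq_zero_iff (v : Fin 2 → ℤ) (γ : SL(2, ℤ)) : v ᵥ* γ.1 = 0 ↔ v = 0 := by
  constructor
  · intro h
    exact (vecMulEquiv γ).injective (h.trans (Matrix.zero_vecMul γ.1).symm)
  · rintro rfl
    exact Matrix.zero_vecMul γ.1

theorem thetaSign_eq (v : Fin 2 → ℤ) : thetaSign v = 0 ∨ thetaSign v = 1 ∨ thetaSign v = -1 := by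
  unfold thetaSign; split_ifs <;> simp

/-- The integral over a fundamental domain of a signed sum over the lattice: the origin
contributes the value at `0`, and the vectors of each sign contribute a multiple of the
integral. -/
theorem exists_integral_signed {F : Set ℍ} (hF : IsFundamentalDomain Gamma14Bar F volume) :
    ∃ κ : ℝ, ∀ A : ℝ → ℝ, RadialDecay A →
      ∫ z in F, ∑' v : Fin 2 → ℤ, thetaSign v * A (latticeSq v z) =
        (volume F).toReal * A 0 + κ * ∫ t in Set.Ioi (0 : ℝ), A t := by
  classical
  have hvol := volume_fundamental_ne_top hF
  have hinv : ∀ s : ℤ, ∀ v, ∀ γ ∈ CongruenceSubgroup.Gamma1 4,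
      v ᵥ* γ.1 ∈ {v : Fin 2 → ℤ | v ≠ 0 ∧ thetaSign v = s} ↔
        v ∈ {v : Fin 2 → ℤ | v ≠ 0 ∧ thetaSign v = s} := fun s v γ hγ => by
    change _ ∧ _ ↔ _ ∧ _
    rw [ne_eq, vecMul_eq_zero_iff, thetaSign_vecMul v hγ]
  obtain ⟨κ₁, h₁⟩ := exists_hasSum_integral hF (S := {v | v ≠ 0 ∧ thetaSign v = 1})
    (fun h => h.1 rfl) (hinv 1)
  obtain ⟨κ₂, h₂⟩ := exists_hasSum_integral hF (S := {v | v ≠ 0 ∧ thetaSign v = -1})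
    (fun h => h.1 rfl) (hinv (-1))
  refine ⟨κ₁ - κ₂, fun A hA => ?_⟩
  have hzero : ∀ B : ℝ → ℝ, HasSum (({0} : Set (Fin 2 → ℤ)).indicator
      fun v => ∫ z in F, B (latticeSq v z)) ((volume F).toReal * B 0) := by
    intro B
    have : ∫ z in F, B (latticeSq 0 z) = (volume F).toReal * B 0 := by
      simp [latticeSq, latticePt_zero, Measure.real]
    rw [← this, ← hasSum_subtype_iff_indicator]
    exact hasSum_unique _
  -- for `ε = -1` this decomposes the signed sum, for `ε = 1` the sum of absolute values
  have hcase : ∀ (I : (Fin 2 → ℤ) → ℝ) (ε : ℝ) v,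
      (if thetaSign v = -1 then ε else thetaSign v) * I v =
        ({0} : Set (Fin 2 → ℤ)).indicator I v +
        ({v | v ≠ 0 ∧ thetaSign v = 1} : Set (Fin 2 → ℤ)).indicator I v +
        ε * ({v | v ≠ 0 ∧ thetaSign v = -1} : Set (Fin 2 → ℤ)).indicator I v := by
    intro I ε v
    by_cases hv : v = 0
    · subst hv
      simp [thetaSign_zero]
    · rcases thetaSign_eq v with h | h | h <;> simp [hv, h]
  have hmeas : ∀ v : Fin 2 → ℤ, AEStronglyMeasurable (fun z : ℍ => thetaSign v * A (latticeSq v z))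
      (volume.restrict F) := fun v =>
    ((hA.continuous.comp (continuous_latticeSq v)).measurable.const_mul _).aestronglyMeasurable
  -- the integrals of the absolute values, which justify the interchange of sum and integral
  have habs : HasSum (fun v : Fin 2 → ℤ => ∫ z in F, ‖(thetaSign v : ℝ) * A (latticeSq v z)‖)
      ((volume F).toReal * |A 0| + κ₁ * (∫ t in Set.Ioi (0 : ℝ), |A t|) +
        1 * (κ₂ * ∫ t in Set.Ioi (0 : ℝ), |A t|)) := by
    have h := ((hzero fun t => |A t|).add (h₁ _ hA.abs)).add ((h₂ _ hA.abs).mul_left 1)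
    refine h.congr_fun fun v => ?_
    rw [← hcase]
    simp only [norm_mul, Real.norm_eq_abs]
    rw [integral_const_mul]
    congr 1
    rcases thetaSign_eq v with h | h | h <;> simp [h]
  have hint : ∀ v : Fin 2 → ℤ, Integrable (fun z : ℍ => (thetaSign v : ℝ) * A (latticeSq v z))
      (volume.restrict F) := by
    intro v
    obtain ⟨C, hC0, hC⟩ := hA.decay
    have : IsFiniteMeasure (volume.restrict F) := ⟨by
      rw [Measure.restrict_apply_univ]; exact hvol.lt_top⟩
    refine Integrable.of_bound (hmeas v) C (Eventually.of_forall fun z => ?_)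
    have h0 : 0 ≤ latticeSq v z := sq_nonneg _
    rw [norm_mul, Real.norm_eq_abs, Real.norm_eq_abs]
    calc _ ≤ 1 * (C * (1 / (1 + latticeSq v z) ^ 2)) := by
          gcongr
          · exact abs_thetaSign_le v
          · exact hC _ h0
      _ ≤ 1 * (C * 1) := by
          gcongr
          rw [div_le_one (by positivity)]
          nlinarith
      _ = C := by ring
  have hmain := hasSum_integral_of_summable_integral_norm hint habs.summable
  have hval : HasSum (fun v : Fin 2 → ℤ => ∫ z in F, (thetaSign v : ℝ) * A (latticeSq v z))
      ((volume F).toReal * A 0 + κ₁ * (∫ t in Set.Ioi (0 : ℝ), A t) +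
        -1 * (κ₂ * ∫ t in Set.Ioi (0 : ℝ), A t)) := by
    have h := ((hzero A).add (h₁ _ hA)).add ((h₂ _ hA).mul_left (-1))
    refine h.congr_fun fun v => ?_
    rw [← hcase, integral_const_mul]
    congr 1
    rcases thetaSign_eq v with h | h | h <;> simp [h]
  rw [hmain.unique hval]
  ring

/-- The integral of `Φ` in the angle over the circle of squared radius `s`. As in the action on the
tangent bundle, the angle is halved, so that for even `Φ` a half circle is traversed. -/
noncomputable def circleIntegral (Φ : ℂ → ℝ) (s : ℝ) : ℝ :=
  ∫ t in (0 : ℝ)..(2 * Real.pi), Φ (Complex.exp (-(t / 2) * Complex.I) * (Real.sqrt s : ℝ))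

theorem Admissible.periodic {Φ : ℂ → ℝ} (hΦ : Admissible Φ) (w : ℂ) :
    Function.Periodic (fun t : ℝ => Φ (Complex.exp (-(t / 2) * Complex.I) * w)) (2 * Real.pi) := by
  intro t
  have : Complex.exp (-(((t + 2 * Real.pi : ℝ) : ℂ) / 2) * Complex.I) =
      -Complex.exp (-(t / 2) * Complex.I) := by
    rw [show (-(((t + 2 * Real.pi : ℝ) : ℂ) / 2) * Complex.I) =
      -(t / 2) * Complex.I + -(Real.pi * Complex.I) by push_cast; ring, Complex.exp_add,
      Complex.exp_neg_pi_mul_I]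
    ring
  change Φ (Complex.exp (-(((t + 2 * Real.pi : ℝ) : ℂ) / 2) * Complex.I) * w) = _
  rw [this, neg_mul (Complex.exp _), hΦ.even]

theorem Admissible.circleIntegral_eq {Φ : ℂ → ℝ} (hΦ : Admissible Φ) (w : ℂ) :
    ∫ t in (0 : ℝ)..(2 * Real.pi), Φ (Complex.exp (-(t / 2) * Complex.I) * w) =
      circleIntegral Φ (‖w‖ ^ 2) := by
  rw [circleIntegral, Real.sqrt_sq (norm_nonneg w)]
  have h1 : ∀ t : ℝ, Φ (Complex.exp (-(t / 2) * Complex.I) * w) =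
      Φ (Complex.exp (-((t - 2 * w.arg : ℝ) / 2) * Complex.I) * (‖w‖ : ℝ)) := by
    intro t
    congr 1
    conv_lhs => rw [← Complex.norm_mul_exp_arg_mul_I w]
    rw [mul_comm ((‖w‖ : ℝ) : ℂ), ← mul_assoc, ← Complex.exp_add]
    congr 2
    push_cast
    ring
  simp_rw [h1]
  rw [intervalIntegral.integral_comp_sub_right fun t : ℝ =>
    Φ (Complex.exp (-(t / 2) * Complex.I) * (‖w‖ : ℝ))]
  have h2 := (hΦ.periodic (‖w‖ : ℝ)).intervalIntegral_add_eq (-(2 * w.arg)) 0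
  rw [zero_add] at h2
  rw [← h2]
  congr 1 <;> ring

theorem Admissible.radialDecay {Φ : ℂ → ℝ} (hΦ : Admissible Φ) :
    RadialDecay (circleIntegral Φ) := by
  constructor
  · refine intervalIntegral.continuous_parametric_intervalIntegral_of_continuous' ?_ _ _
    have h1 : Continuous fun p : ℝ × ℝ =>
        Complex.exp (-(p.2 / 2) * Complex.I) * (Real.sqrt p.1 : ℝ) := by fun_prop
    exact hΦ.continuous.comp h1
  · obtain ⟨C, hC0, hC⟩ := hΦ.decay
    refine ⟨C * (2 * Real.pi), by positivity, fun s hs => ?_⟩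
    have h := intervalIntegral.norm_integral_le_of_norm_le_const (a := 0) (b := 2 * Real.pi)
      (f := fun t : ℝ => Φ (Complex.exp (-(t / 2) * Complex.I) * (Real.sqrt s : ℝ)))
      (C := C * (1 / (1 + s) ^ 2)) fun t _ => by
        have := hC (Complex.exp (-(t / 2) * Complex.I) * (Real.sqrt s : ℝ))
        rw [norm_mul, norm_exp_half, one_mul, Complex.norm_real, Real.norm_eq_abs, sq_abs,
          Real.sq_sqrt hs] at this
        exact this
    rw [sub_zero, abs_of_pos Real.two_pi_pos] at h
    rw [circleIntegral, ← Real.norm_eq_abs]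
    linarith

theorem circleIntegral_zero (Φ : ℂ → ℝ) : circleIntegral Φ 0 = 2 * Real.pi * Φ 0 := by
  simp [circleIntegral]

theorem Admissible.integral_latticeSum {Φ : ℂ → ℝ} (hΦ : Admissible Φ) (z : ℍ) :
    ∫ t in (0 : ℝ)..(2 * Real.pi), latticeSum Φ z t =
      ∑' v : Fin 2 → ℤ, thetaSign v * circleIntegral Φ (latticeSq v z) := by
  obtain ⟨C, hC0, hC⟩ := hΦ.decay
  have hcont : ∀ v : Fin 2 → ℤ, Continuous fun t : ℝ =>
      (thetaSign v : ℝ) * Φ (Complex.exp (-(t / 2) * Complex.I) * latticePt v z) := by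
    intro v
    have h1 : Continuous fun t : ℝ => Complex.exp (-(t / 2) * Complex.I) * latticePt v z := by
      fun_prop
    exact continuous_const.mul (hΦ.continuous.comp h1)
  have h := intervalIntegral.hasSum_integral_of_dominated_convergence
    (μ := volume) (a := 0) (b := 2 * Real.pi)
    (F := fun (v : Fin 2 → ℤ) (t : ℝ) =>
      (thetaSign v : ℝ) * Φ (Complex.exp (-(t / 2) * Complex.I) * latticePt v z))
    (f := latticeSum Φ z) (fun v _ => C * (1 / (1 + latticeSq v z) ^ 2))
    (fun v => (hcont v).aestronglyMeasurable)
    (fun v => Eventually.of_forall fun t _ => abs_term_le hC v z t)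
    (Eventually.of_forall fun t _ => (summable_one_div_latticeSq z).mul_left C)
    (by simp)
    (Eventually.of_forall fun t _ => (hΦ.summable z t).hasSum)
  rw [← h.tsum_eq]
  refine tsum_congr fun v => ?_
  rw [intervalIntegral.integral_const_mul, hΦ.circleIntegral_eq]
  rfl

/-- The average of a lattice sum, with a constant `κ` that does not depend on `Φ`. -/
theorem exists_average {F : Set ℍ} (hF : IsFundamentalDomain Gamma14Bar F volume) :
    ∃ κ : ℝ, ∀ Φ : ℂ → ℝ, Admissible Φ →
      average F (tangentSum Φ) =
        ((Φ 0 + κ * ∫ t in Set.Ioi (0 : ℝ), circleIntegral Φ t : ℝ) : ℂ) := by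
  obtain ⟨κ, h⟩ := exists_integral_signed hF
  have hvol : (volume F).toReal ≠ 0 :=
    ENNReal.toReal_ne_zero.mpr ⟨volume_fundamental_ne_zero hF, volume_fundamental_ne_top hF⟩
  refine ⟨1 / (2 * Real.pi * (volume F).toReal) * κ, fun Φ hΦ => ?_⟩
  have h1 : ∫ z in F, ∫ θ in (0 : ℝ)..(2 * Real.pi), tangentSum Φ (z, (θ : Real.Angle)) =
      ((∫ z in F, ∑' v : Fin 2 → ℤ, thetaSign v * circleIntegral Φ (latticeSq v z) : ℝ) : ℂ) := by
    rw [← integral_complex_ofReal]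
    refine integral_congr_ae (Eventually.of_forall fun z => ?_)
    simp only [hΦ.tangentSum_coe]
    rw [intervalIntegral.integral_ofReal, hΦ.integral_latticeSum]
  rw [average, h1, h _ hΦ.radialDecay, circleIntegral_zero, ← Complex.ofReal_mul]
  congr 1
  have := Real.pi_ne_zero
  field_simp

theorem Admissible.integrable {Φ : ℂ → ℝ} (hΦ : Admissible Φ) : Integrable Φ := by
  obtain ⟨C, hC0, hC⟩ := hΦ.decay
  have h := (integrable_one_add_norm (E := ℂ) (μ := volume) (r := 4) (by
    rw [Complex.finrank_real_complex]; norm_num)).const_mul (4 * C)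
  refine h.mono' hΦ.continuous.aestronglyMeasurable (Eventually.of_forall fun w => ?_)
  rw [Real.norm_eq_abs, Real.rpow_neg (by positivity), show (4 : ℝ) = ((4 : ℕ) : ℝ) by norm_num,
    Real.rpow_natCast]
  refine (hC w).trans ?_
  push_cast
  rw [mul_comm (4 : ℝ) C, mul_assoc]
  refine mul_le_mul_of_nonneg_left ?_ hC0
  rw [← div_eq_mul_inv, div_le_div_iff₀ (by positivity) (by positivity)]
  have h1 : (1 + ‖w‖) ^ 2 ≤ 2 * (1 + ‖w‖ ^ 2) := by nlinarith [sq_nonneg (1 - ‖w‖)]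
  calc 1 * (1 + ‖w‖) ^ 4 = ((1 + ‖w‖) ^ 2) ^ 2 := by ring
    _ ≤ (2 * (1 + ‖w‖ ^ 2)) ^ 2 := by gcongr
    _ = 4 * (1 + ‖w‖ ^ 2) ^ 2 := by ring

/-- Integration in polar coordinates; the factor `2` comes from `dt = 2 r dr`. -/
theorem Admissible.integral_circleIntegral {Φ : ℂ → ℝ} (hΦ : Admissible Φ) :
    ∫ t in Set.Ioi (0 : ℝ), circleIntegral Φ t = 2 * ∫ w : ℂ, Φ w := by
  have hcirc : ∀ r : ℝ, 0 < r → circleIntegral Φ (r ^ 2) =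
      ∫ u in Set.Ioo (-Real.pi) Real.pi, Φ (Complex.polarCoord.symm (r, u)) := by
    intro r hr
    set g : ℝ → ℝ := fun u => Φ (Complex.exp (u * Complex.I) * r) with hg
    have hgc : Continuous g := by
      have h1 : Continuous fun u : ℝ => Complex.exp (u * Complex.I) * r := by fun_prop
      exact hΦ.continuous.comp h1
    have hper : Function.Periodic g Real.pi := by
      intro u
      simp only [hg]
      rw [← hΦ.even]
      congr 1
      push_cast
      rw [add_mul, Complex.exp_add, Complex.exp_pi_mul_I]
      ring
    have h1 : circleIntegral Φ (r ^ 2) = 2 * ∫ u in (-Real.pi)..0, g u := by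
      have h2 := intervalIntegral.integral_comp_mul_left (a := 0) (b := 2 * Real.pi) g
        (c := -(1 / 2)) (by norm_num)
      rw [circleIntegral, Real.sqrt_sq hr.le]
      have h3 : ∀ t : ℝ, Φ (Complex.exp (-(t / 2) * Complex.I) * r) = g (-(1 / 2) * t) := by
        intro t
        simp only [hg]
        congr 3
        push_cast
        ring
      simp_rw [h3]
      rw [h2, show -(1 / 2) * (2 * Real.pi) = -Real.pi by ring, mul_zero,
        intervalIntegral.integral_symm, smul_eq_mul]
      norm_num
    have h4 := hper.intervalIntegral_add_eq 0 (-Real.pi)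
    rw [zero_add, neg_add_cancel] at h4
    have h5 := intervalIntegral.integral_add_adjacent_intervals
      (hgc.intervalIntegrable (μ := volume) (-Real.pi) 0) (hgc.intervalIntegrable 0 Real.pi)
    rw [h1, ← integral_Ioc_eq_integral_Ioo, ← intervalIntegral.integral_of_le
      (by linarith [Real.pi_pos])]
    have h6 : ∀ u : ℝ, Φ (Complex.polarCoord.symm (r, u)) = g u := by
      intro u
      simp only [hg, Complex.polarCoord_symm_apply, Complex.exp_mul_I]
      congr 1
      push_cast
      ring
    simp_rw [h6]
    rw [← h5, h4]
    ring
  have hint : IntegrableOn (fun p : ℝ × ℝ => p.1 • Φ (Complex.polarCoord.symm p))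
      (Set.Ioi (0 : ℝ) ×ˢ Set.Ioo (-Real.pi) Real.pi) := by
    have hm : MeasurableSet (Set.Ioi (0 : ℝ) ×ˢ Set.Ioo (-Real.pi) Real.pi) :=
      measurableSet_Ioi.prod measurableSet_Ioo
    have hc : Continuous fun p : ℝ × ℝ => p.1 • Φ (Complex.polarCoord.symm p) := by
      have h1 : Continuous fun p : ℝ × ℝ => Complex.polarCoord.symm p := by
        simp only [Complex.polarCoord_symm_apply]
        fun_prop
      exact continuous_fst.smul (hΦ.continuous.comp h1)
    refine ⟨hc.aestronglyMeasurable, ?_⟩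
    have h2 := Complex.lintegral_comp_polarCoord_symm fun w => ‖Φ w‖ₑ
    rw [polarCoord_target] at h2
    have h3 : ∫⁻ p in Set.Ioi (0 : ℝ) ×ˢ Set.Ioo (-Real.pi) Real.pi,
        ‖p.1 • Φ (Complex.polarCoord.symm p)‖ₑ = ∫⁻ w, ‖Φ w‖ₑ := by
      rw [← h2]
      refine setLIntegral_congr_fun hm fun p hp => ?_
      have hp1 : 0 < p.1 := hp.1
      simp only [smul_eq_mul]
      rw [enorm_mul, Real.enorm_of_nonneg hp1.le]
    rw [HasFiniteIntegral, h3]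
    exact hΦ.integrable.2
  rw [← Complex.integral_comp_polarCoord_symm, polarCoord_target, Measure.volume_eq_prod,
    setIntegral_prod _ hint, ← integral_comp_rpow_Ioi_of_pos (p := 2) two_pos, ← integral_const_mul]
  refine setIntegral_congr_fun measurableSet_Ioi fun r hr => ?_
  simp only [smul_eq_mul]
  rw [integral_const_mul, ← hcirc r hr, show (2 : ℝ) - 1 = 1 by norm_num, Real.rpow_one,
    Real.rpow_two, mul_assoc]

end

section

open scoped SchwartzMap FourierTransform ContDiff

/-! ### Wigner functions -/

theorem integrable_e_mul {f : ℝ → ℂ} (hf : Integrable f) (q : ℝ) :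
    Integrable fun v => e (-(v * q)) * f v :=
  hf.bdd_mul (c := 1) (Continuous.aestronglyMeasurable (by fun_prop))
    (Eventually.of_forall fun v => (norm_e _).le)

/-- The product `f(s + h) g(s - h)`. -/
def shiftProd (f g : ℝ → ℂ) (h s : ℝ) : ℂ := f (s + h) * g (s - h)

section ShiftProd

variable {f g : ℝ → ℂ}

theorem contDiff_shiftProd (hf : ContDiff ℝ ∞ f) (hg : ContDiff ℝ ∞ g) (h : ℝ) :
    ContDiff ℝ ∞ (shiftProd f g h) :=
  (hf.comp (contDiff_id.add contDiff_const)).mul (hg.comp (contDiff_id.sub contDiff_const))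

theorem hasCompactSupport_shiftProd (hf : HasCompactSupport f) (h : ℝ) :
    HasCompactSupport (shiftProd f g h) :=
  HasCompactSupport.mul_right (f := fun s => f (s + h)) (f' := fun s => g (s - h))
    (hf.comp_homeomorph (Homeomorph.addRight h))

theorem integrable_shiftProd (hf : ContDiff ℝ ∞ f) (hg : ContDiff ℝ ∞ g)
    (hfs : HasCompactSupport f) (h : ℝ) : Integrable (shiftProd f g h) :=
  (contDiff_shiftProd hf hg h).continuous.integrable_of_hasCompactSupport
    (hasCompactSupport_shiftProd hfs h)

theorem deriv_shiftProd (hf : ContDiff ℝ ∞ f) (hg : ContDiff ℝ ∞ g) (h : ℝ) :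
    deriv (shiftProd f g h) = fun s => shiftProd (deriv f) g h s + shiftProd f (deriv g) h s := by
  funext s
  have h1 : HasDerivAt (fun s => f (s + h)) (deriv f (s + h)) s :=
    ((hf.differentiable (by simp)) (s + h)).hasDerivAt.comp_add_const s h
  have h2 : HasDerivAt (fun s => g (s - h)) (deriv g (s - h)) s :=
    ((hg.differentiable (by simp)) (s - h)).hasDerivAt.comp_sub_const s h
  exact (h1.mul h2).deriv

/-- The Fourier transform of `f(s + h) g(s - h)` decays faster than any power, uniformly in `h`.
The powers are gained by partial integration. -/
theorem exists_pow_mul_fourier_shiftProd_le (n : ℕ) :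
    ∀ f g : ℝ → ℂ, ContDiff ℝ ∞ f → ContDiff ℝ ∞ g → HasCompactSupport f → HasCompactSupport g →
      ∃ C : ℝ, ∀ h q : ℝ, |q| ^ n * ‖𝓕 (shiftProd f g h) q‖ ≤ C := by
  induction n with
  | zero =>
    intro f g hf hg hfs hgs
    obtain ⟨M, hM⟩ := hg.continuous.bounded_above_of_compact_support hgs
    refine ⟨(∫ s, ‖f s‖) * M, fun h q => ?_⟩
    have hfi := (hf.continuous.integrable_of_hasCompactSupport hfs (μ := volume)).norm
    rw [pow_zero, one_mul, fourier_eq_integral_e]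
    calc ‖∫ v, e (-(v * q)) * shiftProd f g h v‖
        ≤ ∫ v, ‖f (v + h)‖ * M := by
          refine norm_integral_le_of_norm_le ((hfi.comp_add_right h).mul_const M)
            (Eventually.of_forall fun v => ?_)
          rw [norm_mul, norm_e, one_mul, shiftProd, norm_mul]
          gcongr
          exact hM _
      _ = (∫ s, ‖f s‖) * M := by
          rw [integral_mul_const, integral_add_right_eq_self fun s => ‖f s‖]
  | succ n ih =>
    intro f g hf hg hfs hgs
    have hf' : ContDiff ℝ ∞ (deriv f) := by
      have := (contDiff_infty_iff_deriv.mp hf).2; exact this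
    have hg' : ContDiff ℝ ∞ (deriv g) := (contDiff_infty_iff_deriv.mp hg).2
    obtain ⟨C₁, h₁⟩ := ih (deriv f) g hf' hg hfs.deriv hgs
    obtain ⟨C₂, h₂⟩ := ih f (deriv g) hf hg' hfs hgs.deriv
    refine ⟨C₁ + C₂, fun h q => ?_⟩
    have i1 := integrable_shiftProd hf' hg hfs.deriv h
    have i2 := integrable_shiftProd hf hg' hfs h
    have hd := Real.fourier_deriv (integrable_shiftProd hf hg hfs h)
      ((contDiff_shiftProd hf hg h).differentiable (by simp))
      (by rw [deriv_shiftProd hf hg]; exact i1.add i2)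
    have hq := congrFun hd q
    rw [deriv_shiftProd hf hg] at hq
    have hadd : 𝓕 (fun s => shiftProd (deriv f) g h s + shiftProd f (deriv g) h s) q =
        𝓕 (shiftProd (deriv f) g h) q + 𝓕 (shiftProd f (deriv g) h) q := by
      simp only [fourier_eq_integral_e, mul_add]
      exact integral_add (integrable_e_mul i1 q) (integrable_e_mul i2 q)
    rw [hadd] at hq
    have hn := congrArg norm hq
    rw [norm_smul, norm_mul, norm_mul, norm_mul, Complex.norm_I, Complex.norm_real,
      Complex.norm_real, Real.norm_eq_abs, Real.norm_eq_abs, abs_of_pos Real.pi_pos] at hn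
    have h2 : |q| * ‖𝓕 (shiftProd f g h) q‖ ≤
        ‖𝓕 (shiftProd (deriv f) g h) q‖ + ‖𝓕 (shiftProd f (deriv g) h) q‖ := by
      refine le_trans ?_ (norm_add_le _ _)
      rw [hn]
      have h3 : 1 ≤ ‖(2 : ℂ)‖ * Real.pi * 1 := by
        rw [Complex.norm_ofNat]; linarith [Real.pi_gt_three]
      have h4 : 0 ≤ |q| * ‖𝓕 (shiftProd f g h) q‖ := by positivity
      nlinarith
    calc |q| ^ (n + 1) * ‖𝓕 (shiftProd f g h) q‖
        = |q| ^ n * (|q| * ‖𝓕 (shiftProd f g h) q‖) := by ring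
      _ ≤ |q| ^ n * (‖𝓕 (shiftProd (deriv f) g h) q‖ + ‖𝓕 (shiftProd f (deriv g) h) q‖) := by
          gcongr
      _ ≤ C₁ + C₂ := by rw [mul_add]; exact add_le_add (h₁ h q) (h₂ h q)

end ShiftProd

/-- The Wigner function of `ψ`, the real part of the Fourier transform at `Re w` of
`s ↦ ψ(s + h) ψ(s - h)` with `h = Im w / 4`. -/
noncomputable def wigner (ψ : ℝ → ℝ) (w : ℂ) : ℝ :=
  (𝓕 (shiftProd (fun s => (ψ s : ℂ)) (fun s => (ψ s : ℂ)) (w.im / 4)) w.re).re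

theorem wigner_eq_integral {ψ : ℝ → ℝ} (hψ : ContDiff ℝ ∞ ψ) (hs : HasCompactSupport ψ) (w : ℂ) :
    wigner ψ w = ∫ s, Real.cos (2 * Real.pi * (s * w.re)) *
      (ψ (s + w.im / 4) * ψ (s - w.im / 4)) := by
  have hψ' : ContDiff ℝ ∞ fun s => (ψ s : ℂ) := Complex.ofRealCLM.contDiff.comp hψ
  have hs' : HasCompactSupport fun s => (ψ s : ℂ) := hs.comp_left Complex.ofReal_zero
  have hi := integrable_shiftProd hψ' hψ' hs' (w.im / 4)
  have h := integral_re (integrable_e_mul hi w.re)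
  rw [wigner, fourier_eq_integral_e]
  refine h.symm.trans ?_
  refine integral_congr_ae (Eventually.of_forall fun s => ?_)
  simp only [shiftProd, RCLike.re_eq_complex_re, ← Complex.ofReal_mul]
  rw [mul_comm (e _), Complex.re_ofReal_mul, re_e, mul_neg, Real.cos_neg, mul_comm]

theorem admissible_wigner {ψ : ℝ → ℝ} (hψ : ContDiff ℝ ∞ ψ) (hs : HasCompactSupport ψ) :
    Admissible (wigner ψ) := by
  obtain ⟨R, hR0, hR⟩ : ∃ R : ℝ, 0 < R ∧ ∀ x, R ≤ |x| → ψ x = 0 := by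
    obtain ⟨R, hR0, hR⟩ := hs.exists_pos_le_norm
    exact ⟨R, hR0, hR⟩
  have hψ' : ContDiff ℝ ∞ fun s => (ψ s : ℂ) := Complex.ofRealCLM.contDiff.comp hψ
  have hs' : HasCompactSupport fun s => (ψ s : ℂ) := hs.comp_left Complex.ofReal_zero
  refine ⟨?_, fun w => ?_, ?_⟩
  -- continuity: the integral extends over a fixed compact interval
  · have h1 : wigner ψ = fun w => ∫ s in (-R)..R,
        Real.cos (2 * Real.pi * (s * w.re)) * (ψ (s + w.im / 4) * ψ (s - w.im / 4)) := by
      funext w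
      rw [wigner_eq_integral hψ hs, intervalIntegral.integral_of_le (by linarith),
        setIntegral_eq_integral_of_forall_compl_eq_zero]
      intro s hsR
      have h2 : R ≤ |s| := by
        by_contra h
        obtain ⟨h3, h4⟩ := abs_lt.mp (not_le.mp h)
        exact hsR ⟨h3, h4.le⟩
      -- of the two points `s ± h`, one is at least as far from the origin as `s`
      have h3 : R ≤ |s + w.im / 4| ∨ R ≤ |s - w.im / 4| := by
        by_contra! h
        obtain ⟨h4, h5⟩ := h
        rw [abs_lt] at h4 h5
        have : |s| < R := abs_lt.mpr ⟨by linarith [h4.1, h5.1], by linarith [h4.2, h5.2]⟩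
        linarith
      rcases h3 with h3 | h3 <;> rw [hR _ h3] <;> ring
    rw [h1]
    refine intervalIntegral.continuous_parametric_intervalIntegral_of_continuous' ?_ _ _
    have hc := hψ.continuous
    have h2 : Continuous fun p : ℂ × ℝ => p.2 + p.1.im / 4 := by fun_prop
    have h3 : Continuous fun p : ℂ × ℝ => p.2 - p.1.im / 4 := by fun_prop
    have h4 : Continuous fun p : ℂ × ℝ => Real.cos (2 * Real.pi * (p.2 * p.1.re)) := by fun_prop
    exact h4.mul ((hc.comp h2).mul (hc.comp h3))
  · rw [wigner_eq_integral hψ hs, wigner_eq_integral hψ hs]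
    refine integral_congr_ae (Eventually.of_forall fun s => ?_)
    simp only [Complex.neg_re, Complex.neg_im]
    rw [show 2 * Real.pi * (s * -w.re) = -(2 * Real.pi * (s * w.re)) by ring, Real.cos_neg,
      show s + -w.im / 4 = s - w.im / 4 by ring, show s - -w.im / 4 = s + w.im / 4 by ring]
    ring
  -- decay: the function vanishes for large `|Im w|`, and decays in `Re w` as a Fourier transform
  · obtain ⟨C₀, h₀⟩ := exists_pow_mul_fourier_shiftProd_le 0 _ _ hψ' hψ' hs' hs'
    obtain ⟨C₄, h₄⟩ := exists_pow_mul_fourier_shiftProd_le 4 _ _ hψ' hψ' hs' hs'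
    have hC0 : 0 ≤ C₀ := le_trans (by positivity) (h₀ 0 0)
    have hC4 : 0 ≤ C₄ := le_trans (by positivity) (h₄ 0 0)
    refine ⟨2 * ((1 + (4 * R) ^ 2) ^ 2 * C₀ + C₄), by positivity, fun w => ?_⟩
    rw [mul_one_div, le_div_iff₀ (by positivity)]
    by_cases hw : 4 * R ≤ |w.im|
    · have : wigner ψ w = 0 := by
        rw [wigner_eq_integral hψ hs]
        refine integral_eq_zero_of_ae (Eventually.of_forall fun s => ?_)
        have h3 : R ≤ |s + w.im / 4| ∨ R ≤ |s - w.im / 4| := by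
          by_contra! h
          obtain ⟨h4, h5⟩ := h
          rw [abs_lt] at h4 h5
          have : |w.im| < 4 * R := abs_lt.mpr ⟨by linarith [h4.1, h5.2], by linarith [h4.2, h5.1]⟩
          linarith
        change Real.cos _ * (ψ (s + w.im / 4) * ψ (s - w.im / 4)) = 0
        rcases h3 with h3 | h3 <;> rw [hR _ h3] <;> ring
      rw [this, abs_zero, zero_mul]
      positivity
    · have h1 := h₀ (w.im / 4) w.re
      have h2 := h₄ (w.im / 4) w.re
      have h3 : |wigner ψ w| ≤ _ := Complex.abs_re_le_norm
        (𝓕 (shiftProd (fun s => (ψ s : ℂ)) (fun s => (ψ s : ℂ)) (w.im / 4)) w.re)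
      set X := ‖𝓕 (shiftProd (fun s => (ψ s : ℂ)) (fun s => (ψ s : ℂ)) (w.im / 4)) w.re‖
      have h4 : w.im ^ 2 ≤ (4 * R) ^ 2 := by
        rw [← sq_abs w.im]
        gcongr
        exact (not_le.mp hw).le
      have h5 : ‖w‖ ^ 2 = w.re ^ 2 + w.im ^ 2 := by
        rw [← Complex.normSq_eq_norm_sq, Complex.normSq_apply]; ring
      rw [pow_zero, one_mul] at h1
      have h6 : |w.re| ^ 4 = (w.re ^ 2) ^ 2 := by rw [← sq_abs w.re]; ring
      rw [h6] at h2
      have hX : 0 ≤ X := norm_nonneg _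
      calc |wigner ψ w| * (1 + ‖w‖ ^ 2) ^ 2
          ≤ X * (2 * ((1 + (4 * R) ^ 2) ^ 2 + (w.re ^ 2) ^ 2)) := by
            gcongr
            rw [h5]
            calc (1 + (w.re ^ 2 + w.im ^ 2)) ^ 2 ≤ ((1 + (4 * R) ^ 2) + w.re ^ 2) ^ 2 := by
                  gcongr ?_ ^ 2
                  linarith
              _ ≤ _ := by nlinarith [sq_nonneg ((1 + (4 * R) ^ 2) - w.re ^ 2)]
        _ = 2 * ((1 + (4 * R) ^ 2) ^ 2 * X + (w.re ^ 2) ^ 2 * X) := by ring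
        _ ≤ _ := by gcongr

theorem wigner_zero {ψ : ℝ → ℝ} (hψ : ContDiff ℝ ∞ ψ) (hs : HasCompactSupport ψ) :
    wigner ψ 0 = ∫ s, ψ s ^ 2 := by
  rw [wigner_eq_integral hψ hs]
  simp [sq]

/-- The integral over the plane, by Fourier inversion in the real part. -/
theorem integral_wigner {ψ : ℝ → ℝ} (hψ : ContDiff ℝ ∞ ψ) (hs : HasCompactSupport ψ) :
    ∫ w : ℂ, wigner ψ w = 4 * ∫ s, ψ s * ψ (-s) := by
  have hψ' : ContDiff ℝ ∞ fun s => (ψ s : ℂ) := Complex.ofRealCLM.contDiff.comp hψ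
  have hs' : HasCompactSupport fun s => (ψ s : ℂ) := hs.comp_left Complex.ofReal_zero
  have hadm := admissible_wigner hψ hs
  have hint : Integrable fun p : ℝ × ℝ => wigner ψ (Complex.measurableEquivRealProd.symm p) :=
    Complex.volume_preserving_equiv_real_prod.symm.integrable_comp_emb
      Complex.measurableEquivRealProd.symm.measurableEmbedding |>.mpr hadm.integrable
  rw [← Complex.volume_preserving_equiv_real_prod.symm.integral_comp
    Complex.measurableEquivRealProd.symm.measurableEmbedding]
  rw [Measure.volume_eq_prod] at hint ⊢
  rw [integral_prod_symm _ hint]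
  have hinner : ∀ y : ℝ, ∫ x : ℝ, wigner ψ (Complex.measurableEquivRealProd.symm (x, y)) =
      ψ (y / 4) * ψ (-(y / 4)) := by
    intro y
    set H : 𝓢(ℝ, ℂ) := (hasCompactSupport_shiftProd (g := fun s => (ψ s : ℂ)) hs'
      (y / 4)).toSchwartzMap (contDiff_shiftProd hψ' hψ' (y / 4)) with hH
    have h1 := integral_fourier_schwartz H
    have h2 : H 0 = ((ψ (y / 4) * ψ (-(y / 4)) : ℝ) : ℂ) := by
      simp [hH, shiftProd]
    have h3 := integral_re (𝓕 H).integrable (μ := volume)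
    rw [h1, h2, RCLike.re_eq_complex_re, Complex.ofReal_re] at h3
    rw [← h3]
    rfl
  simp_rw [hinner]
  have := Measure.integral_comp_div (fun s => ψ s * ψ (-s)) 4
  rw [this]
  norm_num

end

section

open scoped SchwartzMap FourierTransform ContDiff

/-! ### Theta sums as lattice sums -/

/-- The change of variables `(a, n) ↦ (n + a, n)`. -/
def differenceEquiv : ℤ × ℤ ≃ ℤ × ℤ where
  toFun p := (p.2 + p.1, p.2)
  invFun p := (p.1 - p.2, p.2)
  left_inv _ := Prod.ext (add_sub_cancel_left _ _) rfl
  right_inv _ := Prod.ext (add_sub_cancel _ _) rfl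

theorem contDiff_e : ContDiff ℝ ∞ e :=
  Complex.contDiff_exp.comp (contDiff_const.mul Complex.ofRealCLM.contDiff)

/-- The squared modulus of a series, summed over the differences `a` of the indices. -/
theorem hasSum_normSq_tsum {f : ℤ → ℂ} (hf : Summable fun n => ‖f n‖) :
    HasSum (fun a : ℤ => ∑' n : ℤ, (starRingEnd ℂ) (f (n + a)) * f n)
      ((‖∑' n, f n‖ ^ 2 : ℝ) : ℂ) := by
  have hg : Summable fun n => ‖(starRingEnd ℂ) (f n)‖ := hf.congr fun n => (RCLike.norm_conj _).symm
  have hs := summable_mul_of_summable_norm hg hf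
  have h1 : ((‖∑' n, f n‖ ^ 2 : ℝ) : ℂ) = ∑' p : ℤ × ℤ, (starRingEnd ℂ) (f p.1) * f p.2 := by
    rw [← tsum_mul_tsum_of_summable_norm hg hf, Complex.ofReal_pow, ← Complex.conj_mul',
      Complex.conj_tsum]
  have hE : HasSum (fun p : ℤ × ℤ => (starRingEnd ℂ) (f (p.2 + p.1)) * f p.2)
      (∑' p : ℤ × ℤ, (starRingEnd ℂ) (f p.1) * f p.2) := differenceEquiv.hasSum_iff.mpr hs.hasSum
  rw [h1]
  refine hE.prod_fiberwise fun a => ?_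
  exact (hE.summable.prod_factor a).hasSum

/-- The sign character arises from the shift by half an integer in
`n² - (n + a)² = -2 a (n + a / 2)`. -/
theorem e_half_mul (a m : ℤ) : e (m * a / 2) = (thetaSign ![2 * a, m] : ℂ) := by
  have h4 : (4 : ℤ) ∣ 2 * a ↔ (2 : ℤ) ∣ a := by omega
  simp only [thetaSign, Matrix.cons_val_zero, Matrix.cons_val_one, Matrix.cons_val_fin_one,
    dvd_mul_right, if_true, h4]
  split_ifs with h
  · obtain ⟨k, hk⟩ : (2 : ℤ) ∣ m * a := by
      rcases h with h | h
      · exact h.mul_left m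
      · exact h.mul_right a
    have : ((m * a / 2 : ℝ)) = (k : ℤ) := by
      rw [← Int.cast_mul, hk]; push_cast; ring
    rw [this, e_intCast]; simp
  · rw [not_or] at h
    obtain ⟨k, hk⟩ : Odd (m * a) :=
      (Int.not_even_iff_odd.mp fun h' => h.2 h'.two_dvd).mul
        (Int.not_even_iff_odd.mp fun h' => h.1 h'.two_dvd)
    have : ((m * a / 2 : ℝ)) = (k : ℤ) + 1 / 2 := by
      rw [← Int.cast_mul, hk]; push_cast; ring
    rw [this, e_add, e_intCast, e,
      show (2 * Real.pi * Complex.I * ((1 / 2 : ℝ) : ℂ) : ℂ) = Real.pi * Complex.I by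
        push_cast; ring, Complex.exp_pi_mul_I]
    simp

/-- The Fourier transform of a function that is translated, rescaled and modulated. -/
theorem integral_modulated (k : ℝ → ℂ) {r : ℝ} (hr : 0 < r) (b c m : ℝ) :
    ∫ t, e (-(t * m)) * (e (-(c * t)) * k ((t + b) * r)) =
      (1 / r : ℂ) * (e ((c + m) * b) * 𝓕 k ((c + m) / r)) := by
  set g : ℝ → ℂ := fun v => e (-(v * ((c + m) / r))) * k v with hg
  have h1 : ∀ t : ℝ, e (-(t * m)) * (e (-(c * t)) * k ((t + b) * r)) =
      e ((c + m) * b) * g ((t + b) * r) := by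
    intro t
    simp only [hg]
    rw [← mul_assoc, ← mul_assoc, ← e_add, ← e_add]
    congr 2
    field_simp
    ring
  simp_rw [h1]
  rw [integral_const_mul, integral_add_right_eq_self fun t => g (t * r),
    Measure.integral_comp_mul_right, fourier_eq_integral_e, abs_of_pos (inv_pos.mpr hr),
    Complex.real_smul]
  push_cast
  ring

/-- The theta sum `∑ ψ(n√y) e(n² x)` at `z = x + iy`. -/
noncomputable def thetaSum (ψ : ℝ → ℝ) (z : ℍ) : ℂ :=
  ∑' n : ℤ, (ψ (n * Real.sqrt z.im) : ℂ) * e ((n : ℝ) ^ 2 * z.re)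

/-- The contribution of a fixed difference `a` to `|∑ ψ(n√y) e(n² x)|²`, transformed by Poisson
summation. -/
theorem tsum_correlation {ψ : ℝ → ℝ} (hψ : ContDiff ℝ ∞ ψ) (hs : HasCompactSupport ψ) (z : ℍ)
    (a : ℤ) :
    (∑' n : ℤ, (starRingEnd ℂ) ((ψ ((n + a : ℤ) * Real.sqrt z.im) : ℂ) *
        e (((n + a : ℤ) : ℝ) ^ 2 * z.re)) *
        ((ψ (n * Real.sqrt z.im) : ℂ) * e ((n : ℝ) ^ 2 * z.re))).re =
      1 / Real.sqrt z.im * ∑' m : ℤ,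
        thetaSign ![2 * a, m] * wigner ψ (latticePt ![2 * a, m] z) := by
  have hψ' : ContDiff ℝ ∞ fun s => (ψ s : ℂ) := Complex.ofRealCLM.contDiff.comp hψ
  have hs' : HasCompactSupport fun s => (ψ s : ℂ) := hs.comp_left Complex.ofReal_zero
  have hr : 0 < Real.sqrt z.im := Real.sqrt_pos.mpr z.im_pos
  have hrr := Real.mul_self_sqrt z.im_pos.le
  set x := z.re with hx
  set r := Real.sqrt z.im with hrdef
  -- with `t = n + a / 2` the arguments of `ψ` are `t r ± a r / 2`
  set k := shiftProd (fun s => (ψ s : ℂ)) (fun s => (ψ s : ℂ)) (a * r / 2) with hk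
  set G : ℝ → ℂ := fun t => e (-(2 * a * x * t)) * k ((t + a / 2) * r) with hG
  have hGs : ContDiff ℝ ∞ G := by
    refine ContDiff.mul ?_ ((contDiff_shiftProd hψ' hψ' _).comp ?_)
    · have h1 : ContDiff ℝ ∞ fun t : ℝ => -(2 * a * x * t) := by fun_prop
      exact contDiff_e.comp h1
    · fun_prop
  have hGc : HasCompactSupport G := by
    refine HasCompactSupport.mul_left ?_
    exact (hasCompactSupport_shiftProd hs' _).comp_homeomorph
      ((Homeomorph.addRight (a / 2 : ℝ)).trans (Homeomorph.mulRight₀ r hr.ne'))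
  set H : 𝓢(ℝ, ℂ) := hGc.toSchwartzMap hGs with hH
  have hHG : ∀ t, H t = G t := fun t => rfl
  have hfour : ∀ m : ℤ, 𝓕 (H : ℝ → ℂ) m =
      (1 / r : ℂ) * (e ((2 * a * x + m) * (a / 2)) * 𝓕 k ((2 * a * x + m) / r)) := by
    intro m
    rw [fourier_eq_integral_e, ← integral_modulated k hr]
    rfl
  have hpoisson := SchwartzMap.tsum_eq_tsum_fourier H 0
  simp only [zero_add, SchwartzMap.fourier_coe] at hpoisson
  have hterm : ∀ n : ℤ, (starRingEnd ℂ) ((ψ ((n + a : ℤ) * r) : ℂ) *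
        e (((n + a : ℤ) : ℝ) ^ 2 * x)) * ((ψ (n * r) : ℂ) * e ((n : ℝ) ^ 2 * x)) =
      e (-(a ^ 2 * x)) * H n := by
    intro n
    rw [hHG, hG, hk, map_mul, star_e, Complex.conj_ofReal]
    simp only [shiftProd]
    rw [show ((n : ℝ) + a / 2) * r + a * r / 2 = ((n + a : ℤ) : ℝ) * r by push_cast; ring,
      show ((n : ℝ) + a / 2) * r - a * r / 2 = n * r by ring]
    have : e (-(((n + a : ℤ) : ℝ) ^ 2 * x)) * e ((n : ℝ) ^ 2 * x) =
        e (-(a ^ 2 * x)) * e (-(2 * a * x * n)) := by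
      rw [← e_add, ← e_add]
      congr 1
      push_cast
      ring
    linear_combination ((ψ (((n + a : ℤ) : ℝ) * r) : ℂ) * (ψ (n * r) : ℂ)) * this
  have hval : ∀ m : ℤ, e (-(a ^ 2 * x)) * 𝓕 (H : ℝ → ℂ) m =
      ((1 / r * thetaSign ![2 * a, m] : ℝ) : ℂ) * 𝓕 k ((2 * a * x + m) / r) := by
    intro m
    have h1 : e (-(a ^ 2 * x)) * e ((2 * a * x + m) * (a / 2)) = thetaSign ![2 * a, m] := by
      rw [← e_half_mul, ← e_add]
      congr 1
      ring
    rw [hfour]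
    push_cast
    linear_combination ((1 / r : ℂ) * 𝓕 k ((2 * a * x + m) / r)) * h1
  have hsum : Summable fun m : ℤ => e (-(a ^ 2 * x)) * 𝓕 (H : ℝ → ℂ) m := by
    have := summable_schwartz_int (𝓕 H) 1 one_pos
    simp only [div_one] at this
    exact this.mul_left _
  simp_rw [hterm]
  rw [tsum_mul_left, hpoisson]
  simp only [QuotientAddGroup.mk_zero, fourier_eval_zero, mul_one]
  rw [← tsum_mul_left, Complex.re_tsum hsum, ← tsum_mul_left]
  refine tsum_congr fun m => ?_
  rw [hval, Complex.re_ofReal_mul, wigner, mul_assoc]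
  have hpt : latticePt ![2 * a, m] z =
      (((2 * a * x + m) / r : ℝ) : ℂ) + ((2 * a * r : ℝ) : ℂ) * Complex.I := by
    have hz : (z : ℂ) = (x : ℂ) + ((r * r : ℝ) : ℂ) * Complex.I := by
      rw [hrr, hx]
      exact (Complex.re_add_im (z : ℂ)).symm
    have hrc : (r : ℂ) ≠ 0 := by exact_mod_cast hr.ne'
    rw [latticePt, hz, ← hrdef]
    simp only [Matrix.cons_val_zero, Matrix.cons_val_one, Matrix.cons_val_fin_one]
    push_cast
    field_simp
    ring
  have hre : (latticePt ![2 * a, m] z).re = (2 * a * x + m) / r := by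
    rw [hpt, Complex.add_re, Complex.re_ofReal_mul, Complex.ofReal_re, Complex.I_re]; ring
  have him : (latticePt ![2 * a, m] z).im = 2 * a * r := by
    rw [hpt, Complex.add_im, Complex.im_ofReal_mul, Complex.ofReal_im, Complex.I_im]; ring
  rw [hre, him, show 2 * a * r / 4 = a * r / 2 by ring]

theorem summable_norm_theta {ψ : ℝ → ℝ} (hψ : ContDiff ℝ ∞ ψ) (hs : HasCompactSupport ψ) (z : ℍ) :
    Summable fun n : ℤ => ‖(ψ (n * Real.sqrt z.im) : ℂ) * e ((n : ℝ) ^ 2 * z.re)‖ := by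
  have hψ' : ContDiff ℝ ∞ fun s => (ψ s : ℂ) := Complex.ofRealCLM.contDiff.comp hψ
  have hs' : HasCompactSupport fun s => (ψ s : ℂ) := hs.comp_left Complex.ofReal_zero
  have hr : 0 < Real.sqrt z.im := Real.sqrt_pos.mpr z.im_pos
  have := (summable_schwartz_int (hs'.toSchwartzMap hψ') (1 / Real.sqrt z.im)
    (by positivity)).norm
  refine this.congr fun n => ?_
  rw [norm_mul, norm_e, mul_one]
  change ‖(ψ (n / (1 / Real.sqrt z.im)) : ℂ)‖ = _
  rw [div_div_eq_mul_div, div_one]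

/-- The lattice sum of a Wigner function at angle zero is the square of a theta sum. -/
theorem latticeSum_wigner {ψ : ℝ → ℝ} (hψ : ContDiff ℝ ∞ ψ) (hs : HasCompactSupport ψ) (z : ℍ) :
    latticeSum (wigner ψ) z 0 = Real.sqrt z.im * ‖thetaSum ψ z‖ ^ 2 := by
  have hr : Real.sqrt z.im ≠ 0 := (Real.sqrt_pos.mpr z.im_pos).ne'
  have h1 := Complex.hasSum_re (hasSum_normSq_tsum (summable_norm_theta hψ hs z))
  simp only [tsum_correlation hψ hs z, Complex.ofReal_re] at h1
  have hsum := (admissible_wigner hψ hs).summable z 0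
  have h2 : latticeSum (wigner ψ) z 0 =
      ∑' a : ℤ, ∑' m : ℤ, thetaSign ![2 * a, m] * wigner ψ (latticePt ![2 * a, m] z) := by
    simp only [Complex.ofReal_zero, zero_div, neg_zero, zero_mul, Complex.exp_zero, one_mul] at hsum
    simp only [latticeSum, Complex.ofReal_zero, zero_div, neg_zero, zero_mul, Complex.exp_zero,
      one_mul]
    have hs2 : Summable fun p : ℤ × ℤ => (thetaSign ((finTwoArrowEquiv ℤ).symm p) : ℝ) *
        wigner ψ (latticePt ((finTwoArrowEquiv ℤ).symm p) z) :=
      (finTwoArrowEquiv ℤ).symm.summable_iff.mpr hsum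
    rw [← (finTwoArrowEquiv ℤ).symm.tsum_eq, hs2.tsum_prod]
    have hinj : Function.Injective fun a : ℤ => 2 * a := mul_right_injective₀ two_ne_zero
    rw [← hinj.tsum_eq]
    · rfl
    -- the rows with odd `c` have sign zero
    · intro c hc
      by_contra h
      refine hc ?_
      have h2c : ¬ (2 : ℤ) ∣ c := fun ⟨a, ha⟩ => h ⟨a, ha.symm⟩
      refine (tsum_congr fun m => ?_).trans tsum_zero
      have : thetaSign ![c, m] = 0 := by simp [thetaSign, h2c]
      simp [this]
  rw [h2]
  have h3 := h1.tsum_eq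
  rw [tsum_mul_left] at h3
  rw [thetaSum, ← h3]
  field_simp

end

section

open scoped SchwartzMap FourierTransform ContDiff

/-! ### Mean squares of smoothed theta sums from equidistribution -/

theorem thetaSum_of_odd {ψ : ℝ → ℝ} (hodd : ∀ x, ψ (-x) = -ψ x) (z : ℍ) : thetaSum ψ z = 0 := by
  have h : thetaSum ψ z = -thetaSum ψ z := by
    conv_lhs => rw [thetaSum, ← (Equiv.neg ℤ).tsum_eq]
    rw [thetaSum, ← tsum_neg]
    refine tsum_congr fun n => ?_
    rw [Equiv.neg_apply]
    push_cast
    rw [neg_mul, hodd, neg_sq]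
    push_cast
    ring
  exact self_eq_neg.mp h

/-- `PSE` for squares of theta sums. The constant in the formula for the average is determined by
an odd function `ψ`, for which the theta sum vanishes identically. -/
theorem tendsto_thetaSum_of_PSE {α : ℝ} (h : PSE Gamma14Bar 2 α (1 / 2)) {ψ : ℝ → ℝ}
    (hψ : ContDiff ℝ ∞ ψ) (hs : HasCompactSupport ψ) (heven : ∀ x, ψ (-x) = ψ x)
    {C₁ C₂ : ℝ} (hC₁ : 0 < C₁) (hC₂ : C₁ < C₂) {ε : ℝ} (hε : 0 < ε) :
    ∃ M₀ : ℕ, ∀ M : ℕ, M₀ ≤ M → ∀ (y : ℝ) (hy : 0 < y), C₁ * (M : ℝ) ^ (-2 : ℝ) ≤ y →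
      y ≤ C₂ * (M : ℝ) ^ (-2 : ℝ) →
      |1 / (M : ℝ) * ∑ m ∈ Finset.Icc 1 M,
        Real.sqrt y * ‖thetaSum ψ (⟨⟨(m : ℝ) * α, y⟩, hy⟩ : ℍ)‖ ^ 2 - 2 * ∫ s, ψ s ^ 2| < ε := by
  obtain ⟨F, hF, hPSE⟩ := h
  obtain ⟨κ, hκ⟩ := exists_average hF
  have havg : ∀ φ : ℝ → ℝ, ContDiff ℝ ∞ φ → HasCompactSupport φ →
      average F (tangentSum (wigner φ)) =
        (((∫ s, φ s ^ 2) + κ * (8 * ∫ s, φ s * φ (-s)) : ℝ) : ℂ) := by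
    intro φ hφ hφs
    rw [hκ _ (admissible_wigner hφ hφs), wigner_zero hφ hφs,
      (admissible_wigner hφ hφs).integral_circleIntegral, integral_wigner hφ hφs]
    congr 3
    ring
  have hval : ∀ φ : ℝ → ℝ, ContDiff ℝ ∞ φ → HasCompactSupport φ → ∀ z : ℍ,
      tangentSum (wigner φ) (z, (0 : Real.Angle)) =
        ((Real.sqrt z.im * ‖thetaSum φ z‖ ^ 2 : ℝ) : ℂ) := by
    intro φ hφ hφs z
    rw [← latticeSum_wigner hφ hφs, ← (admissible_wigner hφ hφs).tangentSum_coe,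
      Real.Angle.coe_zero]
  -- the constant is read off from the odd function `s b(s)`, `b` an even bump function
  have hκ1 : κ * 8 = 1 := by
    let b : ContDiffBump (0 : ℝ) := ⟨1, 2, one_pos, one_lt_two⟩
    set φ : ℝ → ℝ := fun s => s * b s with hφdef
    have hφ : ContDiff ℝ ∞ φ := contDiff_id.mul b.contDiff
    have hφs : HasCompactSupport φ := b.hasCompactSupport.mul_left
    have hodd : ∀ x, φ (-x) = -φ x := fun x => by
      simp only [hφdef]; rw [b.neg]; ring
    have hzero : average F (tangentSum (wigner φ)) = 0 := by
      by_contra hne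
      obtain ⟨M₀, hM₀⟩ := hPSE _ (admissible_wigner hφ hφs).testFunction 1 2 one_pos one_lt_two
        _ (norm_pos_iff.mpr hne)
      have hpos : (0 : ℝ) < ((M₀ + 1 : ℕ) : ℝ) ^ (-2 : ℝ) := Real.rpow_pos_of_pos (by positivity) _
      have := hM₀ (M₀ + 1) (by omega) _ hpos (by linarith) (by linarith)
      simp only [hval φ hφ hφs, thetaSum_of_odd hodd] at this
      simp at this
    rw [havg φ hφ hφs] at hzero
    have h2 : (∫ s, φ s ^ 2) + κ * (8 * ∫ s, φ s * φ (-s)) = 0 := by exact_mod_cast hzero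
    have h3 : ∫ s, φ s * φ (-s) = -∫ s, φ s ^ 2 := by
      rw [← integral_neg]
      refine integral_congr_ae (Eventually.of_forall fun s => ?_)
      simp only [hodd]
      ring
    have h4 : 0 < ∫ s, φ s ^ 2 := by
      have hc : Continuous fun s => φ s ^ 2 := hφ.continuous.pow 2
      refine hc.integral_pos_of_hasCompactSupport_nonneg_nonzero ?_ (fun s => sq_nonneg _)
        (x := 1) ?_
      · exact hφs.comp_left (g := fun x : ℝ => x ^ 2) (by norm_num)
      · have : b 1 = 1 := b.one_of_mem_closedBall (by simp [b])
        simp [hφdef, this]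
    rw [h3] at h2
    have h5 : (∫ s, φ s ^ 2) * (1 - κ * 8) = 0 := by linarith
    rcases mul_eq_zero.mp h5 with h5 | h5
    · exact absurd h5 h4.ne'
    · linarith
  have havg2 : average F (tangentSum (wigner ψ)) = ((2 * ∫ s, ψ s ^ 2 : ℝ) : ℂ) := by
    rw [havg ψ hψ hs]
    have : ∫ s, ψ s * ψ (-s) = ∫ s, ψ s ^ 2 := by
      simp only [heven, sq]
    rw [this, ← mul_assoc, hκ1]
    congr 1
    ring
  obtain ⟨M₀, hM₀⟩ := hPSE _ (admissible_wigner hψ hs).testFunction C₁ C₂ hC₁ hC₂ ε hε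
  refine ⟨M₀, fun M hM y hy h1 h2 => ?_⟩
  have h3 := hM₀ M hM y hy h1 h2
  rw [havg2] at h3
  simp only [hval ψ hψ hs] at h3
  rw [← Real.norm_eq_abs, ← Complex.norm_real]
  refine lt_of_eq_of_lt (congrArg _ ?_) h3
  push_cast
  rfl

/-! ### Smooth weights -/

/-- The weights `ψ(j/k)`, halved at `j = 0`. -/
noncomputable def halfWeight (ψ : ℝ → ℝ) (k j : ℕ) : ℝ := (if j = 0 then 1 / 2 else 1) * ψ (j / k)

theorem sum_range_eq_add_tsum {F : ℕ → ℂ} {L : ℕ} (h : ∀ j, L ≤ j → F j = 0) :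
    ∑ j ∈ Finset.range L, F j = F 0 + ∑' m : ℕ, F (m + 1) := by
  have h' : ∀ j, j ∉ Finset.range L → F j = 0 := fun j hj => h j (by simpa using hj)
  rw [← tsum_eq_sum (L := SummationFilter.unconditional ℕ) h']
  exact (summable_of_ne_finset_zero h').tsum_eq_zero_add

theorem tendsto_riemann_sum (Q : 𝓢(ℝ, ℂ)) :
    Tendsto (fun k : ℕ => ∑' m : ℕ, Q ((m + 1 : ℕ) / (k : ℝ)) * ((1 / (k : ℝ) : ℝ) : ℂ)) atTop
      (𝓝 (∫ x in Set.Ioi (0 : ℝ), Q x)) := by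
  have hk : ∀ᶠ k : ℕ in atTop, (0 : ℝ) < k :=
    (eventually_gt_atTop 0).mono fun k hk => by exact_mod_cast hk
  have hsum : ∀ (k : ℕ) (x : ℝ), ∑ m ∈ Finset.Icc 1 ⌊(k : ℝ) * x⌋₊, 1 / (k : ℝ) =
      (⌊(k : ℝ) * x⌋₊ : ℝ) / k := by
    intro k x
    rw [Finset.sum_const, Nat.card_Icc, nsmul_eq_mul, mul_one_div, Nat.add_sub_cancel]
  have h := tendsto_tsum_schwartz Q (N := fun k => (k : ℝ)) hk (c := fun k _ => 1 / (k : ℝ))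
    (fun k m => by positivity) (C := 1) (g := 1) zero_le_one
    (hk.mono fun k hk x hx => by
      rw [hsum, div_le_iff₀ hk]
      have := Nat.floor_le (mul_nonneg hk.le hx)
      linarith)
    (fun x hx => by
      simp only [hsum, one_mul]
      have h := (tendsto_nat_floor_mul_div_atTop (R := ℝ) hx.le).comp tendsto_natCast_atTop_atTop
      refine h.congr fun k => ?_
      simp only [Function.comp, mul_comm])
  simpa using h

/-- Mean values of weights obtained from a smooth function of compact support. -/
theorem tendsto_mean_weights {φ : ℝ → ℝ} (hφ : ContDiff ℝ ∞ φ) (hs : HasCompactSupport φ)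
    {R : ℕ} (hR : ∀ x : ℝ, (R : ℝ) ≤ |x| → φ x = 0) (c : ℝ) :
    Tendsto (fun k : ℕ => (1 / (k : ℝ)) *
      ∑ j ∈ Finset.range (R * k + 1), (if j = 0 then c else 1) * φ (j / k)) atTop
      (𝓝 (∫ x in Set.Ioi (0 : ℝ), φ x)) := by
  have hφ' : ContDiff ℝ ∞ fun s => (φ s : ℂ) := Complex.ofRealCLM.contDiff.comp hφ
  have hs' : HasCompactSupport fun s => (φ s : ℂ) := hs.comp_left Complex.ofReal_zero
  have h1 := tendsto_riemann_sum (hs'.toSchwartzMap hφ')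
  have h2 : Tendsto (fun k : ℕ => ((1 / (k : ℝ) * (c * φ 0) : ℝ) : ℂ)) atTop (𝓝 0) := by
    have : Tendsto (fun k : ℕ => 1 / (k : ℝ) * (c * φ 0)) atTop (𝓝 (0 * (c * φ 0))) :=
      tendsto_one_div_atTop_nhds_zero_nat.mul_const _
    rw [zero_mul] at this
    exact_mod_cast (Complex.continuous_ofReal.tendsto 0).comp this
  have h3 := h2.add h1
  have h4 : ∫ x in Set.Ioi (0 : ℝ), (hs'.toSchwartzMap hφ') x =
      ((∫ x in Set.Ioi (0 : ℝ), φ x : ℝ) : ℂ) := integral_complex_ofReal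
  rw [zero_add, h4] at h3
  have h5 := (Complex.continuous_re.tendsto _).comp h3
  rw [Complex.ofReal_re] at h5
  refine h5.congr' ?_
  filter_upwards [eventually_gt_atTop 0] with k hk
  have hk' : (0 : ℝ) < k := by exact_mod_cast hk
  have hz : ∀ j : ℕ, R * k + 1 ≤ j → (((if j = 0 then c else 1) * φ (j / k) : ℝ) : ℂ) = 0 := by
    intro j hj
    rw [hR, mul_zero, Complex.ofReal_zero]
    rw [abs_of_nonneg (by positivity), le_div_iff₀ hk']
    exact_mod_cast (by omega : R * k ≤ j)
  have h6 := sum_range_eq_add_tsum hz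
  have h7 : ((1 / (k : ℝ) * (c * φ 0) : ℝ) : ℂ) +
      ∑' m : ℕ, (hs'.toSchwartzMap hφ') ((m + 1 : ℕ) / (k : ℝ)) * ((1 / (k : ℝ) : ℝ) : ℂ) =
      ((1 / (k : ℝ) * ∑ j ∈ Finset.range (R * k + 1), (if j = 0 then c else 1) * φ (j / k) : ℝ) :
        ℂ) := by
    rw [Complex.ofReal_mul (1 / (k : ℝ)) (∑ j ∈ _, _), Complex.ofReal_sum, h6, mul_add,
      ← tsum_mul_left]
    congr 1
    · simp
    · refine tsum_congr fun m => ?_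
      rw [if_neg (by omega), one_mul, mul_comm]
      rfl
  rw [Function.comp, h7, Complex.ofReal_re]

/-- At `y = 1 / k²`, a theta sum of an even function is twice a sum over `j ≥ 0` in which the term
at `j = 0` is halved. -/
theorem trigSum_halfWeight {ψ : ℝ → ℝ} (hψ : ContDiff ℝ ∞ ψ) (hs : HasCompactSupport ψ)
    (heven : ∀ x, ψ (-x) = ψ x) {R : ℕ} (hR : ∀ x : ℝ, (R : ℝ) ≤ |x| → ψ x = 0) (α : ℝ) {k : ℕ}
    (hk : 0 < k) (m : ℕ) (hy : (0 : ℝ) < (1 / (k : ℝ)) ^ 2) :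
    2 * trigSum (Finset.range (R * k + 1)) (halfWeight ψ k) (sqFreq α) (m : ℕ) =
      thetaSum ψ (⟨⟨(m : ℝ) * α, (1 / (k : ℝ)) ^ 2⟩, hy⟩ : ℍ) := by
  have hk' : (0 : ℝ) < k := by exact_mod_cast hk
  set z : ℍ := ⟨⟨(m : ℝ) * α, (1 / (k : ℝ)) ^ 2⟩, hy⟩ with hz
  have hre : z.re = m * α := rfl
  have him : Real.sqrt z.im = 1 / k := by
    change Real.sqrt ((1 / (k : ℝ)) ^ 2) = _
    exact Real.sqrt_sq (by positivity)
  have hvan : ∀ j : ℕ, R * k + 1 ≤ j →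
      (halfWeight ψ k j : ℂ) * e (((m : ℕ) : ℤ) * sqFreq α j) = 0 := by
    intro j hj
    rw [halfWeight, hR, mul_zero, Complex.ofReal_zero, zero_mul]
    rw [abs_of_nonneg (by positivity), le_div_iff₀ hk']
    exact_mod_cast (by omega : R * k ≤ j)
  rw [trigSum, sum_range_eq_add_tsum hvan, thetaSum,
    tsum_int_split (summable_norm_theta hψ hs z).of_norm,
    him, hre]
  have h1 : ∀ n : ℕ, (ψ (((-(n + 1 : ℕ) : ℤ) : ℝ) * (1 / k)) : ℂ) *
      e (((-(n + 1 : ℕ) : ℤ) : ℝ) ^ 2 * (m * α)) =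
      (halfWeight ψ k (n + 1) : ℂ) * e (((m : ℕ) : ℤ) * sqFreq α (n + 1)) := by
    intro n
    rw [halfWeight, if_neg (by omega), sqFreq]
    push_cast
    rw [neg_mul, heven, neg_sq, one_mul, mul_one_div]
    congr 2
    ring
  have h2 : ∀ n : ℕ, (ψ ((((n + 1 : ℕ) : ℤ) : ℝ) * (1 / k)) : ℂ) *
      e ((((n + 1 : ℕ) : ℤ) : ℝ) ^ 2 * (m * α)) =
      (halfWeight ψ k (n + 1) : ℂ) * e (((m : ℕ) : ℤ) * sqFreq α (n + 1)) := by
    intro n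
    rw [halfWeight, if_neg (by omega), sqFreq]
    push_cast
    rw [one_mul, mul_one_div]
    congr 2
    ring
  simp_rw [h1, h2]
  have h3 : (halfWeight ψ k 0 : ℂ) * e (((m : ℕ) : ℤ) * sqFreq α 0) = 1 / 2 * ψ 0 := by
    simp [halfWeight, sqFreq, e_zero]
  rw [h3]
  simp [e_zero]
  ring

/-- The mean square law for smooth even weights. For the sum over `m ≤ M`, `M = ⌊k x⌋`, the
ordinate `y = 1 / k²` is comparable to `M⁻²`. -/
theorem meanSquareLaw_of_PSE {α : ℝ} (h : PSE Gamma14Bar 2 α (1 / 2)) {ψ : ℝ → ℝ}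
    (hψ : ContDiff ℝ ∞ ψ) (hs : HasCompactSupport ψ) (heven : ∀ x, ψ (-x) = ψ x)
    (hnn : ∀ x, 0 ≤ ψ x) {R : ℕ} (hR : ∀ x : ℝ, (R : ℝ) ≤ |x| → ψ x = 0) :
    MeanSquareLaw α id (halfWeight ψ) (fun k => R * k + 1) (∫ x in Set.Ioi (0 : ℝ), ψ x)
      (∫ x in Set.Ioi (0 : ℝ), ψ x ^ 2) := by
  refine ⟨fun k j => ?_, tendsto_mean_weights hψ hs hR _, ?_, fun x hx => ?_⟩
  · unfold halfWeight
    have := hnn (j / k)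
    split_ifs <;> positivity
  · have h2s : HasCompactSupport fun s => ψ s ^ 2 :=
      hs.comp_left (g := fun x : ℝ => x ^ 2) (by norm_num)
    -- squaring turns the factor `1 / 2` at `j = 0` into `1 / 4`
    have h1 := tendsto_mean_weights (φ := fun s => ψ s ^ 2) (R := R) (hψ.pow 2) h2s
      (fun x hx => by simp only [hR x hx]; norm_num) (1 / 4)
    refine h1.congr fun k => ?_
    simp only [id]
    congr 1
    refine Finset.sum_congr rfl fun j _ => ?_
    rw [halfWeight, mul_pow]
    split_ifs <;> norm_num
  · have hI : ∫ s, ψ s ^ 2 = 2 * ∫ x in Set.Ioi (0 : ℝ), ψ x ^ 2 := by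
      rw [← integral_comp_abs (f := fun s => ψ s ^ 2)]
      refine integral_congr_ae (Eventually.of_forall fun s => ?_)
      rcases abs_choice s with h' | h' <;> simp only [h', heven]
    set I := ∫ x in Set.Ioi (0 : ℝ), ψ x ^ 2 with hIdef
    have hfloor : Tendsto (fun k : ℕ => (⌊(k : ℝ) * x⌋₊ : ℝ) / k) atTop (𝓝 x) := by
      have h := (tendsto_nat_floor_mul_div_atTop (R := ℝ) hx.le).comp tendsto_natCast_atTop_atTop
      refine h.congr fun k => ?_
      simp only [Function.comp, mul_comm]
    have hfl : Tendsto (fun k : ℕ => ⌊(k : ℝ) * x⌋₊) atTop atTop :=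
      tendsto_nat_floor_atTop.comp (tendsto_natCast_atTop_atTop.atTop_mul_const hx)
    set S : ℕ → ℝ := fun k => 1 / (⌊(k : ℝ) * x⌋₊ : ℝ) * ∑ m ∈ Finset.Icc 1 ⌊(k : ℝ) * x⌋₊,
      k * (4 * weylMass α id (halfWeight ψ) (fun k => R * k + 1) k (m : ℕ)) with hS
    have hlim : Tendsto S atTop (𝓝 (2 * ∫ s, ψ s ^ 2)) := by
      rw [Metric.tendsto_atTop']
      intro ε hε
      obtain ⟨M₀, hM₀⟩ := tendsto_thetaSum_of_PSE h hψ hs heven (C₁ := x ^ 2 / 4) (C₂ := x ^ 2)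
        (by positivity) (by nlinarith) hε
      -- as `M / k` lies between `x / 2` and `x`, `y = (M / k)² M⁻²` lies in the range of `PSE`
      have hev : ∀ᶠ k : ℕ in atTop, M₀ ≤ ⌊(k : ℝ) * x⌋₊ ∧ 0 < k ∧
          x / 2 < (⌊(k : ℝ) * x⌋₊ : ℝ) / k :=
        (hfl.eventually_ge_atTop M₀).and ((eventually_gt_atTop 0).and
          (hfloor.eventually_const_lt (by linarith)))
      obtain ⟨k₀, hk₀⟩ := eventually_atTop.mp hev
      refine ⟨k₀, fun k hk => ?_⟩
      obtain ⟨h1, h2, h3⟩ := hk₀ k hk.le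
      have hk' : (0 : ℝ) < k := by exact_mod_cast h2
      have hy : (0 : ℝ) < (1 / (k : ℝ)) ^ 2 := by positivity
      have h4 : (⌊(k : ℝ) * x⌋₊ : ℝ) / k ≤ x := by
        rw [div_le_iff₀ hk', mul_comm x]
        exact Nat.floor_le (by positivity)
      set M := ⌊(k : ℝ) * x⌋₊ with hM
      have hMpos : (0 : ℝ) < M := by
        have h5 : 0 < (M : ℝ) / k := lt_trans (by positivity) h3
        exact (div_pos_iff_of_pos_right hk').mp h5
      have hrp : (M : ℝ) ^ (-2 : ℝ) = 1 / (M : ℝ) ^ 2 := by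
        rw [Real.rpow_neg hMpos.le, Real.rpow_two, one_div]
      have hq : (1 / (k : ℝ)) ^ 2 = ((M : ℝ) / k) ^ 2 * (1 / (M : ℝ) ^ 2) := by
        field_simp
      have h6 := hM₀ M h1 _ hy
        (by rw [hrp, hq]; gcongr; nlinarith) (by rw [hrp, hq]; gcongr)
      rw [Real.dist_eq, hS]
      refine lt_of_eq_of_lt (congrArg _ ?_) h6
      refine congrArg (fun t => 1 / (M : ℝ) * t - 2 * ∫ s, ψ s ^ 2)
        (Finset.sum_congr rfl fun m _ => ?_)
      rw [← trigSum_halfWeight hψ hs heven hR α h2 m hy, norm_mul, mul_pow,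
        Real.sqrt_sq (by positivity), weylMass, Complex.norm_ofNat]
      simp only [id]
      field_simp
      ring
    have hfin := (hfloor.mul hlim).div_const 4
    rw [hI] at hfin
    refine (hfin.congr' ?_).trans_eq ?_
    · filter_upwards [eventually_gt_atTop 0, hfl.eventually_gt_atTop 0] with k hk hM
      have hk' : (k : ℝ) ≠ 0 := by exact_mod_cast hk.ne'
      have hM' : (⌊(k : ℝ) * x⌋₊ : ℝ) ≠ 0 := by exact_mod_cast hM.ne'
      simp only [hS, id]
      rw [← Finset.mul_sum, ← Finset.mul_sum]
      field_simp
    · congr 1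
      ring

/-! ### Pair correlation from equidistribution -/

/-- Pair correlation from equidistribution: the indicator function of `(0, 1]` is approximated by
smooth even functions, restricted to the half-line. -/
theorem tendsto_pairCorrelation_of_PSE {α : ℝ} (h : PSE Gamma14Bar 2 α (1 / 2)) (A B : ℝ)
    (hAB : A ≤ B) : Tendsto (fun N : ℕ => pairCorrelation A B α N) atTop (𝓝 (B - A)) := by
  refine tendsto_pairCorrelation_of_weights (u := id) tendsto_id ?_ ?_ A B hAB
  · intro δ hδ
    set η := min 1 (δ / 3) with hη
    have hη0 : 0 < η := by positivity
    have hη1 : η ≤ 1 := min_le_left _ _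
    have hηδ : η ≤ δ / 3 := min_le_right _ _
    -- an even bump function that is one on `[-1, 1]`
    let b : ContDiffBump (0 : ℝ) := ⟨1, 1 + η, one_pos, by linarith⟩
    have hvan : ∀ x : ℝ, 1 + η ≤ |x| → b x = 0 := fun x hx =>
      b.zero_of_le_dist (by rw [Real.dist_eq, sub_zero]; exact hx)
    have hlaw := meanSquareLaw_of_PSE h (ψ := b) b.contDiff b.hasCompactSupport b.neg b.nonneg'
      (R := 2) (fun x hx => hvan x (by push_cast at hx; linarith))
    refine ⟨_, _, _, _, hlaw, fun k j hj => ?_, ?_⟩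
    · obtain ⟨hj1, hjk⟩ := Finset.mem_Icc.mp hj
      simp only [id] at hjk
      refine ⟨?_, by omega⟩
      have hk : (0 : ℝ) < k := by exact_mod_cast (by omega : 0 < k)
      rw [halfWeight, if_neg (by omega), one_mul, b.one_of_mem_closedBall]
      rw [Metric.mem_closedBall, Real.dist_eq, sub_zero, abs_of_nonneg (by positivity),
        div_le_one hk]
      exact_mod_cast hjk
    · have h0 : 0 ≤ ∫ x in Set.Ioi (0 : ℝ), b x := integral_nonneg b.nonneg'
      have h1 : ∫ x in Set.Ioi (0 : ℝ), b x ≤ 1 + η := by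
        have hle : ∀ x, b x ≤ (Set.Iic (1 + η)).indicator (1 : ℝ → ℝ) x := by
          intro x
          by_cases hx : x ∈ Set.Iic (1 + η)
          · rw [Set.indicator_of_mem hx]; exact b.le_one
          · rw [Set.indicator_of_notMem hx, hvan x ((not_le.mp hx).le.trans (le_abs_self x))]
        calc ∫ x in Set.Ioi (0 : ℝ), b x
            ≤ ∫ x in Set.Ioi (0 : ℝ), (Set.Iic (1 + η)).indicator (1 : ℝ → ℝ) x := by
              refine integral_mono_of_nonneg (Eventually.of_forall b.nonneg') ?_
                (Eventually.of_forall hle)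
              rw [integrable_indicator_iff measurableSet_Iic, IntegrableOn,
                Measure.restrict_restrict measurableSet_Iic, Set.inter_comm, Set.Ioi_inter_Iic]
              exact integrable_const 1
          _ = 1 + η := by
              rw [integral_indicator_one measurableSet_Iic, Measure.real,
                Measure.restrict_apply measurableSet_Iic, Set.inter_comm, Set.Ioi_inter_Iic,
                Real.volume_Ioc, sub_zero, ENNReal.toReal_ofReal (by positivity)]
      nlinarith
  · intro δ hδ
    set η := min (1 / 4) (δ / 4) with hη
    have hη0 : 0 < η := by positivity
    have hη1 : η ≤ 1 / 4 := min_le_left _ _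
    have hηδ : η ≤ δ / 4 := min_le_right _ _
    -- a weight below the indicator function of `[1, N]` has to vanish at `j = 0`
    let b : ContDiffBump (0 : ℝ) := ⟨1 - η, 1, by linarith, by linarith⟩
    let b' : ContDiffBump (0 : ℝ) := ⟨η / 2, η, by linarith, by linarith⟩
    set ψ : ℝ → ℝ := fun x => b x * (1 - b' x) with hψdef
    have hψ : ContDiff ℝ ∞ ψ := b.contDiff.mul (contDiff_const.sub b'.contDiff)
    have hs : HasCompactSupport ψ := b.hasCompactSupport.mul_right
    have heven : ∀ x, ψ (-x) = ψ x := fun x => by simp only [hψdef]; rw [b.neg, b'.neg]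
    have hnn : ∀ x, 0 ≤ ψ x := fun x => mul_nonneg b.nonneg (sub_nonneg.mpr b'.le_one)
    have hle1 : ∀ x, ψ x ≤ 1 := fun x =>
      mul_le_one₀ b.le_one (sub_nonneg.mpr b'.le_one) (sub_le_self _ b'.nonneg)
    have hvan : ∀ x : ℝ, 1 ≤ |x| → ψ x = 0 := fun x hx => by
      simp only [hψdef]
      rw [b.zero_of_le_dist (by rw [Real.dist_eq, sub_zero]; exact hx), zero_mul]
    have hψ0 : ψ 0 = 0 := by
      have : b' 0 = 1 := b'.one_of_mem_closedBall (by simpa [b'] using (half_pos hη0).le)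
      simp only [hψdef, this]; ring
    have hlaw := meanSquareLaw_of_PSE h hψ hs heven hnn (R := 1)
      (fun x hx => hvan x (by simpa using hx))
    refine ⟨_, _, _, _, hlaw, fun k j => ?_, ?_⟩
    · rw [halfWeight]
      by_cases hj : j = 0
      · subst hj
        simp [hψ0]
      · rw [if_neg hj, one_mul]
        split_ifs with hjk
        · exact hle1 _
        · have hjk' : k < j := by
            by_contra hcon
            exact hjk (Finset.mem_Icc.mpr ⟨by omega, by simp only [id]; omega⟩)
          rcases Nat.eq_zero_or_pos k with hk | hk
          · rw [hk, Nat.cast_zero, div_zero, hψ0]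
          · have hk' : (0 : ℝ) < k := by exact_mod_cast hk
            refine (hvan _ ?_).le
            rw [abs_of_nonneg (by positivity), one_le_div hk']
            exact_mod_cast hjk'.le
    · have h1 : 1 - 2 * η ≤ ∫ x in Set.Ioi (0 : ℝ), ψ x := by
        have hone : ∀ x ∈ Set.Icc η (1 - η), ψ x = 1 := by
          intro x hx
          have hx0 : 0 < x := hη0.trans_le hx.1
          have e1 : b x = 1 := b.one_of_mem_closedBall (by
            rw [Metric.mem_closedBall, Real.dist_eq, sub_zero, abs_of_pos hx0]; exact hx.2)
          have e2 : b' x = 0 := b'.zero_of_le_dist (by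
            rw [Real.dist_eq, sub_zero, abs_of_pos hx0]; exact hx.1)
          simp only [hψdef, e1, e2]; norm_num
        calc 1 - 2 * η = ∫ x in Set.Icc η (1 - η), ψ x := by
              rw [setIntegral_congr_fun measurableSet_Icc hone]
              simp only [integral_const, MeasurableSet.univ, measureReal_restrict_apply,
                Set.univ_inter, smul_eq_mul, mul_one]
              rw [Real.volume_real_Icc_of_le (by linarith)]
              ring
          _ ≤ ∫ x in Set.Ioi (0 : ℝ), ψ x :=
              setIntegral_mono_set (hψ.continuous.integrable_of_hasCompactSupport hs).integrableOn
                (Eventually.of_forall hnn)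
                (LE.le.eventuallyLE fun x hx => Set.mem_Ioi.mpr (hη0.trans_le hx.1))
      nlinarith

end

end HorocyclePSE

theorem mainTheorem5 :
    (∀ α : ℝ, HorocyclePSE.PSE HorocyclePSE.Gamma14Bar 2 α (1 / 2) →
      ∀ a b : ℝ, a ≤ b →
        Filter.Tendsto (fun N : ℕ => HorocyclePSE.pairCorrelation a b α N)
          Filter.atTop (nhds (b - a))) ∧
    (∀ᵐ α : ℝ ∂(MeasureTheory.volume : MeasureTheory.Measure ℝ),
      ∀ a b : ℝ, a ≤ b →
        Filter.Tendsto (fun N : ℕ => HorocyclePSE.pairCorrelation a b α N)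
          Filter.atTop (nhds (b - a))) := by
  exact ⟨fun _ h a b hab => HorocyclePSE.tendsto_pairCorrelation_of_PSE h a b hab,
    HorocyclePSE.ae_tendsto_pairCorrelation⟩
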